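/- Let $(X,d)$ be a compact metric space and $\mu$ a Borel probability measure on $X$ with $\mu(U)>0$ for every non-empty open set $U$. Let $(\mathcal E,\operatorname{Dom}\mathcal E)$ be a symmetric, strictly (strongly) local, regular Dirichlet form on $L^2(X,\mu)$ that admits a carré du champ $\Gamma$, normalized by $\mathcal E(f,g)=\int\Gamma(f,g)\,d\mu$. Let $\Delta\le 0$ be its generator and $P_t=e^{t\Delta}$ the heat semigroup. Let $\mathcal H$ be the Hilbert space of $L^2$ one-forms, i.e. the Hausdorff completion of $(C(X)\cap\operatorname{Dom}\mathcal E)\otimes\mathcal B_b(X)$, where $\mathcal B_b(X)$ is the space of bounded Borel functions, for the scalar product $\langle f_1\otimes g_1,f_2\otimes g_2\rangle_{\mathcal H}=\int g_1g_2\,\Gamma(f_1,f_2)\,d\mu$. Let $\|\eta\|_{\mathcal H_x}$ be the fibrewise norm of $\eta\in\mathcal H$ (defined for $\mu$-almost every $x$, with $\|\sum_i f_i\otimes g_i\|_{\mathcal H_x}^2=\sum_{i,j}g_i(x)g_j(x)\Gamma(f_i,f_j)(x)$ on finite sums, and extended by continuity to a map $\mathcal H\to L^2(X,\mu)$). Let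 $\partial:L^2(X,\mu)\to\mathcal H$ be the closure of $f\mapsto f\otimes 1$, $\partial^*$ its adjoint, $\vec\Delta=-\partial\partial^*$ and $\vec P_t=e^{t\vec\Delta}$. Assume that: (i) (semigroup domination) there is a constant $C_1\ge 1$ such that for all $\eta\in\mathcal H$ and $0\le t\le 1$, $\|\vec P_t\eta\|_{\mathcal H_x}\le C_1\,(P_t\|\eta\|_{\mathcal H_\cdot})(x)$ for $\mu$-almost every $x$; (ii) $P_t$ has a heat kernel, $P_tf(x)=\int_X p_t(x,y)f(y)\,d\mu(y)$ for $t>0$ and $f\in L^2(X,\mu)$, which is jointly continuous in $(t,x,y)\in(0,\infty)\times X\times X$ and satisfies $\inf_{x,y}p_t(x,y)>0$ for some $t>0$; (iii) for some constant $Q>1$, $\sup_{x,y\in X,\ t\in(0,1]}t^{Q/2}p_t(x,y)<\infty$. For a bounded Borel function $f$ let $\operatorname{Var}f=\sup\{\langle f,\partial^*\eta\rangle_{L^2}:\eta\in\operatorname{Dom}\partial^*,\ \|\eta\|_{\mathcal H_x}\le 1\text{ for }\mu\text{-a.e. }x\}$, and for a Borel set $E\subset X$ let $P(E)=\operatorname{Var}\mathbf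 1_E$; $E$ is called a Caccioppoli set if $P(E)<\infty$. Then there exist constants $C_{\mathrm{iso}},\mu_{\max}>0$ such that every Caccioppoli set $E\subset X$ with $\mu(E)\le\mu_{\max}$ satisfies \[ \mu(E)^{\frac{Q-1}{Q}}\le C_{\mathrm{iso}}\,P(E). \] -/

import Mathlib

open MeasureTheory Filter Topology Set
open scoped ENNReal TensorProduct

noncomputable section

/-! ### Dirichlet forms on a compact metric measure space -/

/-- A symmetric Dirichlet form on `L²(X, μ)`: a densely defined, nonnegative, closed symmetric
bilinear form on which the unit contraction operates. -/
structure DirichletForm (X : Type*) [MeasurableSpace X] (μ : Measure X) where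
  /-- The domain, a linear subspace of `L²(X, μ)`. -/
  dom : Submodule ℝ (Lp ℝ 2 μ)
  /-- The bilinear form on the domain. -/
  form : dom →ₗ[ℝ] dom →ₗ[ℝ] ℝ
  dense_dom : Dense (dom : Set (Lp ℝ 2 μ))
  symm : ∀ u v : dom, form u v = form v u
  nonneg : ∀ u : dom, 0 ≤ form u u
  /-- The domain is complete for the norm `(form u u + ‖u‖²)^(1/2)`. -/
  closed : ∀ u : ℕ → dom,
    (∀ ε > 0, ∃ N, ∀ m ≥ N, ∀ n ≥ N, form (u m - u n) (u m - u n) + ‖u m - u n‖ ^ 2 < ε) →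
    ∃ v : dom, Tendsto (fun n => form (u n - v) (u n - v) + ‖u n - v‖ ^ 2) atTop (𝓝 0)
  /-- The Markov property, for `v = (0 ∨ u) ∧ 1`. -/
  markov : ∀ (u : dom) (v : Lp ℝ 2 μ),
    (∀ᵐ x ∂μ, v x = max 0 (min ((u : Lp ℝ 2 μ) x) 1)) →
    ∃ hv : v ∈ dom, form ⟨v, hv⟩ ⟨v, hv⟩ ≤ form u u

/-- The linear space of bounded Borel functions on `X`. -/
def BoundedBorel (X : Type*) [MeasurableSpace X] : Submodule ℝ (X → ℝ) where
  carrier := {g | Measurable g ∧ ∃ M : ℝ, ∀ x, |g x| ≤ M}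
  zero_mem' := ⟨measurable_const, 0, fun x => by simp⟩
  add_mem' := by
    rintro f g ⟨hf, M, hM⟩ ⟨hg, N, hN⟩
    exact ⟨hf.add hg, M + N, fun x => (abs_add_le _ _).trans (add_le_add (hM x) (hN x))⟩
  smul_mem' := by
    rintro c f ⟨hf, M, hM⟩
    refine ⟨hf.const_smul c, |c| * M, fun x => ?_⟩
    rw [Pi.smul_apply, smul_eq_mul, abs_mul]
    exact mul_le_mul_of_nonneg_left (hM x) (abs_nonneg c)

/-- The constant function `1` as a bounded Borel function. -/
def BoundedBorel.one (X : Type*) [MeasurableSpace X] : BoundedBorel X :=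
  ⟨fun _ => 1, measurable_const, 1, fun _ => by simp⟩

namespace DirichletForm

variable {X : Type*} [MetricSpace X] [CompactSpace X] [MeasurableSpace X] [BorelSpace X]
  {μ : Measure X} [IsProbabilityMeasure μ]

/-- `C(X) ∩ Dom 𝓔`, as a space of continuous functions. -/
def core (E : DirichletForm X μ) : Submodule ℝ C(X, ℝ) :=
  E.dom.comap (ContinuousMap.toLp (E := ℝ) 2 μ ℝ).toLinearMap

/-- The map sending a continuous function in the domain to its class in `Dom 𝓔 ⊆ L²`. -/
def coreToDom (E : DirichletForm X μ) : E.core →ₗ[ℝ] E.dom :=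
  (ContinuousMap.toLp (E := ℝ) 2 μ ℝ).toLinearMap.restrict (fun _ h => h)

/-- Regularity: `C(X) ∩ Dom 𝓔` is uniformly dense in `C(X)`, and dense in `Dom 𝓔` for the norm
`(𝓔(u,u) + ‖u‖²)^(1/2)`. -/
def IsRegular (E : DirichletForm X μ) : Prop :=
  Dense (E.core : Set C(X, ℝ)) ∧
  ∀ (u : E.dom), ∀ ε > 0, ∃ f : E.core,
    E.form (u - E.coreToDom f) (u - E.coreToDom f) + ‖u - E.coreToDom f‖ ^ 2 < ε

/-- Strict (strong) locality: `𝓔(u,v) = 0` whenever `v` is constant on a neighbourhood `U` of the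
support of `u`. Here `K` is a closed set which contains the support of `u`. -/
def IsStrictlyLocal (E : DirichletForm X μ) : Prop :=
  ∀ (u v : E.dom) (K U : Set X) (c : ℝ), IsClosed K → IsOpen U → K ⊆ U →
    (∀ᵐ x ∂μ, x ∉ K → (u : Lp ℝ 2 μ) x = 0) →
    (∀ᵐ x ∂μ, x ∈ U → (v : Lp ℝ 2 μ) x = c) → E.form u v = 0

/-- Essentially bounded elements of `L²`. -/
def IsEssBounded (u : Lp ℝ 2 μ) : Prop := ∃ M : ℝ, ∀ᵐ x ∂μ, |u x| ≤ M

/-- `w` is the product `u * v`. -/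
def IsProduct (w u v : Lp ℝ 2 μ) : Prop := ∀ᵐ x ∂μ, w x = u x * v x

/-- The graph of the generator `Δ`: `u ∈ Dom Δ` and `Δ u = w` iff `u ∈ Dom 𝓔` and
`𝓔(u, φ) = -⟨w, φ⟩` for all `φ ∈ Dom 𝓔`. -/
def IsLaplacian (E : DirichletForm X μ) (u w : Lp ℝ 2 μ) : Prop :=
  ∃ hu : u ∈ E.dom, ∀ φ : E.dom, E.form ⟨u, hu⟩ φ = -inner ℝ w (φ : Lp ℝ 2 μ)

end DirichletForm

/-! ### Strongly continuous semigroups -/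

/-- `S` is a strongly continuous semigroup of bounded operators whose generator has graph `A`. -/
structure IsSemigroupGeneratedBy {H : Type*} [NormedAddCommGroup H] [NormedSpace ℝ H]
    (S : ℝ → H →L[ℝ] H) (A : H → H → Prop) : Prop where
  zero : S 0 = ContinuousLinearMap.id ℝ H
  add : ∀ s t : ℝ, 0 ≤ s → 0 ≤ t → S (s + t) = (S s).comp (S t)
  tendsto_zero : ∀ u : H, Tendsto (fun t => S t u) (𝓝[>] 0) (𝓝 u)
  generator : ∀ u w : H, A u w ↔ Tendsto (fun t : ℝ => t⁻¹ • (S t u - u)) (𝓝[>] 0) (𝓝 w)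

/-- The strongly continuous semigroup `exp(tA)`, `t ≥ 0`, generated by the operator with graph `A`.
A strongly continuous semigroup is determined by its generator, so there is nothing to choose for
`t ≥ 0`; for self-adjoint nonpositive operators it exists. -/
def semigroupGeneratedBy {H : Type*} [NormedAddCommGroup H] [NormedSpace ℝ H]
    (A : H → H → Prop) : ℝ → H →L[ℝ] H :=
  Classical.epsilon fun S => IsSemigroupGeneratedBy S A

/-! ### Carré du champ -/

/-- A carré du champ of `𝓔`: a positive symmetric continuous bilinear map
`Γ : Dom 𝓔 × Dom 𝓔 → L¹(X, μ)` with
`𝓔(fh, g) + 𝓔(gh, f) - 𝓔(h, fg) = 2 ∫ h Γ(f, g) dμ` for all bounded `f, g, h ∈ Dom 𝓔`.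
(Products of bounded elements of the domain are in the domain.) -/
structure CarreDuChamp {X : Type*} [MeasurableSpace X] {μ : Measure X}
    (E : DirichletForm X μ) where
  /-- The bilinear map. -/
  toFun : E.dom →ₗ[ℝ] E.dom →ₗ[ℝ] Lp ℝ 1 μ
  symm : ∀ f g, toFun f g = toFun g f
  nonneg : ∀ f, 0 ≤ toFun f f
  continuous : ∃ C : ℝ, ∀ f, ‖toFun f f‖ ≤ C * (E.form f f + ‖f‖ ^ 2)
  identity : ∀ f g h fg fh gh : E.dom,
    DirichletForm.IsEssBounded (f : Lp ℝ 2 μ) → DirichletForm.IsEssBounded (g : Lp ℝ 2 μ) →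
    DirichletForm.IsEssBounded (h : Lp ℝ 2 μ) →
    DirichletForm.IsProduct (fg : Lp ℝ 2 μ) f g → DirichletForm.IsProduct (fh : Lp ℝ 2 μ) f h →
    DirichletForm.IsProduct (gh : Lp ℝ 2 μ) g h →
    E.form fh g + E.form gh f - E.form h fg
      = 2 * ∫ x, (h : Lp ℝ 2 μ) x * toFun f g x ∂μ

/-! ### The Hilbert space of `L²` one-forms -/

section Auxiliary

variable {X : Type*} [MeasurableSpace X] {μ : Measure X}

/-- Multiplication of classes of measurable functions, as a bilinear map. -/
def aeMul (μ : Measure X) : (X →ₘ[μ] ℝ) →ₗ[ℝ] (X →ₘ[μ] ℝ) →ₗ[ℝ] (X →ₘ[μ] ℝ) :=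
  LinearMap.mk₂ ℝ (fun a b => a * b)
    (fun a b c => by
      refine AEEqFun.ext ?_
      filter_upwards [AEEqFun.coeFn_mul (a + b) c, AEEqFun.coeFn_add a b,
        AEEqFun.coeFn_add (a * c) (b * c), AEEqFun.coeFn_mul a c, AEEqFun.coeFn_mul b c]
        with x h1 h2 h3 h4 h5
      simp only [h1, h2, h3, h4, h5, Pi.mul_apply, Pi.add_apply]; ring)
    (fun r a c => by
      refine AEEqFun.ext ?_
      filter_upwards [AEEqFun.coeFn_mul (r • a) c, AEEqFun.coeFn_smul r a,
        AEEqFun.coeFn_smul r (a * c), AEEqFun.coeFn_mul a c] with x h1 h2 h3 h4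
      simp only [h1, h2, h3, h4, Pi.mul_apply, Pi.smul_apply, smul_eq_mul]; ring)
    (fun a b c => by
      refine AEEqFun.ext ?_
      filter_upwards [AEEqFun.coeFn_mul a (b + c), AEEqFun.coeFn_add b c,
        AEEqFun.coeFn_add (a * b) (a * c), AEEqFun.coeFn_mul a b, AEEqFun.coeFn_mul a c]
        with x h1 h2 h3 h4 h5
      simp only [h1, h2, h3, h4, h5, Pi.mul_apply, Pi.add_apply]; ring)
    (fun r a c => by
      refine AEEqFun.ext ?_
      filter_upwards [AEEqFun.coeFn_mul a (r • c), AEEqFun.coeFn_smul r c,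
        AEEqFun.coeFn_smul r (a * c), AEEqFun.coeFn_mul a c] with x h1 h2 h3 h4
      simp only [h1, h2, h3, h4, Pi.mul_apply, Pi.smul_apply, smul_eq_mul]; ring)

/-- The class of a bounded Borel function. -/
def BoundedBorel.toAE (μ : Measure X) : BoundedBorel X →ₗ[ℝ] (X →ₘ[μ] ℝ) where
  toFun g := AEEqFun.mk (g : X → ℝ) g.2.1.aestronglyMeasurable
  map_add' _ _ := rfl
  map_smul' _ _ := rfl

theorem BoundedBorel.coeFn_toAE (g : BoundedBorel X) :
    (BoundedBorel.toAE μ g : X → ℝ) =ᵐ[μ] (g : X → ℝ) :=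
  AEEqFun.coeFn_mk g.1 g.2.1.aestronglyMeasurable

/-- The inclusion of `L¹` into the space of classes of measurable functions. -/
def l1ToAE (μ : Measure X) : Lp ℝ 1 μ →ₗ[ℝ] (X →ₘ[μ] ℝ) where
  toFun f := f
  map_add' _ _ := rfl
  map_smul' _ _ := rfl

theorem ae_bilin_nonneg {M : Type*} [AddCommGroup M] [Module ℝ M]
    (B : M →ₗ[ℝ] M →ₗ[ℝ] (X →ₘ[μ] ℝ)) (hB : ∀ m, 0 ≤ᵐ[μ] (B m m : X → ℝ))
    {ι : Type*} (S : Finset ι) (f : ι → M) :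
    ∀ᵐ x ∂μ, ∀ c : ι → ℝ, 0 ≤ ∑ i ∈ S, ∑ j ∈ S, c i * c j * B (f i) (f j) x := by
  classical
  have key : ∀ q : S → ℚ, ∀ᵐ x ∂μ,
      0 ≤ ∑ i : S, ∑ j : S, (q i : ℝ) * (q j : ℝ) * B (f i) (f j) x := by
    intro q
    have h1 := hB (∑ i : S, (q i : ℝ) • f i)
    have h2 : B (∑ i : S, (q i : ℝ) • f i) (∑ i : S, (q i : ℝ) • f i)
        = ∑ p : S × S, ((q p.1 : ℝ) * (q p.2 : ℝ)) • B (f p.1) (f p.2) := by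
      rw [Fintype.sum_prod_type]
      simp only [map_sum, LinearMap.sum_apply, map_smul, LinearMap.smul_apply]
      rw [Finset.sum_comm]
      refine Finset.sum_congr rfl fun i _ => ?_
      rw [Finset.smul_sum]
      refine Finset.sum_congr rfl fun j _ => ?_
      rw [smul_smul, mul_comm]
    rw [h2] at h1
    have h3 : ∀ᵐ x ∂μ, ∀ p : S × S,
        (((q p.1 : ℝ) * (q p.2 : ℝ)) • B (f p.1) (f p.2) : X →ₘ[μ] ℝ) x
          = (q p.1 : ℝ) * (q p.2 : ℝ) * B (f p.1) (f p.2) x := by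
      rw [ae_all_iff]
      intro p
      filter_upwards [AEEqFun.coeFn_smul ((q p.1 : ℝ) * (q p.2 : ℝ)) (B (f p.1) (f p.2))] with x hx
      rw [hx]; rfl
    filter_upwards [h1, h3, AEEqFun.coeFn_finsetSum (μ := μ) Finset.univ
      fun p : S × S => ((q p.1 : ℝ) * (q p.2 : ℝ)) • B (f p.1) (f p.2)] with x h1 h3 h4
    rw [h4] at h1
    simp only [Pi.zero_apply, Finset.sum_apply, h3] at h1
    rwa [Fintype.sum_prod_type] at h1
  filter_upwards [ae_all_iff.2 key] with x hx c
  have hcl : IsClosed {c : S → ℝ | 0 ≤ ∑ i : S, ∑ j : S, c i * c j * B (f i) (f j) x} :=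
    isClosed_le continuous_const (by fun_prop)
  have hd : DenseRange (Pi.map (fun (_ : S) (q : ℚ) => (q : ℝ))) :=
    DenseRange.piMap fun _ => Rat.denseRange_cast
  have h := hd.induction_on (p := fun c : S → ℝ =>
    0 ≤ ∑ i : S, ∑ j : S, c i * c j * B (f i) (f j) x) (fun i => c i) hcl (fun q => hx q)
  rw [← Finset.sum_coe_sort S]
  simp only [← Finset.sum_coe_sort S (fun j => _ * c j * _)]
  exact h

end Auxiliary

namespace CarreDuChamp

variable {X : Type*} [MetricSpace X] [CompactSpace X] [MeasurableSpace X] [BorelSpace X]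
  {μ : Measure X} [IsProbabilityMeasure μ] {E : DirichletForm X μ}

/-- `Γ(f, g)` for `f, g ∈ C(X) ∩ Dom 𝓔`. -/
def onCore (Γ : CarreDuChamp E) : E.core →ₗ[ℝ] E.core →ₗ[ℝ] Lp ℝ 1 μ :=
  Γ.toFun.compl₁₂ E.coreToDom E.coreToDom

/-- The space of tensors `(C(X) ∩ Dom 𝓔) ⊗ 𝓑_b(X)`. -/
def Tensors (_Γ : CarreDuChamp E) : Type _ := E.core ⊗[ℝ] BoundedBorel X

instance (Γ : CarreDuChamp E) : AddCommGroup Γ.Tensors :=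
  inferInstanceAs (AddCommGroup (E.core ⊗[ℝ] BoundedBorel X))

instance (Γ : CarreDuChamp E) : Module ℝ Γ.Tensors :=
  inferInstanceAs (Module ℝ (E.core ⊗[ℝ] BoundedBorel X))

/-- The simple tensor `f ⊗ g`. -/
def tensor (Γ : CarreDuChamp E) (f : E.core) (g : BoundedBorel X) : Γ.Tensors := f ⊗ₜ[ℝ] g

/-- The fibrewise scalar product `⟨η₁, η₂⟩_{𝓗_x}`, as a function of `x` defined almost everywhere.
It is the bilinear map with `⟨f₁ ⊗ g₁, f₂ ⊗ g₂⟩_{𝓗_x} = g₁(x) g₂(x) Γ(f₁, f₂)(x)`. -/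
def fibreInner (Γ : CarreDuChamp E) : Γ.Tensors →ₗ[ℝ] Γ.Tensors →ₗ[ℝ] (X →ₘ[μ] ℝ) :=
  (LinearMap.BilinMap.tmul (R := ℝ) (A := ℝ)
    (Γ.onCore.compr₂ (l1ToAE μ))
    ((aeMul μ).compl₁₂ (BoundedBorel.toAE μ) (BoundedBorel.toAE μ))).compr₂
      (TensorProduct.lift (aeMul μ))

theorem fibreInner_tensor (Γ : CarreDuChamp E) (f₁ f₂ : E.core) (g₁ g₂ : BoundedBorel X) :
    Γ.fibreInner (Γ.tensor f₁ g₁) (Γ.tensor f₂ g₂)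
      =ᵐ[μ] fun x => g₁.1 x * g₂.1 x * Γ.onCore f₁ f₂ x := by
  have h : Γ.fibreInner (Γ.tensor f₁ g₁) (Γ.tensor f₂ g₂)
      = (Γ.onCore f₁ f₂ : X →ₘ[μ] ℝ) * (BoundedBorel.toAE μ g₁ * BoundedBorel.toAE μ g₂) := rfl
  rw [h]
  filter_upwards [AEEqFun.coeFn_mul (Γ.onCore f₁ f₂ : X →ₘ[μ] ℝ)
      (BoundedBorel.toAE μ g₁ * BoundedBorel.toAE μ g₂),
    AEEqFun.coeFn_mul (BoundedBorel.toAE μ g₁) (BoundedBorel.toAE μ g₂),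
    BoundedBorel.coeFn_toAE (μ := μ) g₁, BoundedBorel.coeFn_toAE (μ := μ) g₂] with x h1 h2 h3 h4
  rw [h1, Pi.mul_apply, h2, Pi.mul_apply, h3, h4]; ring

theorem exists_sum (Γ : CarreDuChamp E) (v : Γ.Tensors) :
    ∃ S : Finset (E.core × BoundedBorel X), v = ∑ i ∈ S, Γ.tensor i.1 i.2 :=
  TensorProduct.exists_finset (R := ℝ) v

theorem fibreInner_symm (Γ : CarreDuChamp E) (v w : Γ.Tensors) :
    Γ.fibreInner v w = Γ.fibreInner w v := by
  obtain ⟨S, rfl⟩ := Γ.exists_sum v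
  obtain ⟨T, rfl⟩ := Γ.exists_sum w
  simp only [map_sum, LinearMap.sum_apply]
  rw [Finset.sum_comm]
  refine Finset.sum_congr rfl fun i _ => Finset.sum_congr rfl fun j _ => ?_
  refine AEEqFun.ext ?_
  filter_upwards [Γ.fibreInner_tensor j.1 i.1 j.2 i.2,
    Γ.fibreInner_tensor i.1 j.1 i.2 j.2] with x h1 h2
  rw [h1, h2]
  have : Γ.onCore j.1 i.1 = Γ.onCore i.1 j.1 := Γ.symm _ _
  rw [this]; ring

theorem fibreInner_nonneg (Γ : CarreDuChamp E) (v : Γ.Tensors) :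
    0 ≤ᵐ[μ] (Γ.fibreInner v v : X → ℝ) := by
  obtain ⟨S, rfl⟩ := Γ.exists_sum v
  have h0 : ∀ f : E.core, 0 ≤ᵐ[μ] ((Γ.onCore.compr₂ (l1ToAE μ)) f f : X → ℝ) := fun f =>
    (Lp.coeFn_nonneg _).2 (Γ.nonneg (E.coreToDom f))
  have h1 := ae_bilin_nonneg _ h0 S fun i => i.1
  have h2 : Γ.fibreInner (∑ i ∈ S, Γ.tensor i.1 i.2) (∑ i ∈ S, Γ.tensor i.1 i.2)
      = ∑ p ∈ S ×ˢ S, Γ.fibreInner (Γ.tensor p.1.1 p.1.2) (Γ.tensor p.2.1 p.2.2) := by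
    rw [Finset.sum_product]
    simp only [map_sum, LinearMap.sum_apply]
    rw [Finset.sum_comm]
  have h3 : ∀ᵐ x ∂μ, ∀ p ∈ S ×ˢ S,
      Γ.fibreInner (Γ.tensor p.1.1 p.1.2) (Γ.tensor p.2.1 p.2.2) x
        = p.1.2.1 x * p.2.2.1 x * Γ.onCore p.1.1 p.2.1 x :=
    (Finset.eventually_all (S ×ˢ S)).2 fun p _ => Γ.fibreInner_tensor p.1.1 p.2.1 p.1.2 p.2.2
  rw [h2]
  filter_upwards [h1, h3, AEEqFun.coeFn_finsetSum (μ := μ) (S ×ˢ S)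
    fun p => Γ.fibreInner (Γ.tensor p.1.1 p.1.2) (Γ.tensor p.2.1 p.2.2)] with x h1 h3 h4
  rw [h4, Finset.sum_apply, Finset.sum_congr rfl h3, Finset.sum_product]
  exact h1 fun i => i.2.1 x

theorem fibreInner_integrable (Γ : CarreDuChamp E) (v w : Γ.Tensors) :
    Integrable (Γ.fibreInner v w : X → ℝ) μ := by
  obtain ⟨S, rfl⟩ := Γ.exists_sum v
  obtain ⟨T, rfl⟩ := Γ.exists_sum w
  simp only [map_sum, LinearMap.sum_apply]
  rw [AEEqFun.integrable_coeFn]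
  refine Finset.sum_induction _ AEEqFun.Integrable (fun _ _ => AEEqFun.Integrable.add)
    AEEqFun.integrable_zero fun j _ => Finset.sum_induction _ AEEqFun.Integrable
      (fun _ _ => AEEqFun.Integrable.add) AEEqFun.integrable_zero fun i _ => ?_
  rw [← AEEqFun.integrable_coeFn]
  refine Integrable.congr ?_ (Γ.fibreInner_tensor i.1 j.1 i.2 j.2).symm
  obtain ⟨hm, M, hM⟩ := i.2.2
  obtain ⟨hn, N, hN⟩ := j.2.2
  refine (L1.integrable_coeFn (Γ.onCore i.1 j.1)).bdd_mul (c := M * N)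
    (hm.mul hn).aestronglyMeasurable (Eventually.of_forall fun x => ?_)
  rw [Real.norm_eq_abs, abs_mul]
  exact mul_le_mul (hM x) (hN x) (abs_nonneg _) ((abs_nonneg _).trans (hM x))

/-- The scalar product `⟨η₁, η₂⟩ = ∫ ⟨η₁, η₂⟩_{𝓗_x} dμ(x)` on tensors; it is nonnegative. -/
instance preCore (Γ : CarreDuChamp E) : PreInnerProductSpace.Core ℝ Γ.Tensors where
  inner v w := ∫ x, Γ.fibreInner v w x ∂μ
  conj_inner_symm v w := by
    simp only [conj_trivial]
    rw [Γ.fibreInner_symm]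
  re_inner_nonneg v := integral_nonneg_of_ae (Γ.fibreInner_nonneg v)
  add_left u v w := by
    rw [← integral_add (Γ.fibreInner_integrable u w) (Γ.fibreInner_integrable v w), map_add,
      LinearMap.add_apply]
    exact integral_congr_ae (AEEqFun.coeFn_add _ _)
  smul_left v w r := by
    simp only [conj_trivial]
    rw [← integral_const_mul, map_smul, LinearMap.smul_apply]
    exact integral_congr_ae (AEEqFun.coeFn_smul _ _)

instance (Γ : CarreDuChamp E) : SeminormedAddCommGroup Γ.Tensors :=
  InnerProductSpace.Core.toSeminormedAddCommGroup (𝕜 := ℝ)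

instance (Γ : CarreDuChamp E) : InnerProductSpace ℝ Γ.Tensors :=
  InnerProductSpace.ofCore Γ.preCore

/-- The Hilbert space `𝓗` of `L²` one-forms: the (Hausdorff) completion of the tensors. -/
abbrev OneForms (Γ : CarreDuChamp E) : Type _ := UniformSpace.Completion Γ.Tensors

/-- The fibrewise norm `x ↦ ‖η‖_{𝓗_x}` of a tensor, an element of `L²(X, μ)`. -/
def fibreNormTensor (Γ : CarreDuChamp E) (η : Γ.Tensors) : Lp ℝ 2 μ :=
  MemLp.toLp (fun x => √(Γ.fibreInner η η x)) <| by
    have hm : AEStronglyMeasurable (fun x => √(Γ.fibreInner η η x)) μ :=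
      Real.continuous_sqrt.comp_aestronglyMeasurable (Γ.fibreInner η η).aestronglyMeasurable
    rw [memLp_two_iff_integrable_sq hm]
    refine (Γ.fibreInner_integrable η η).congr ?_
    filter_upwards [Γ.fibreInner_nonneg η] with x hx
    exact (Real.sq_sqrt hx).symm

/-- The fibrewise norm is `1`-Lipschitz, hence extends to the completion. -/
theorem lipschitz_fibreNormTensor (Γ : CarreDuChamp E) :
    LipschitzWith 1 Γ.fibreNormTensor := by
  refine LipschitzWith.of_dist_le_mul fun v w => ?_
  have hfin : ∀ᵐ x ∂μ, |Γ.fibreNormTensor v x - Γ.fibreNormTensor w x|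
      ≤ |Γ.fibreNormTensor (v - w) x| := by
    have hP := ae_bilin_nonneg Γ.fibreInner Γ.fibreInner_nonneg (Finset.univ : Finset (Fin 2))
      ![v, w]
    have e1 : Γ.fibreInner (v - w) (v - w)
        = (Γ.fibreInner v v - Γ.fibreInner v w) - (Γ.fibreInner v w - Γ.fibreInner w w) := by
      simp only [map_sub, LinearMap.sub_apply, Γ.fibreInner_symm w v]
    have e2 : ∀ u, Γ.fibreNormTensor u =ᵐ[μ] fun x => √(Γ.fibreInner u u x) :=
      fun u => MemLp.coeFn_toLp _
    have e3 := AEEqFun.coeFn_sub (Γ.fibreInner v v - Γ.fibreInner v w)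
      (Γ.fibreInner v w - Γ.fibreInner w w)
    rw [← e1] at e3
    filter_upwards [hP, e2 v, e2 w, e2 (v - w), e3,
      AEEqFun.coeFn_sub (Γ.fibreInner v v) (Γ.fibreInner v w),
      AEEqFun.coeFn_sub (Γ.fibreInner v w) (Γ.fibreInner w w)] with x hP h1 h2 h3 h4 h5 h6
    rw [h1, h2, h3, h4, Pi.sub_apply, h5, h6, Pi.sub_apply, Pi.sub_apply,
      abs_of_nonneg (Real.sqrt_nonneg _)]
    simp only [Fin.sum_univ_two, Matrix.cons_val_zero, Matrix.cons_val_one,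
      Γ.fibreInner_symm w v] at hP
    generalize (Γ.fibreInner v v : X → ℝ) x = a at *
    generalize (Γ.fibreInner v w : X → ℝ) x = b at *
    generalize (Γ.fibreInner w w : X → ℝ) x = d at *
    have ha : 0 ≤ a := by simpa using hP ![1, 0]
    have hd : 0 ≤ d := by simpa using hP ![0, 1]
    have hb : b ≤ √a * √d := by
      have h := hP ![√d, -√a]
      simp only [Matrix.cons_val_zero, Matrix.cons_val_one] at h
      by_contra hlt
      push Not at hlt
      have sa := Real.sq_sqrt ha
      have sd := Real.sq_sqrt hd
      rcases (Real.sqrt_nonneg a).eq_or_lt with h0 | h0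
      · rw [← h0, zero_mul] at hlt
        have ha0 : a = 0 := by rw [← sa, ← h0]; ring
        have h' := hP ![(d + 1) / b, -1]
        simp only [Matrix.cons_val_zero, Matrix.cons_val_one, ha0] at h'
        have : (d + 1) / b * b = d + 1 := div_mul_cancel₀ _ hlt.ne'
        nlinarith
      · rcases (Real.sqrt_nonneg d).eq_or_lt with k0 | k0
        · rw [← k0, mul_zero] at hlt
          have hd0 : d = 0 := by rw [← sd, ← k0]; ring
          have h' := hP ![-1, (a + 1) / b]
          simp only [Matrix.cons_val_zero, Matrix.cons_val_one, hd0] at h'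
          have : (a + 1) / b * b = a + 1 := div_mul_cancel₀ _ hlt.ne'
          nlinarith
        · have hp := mul_pos h0 k0
          have : √d * √d * a = (√a * √d) ^ 2 := by rw [mul_pow, sa, ← sq, sd]; ring
          have : √a * √a * d = (√a * √d) ^ 2 := by rw [mul_pow, ← sq, sa, sd]
          nlinarith
    refine Real.abs_le_sqrt ?_
    nlinarith [Real.sq_sqrt ha, Real.sq_sqrt hd]
  have hn : ‖Γ.fibreNormTensor v - Γ.fibreNormTensor w‖ ≤ ‖Γ.fibreNormTensor (v - w)‖ := by
    refine Lp.norm_le_norm_of_ae_le ?_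
    filter_upwards [hfin, Lp.coeFn_sub (Γ.fibreNormTensor v) (Γ.fibreNormTensor w)] with x h1 h2
    rw [h2]; exact h1
  have hq : ‖Γ.fibreNormTensor (v - w)‖ = ‖v - w‖ := by
    rw [← sq_eq_sq₀ (norm_nonneg _) (norm_nonneg _), ← real_inner_self_eq_norm_sq,
      ← real_inner_self_eq_norm_sq, L2.inner_def]
    change _ = ∫ x, Γ.fibreInner (v - w) (v - w) x ∂μ
    refine integral_congr_ae ?_
    have e2 : Γ.fibreNormTensor (v - w) =ᵐ[μ] fun x => √(Γ.fibreInner (v - w) (v - w) x) :=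
      MemLp.coeFn_toLp _
    filter_upwards [e2, Γ.fibreInner_nonneg (v - w)] with x h1 h2
    rw [h1, real_inner_self_eq_norm_sq, Real.norm_eq_abs, sq_abs]
    exact Real.sq_sqrt h2
  rw [dist_eq_norm, dist_eq_norm, NNReal.coe_one, one_mul]
  exact hn.trans hq.le

/-- The fibrewise norm `x ↦ ‖η‖_{𝓗_x}` of a one-form, an element of `L²(X, μ)`: the continuous
extension to `𝓗` of the fibrewise norm of tensors. -/
def fibreNorm (Γ : CarreDuChamp E) : Γ.OneForms → Lp ℝ 2 μ :=
  UniformSpace.Completion.extension Γ.fibreNormTensor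

/-! ### Exterior derivative, codifferential, Laplacians, semigroups -/

/-- The graph `{(f, f ⊗ 1)}` of the exterior derivative on `C(X) ∩ Dom 𝓔`. -/
def derivGraph (Γ : CarreDuChamp E) : Submodule ℝ (Lp ℝ 2 μ × Γ.OneForms) where
  carrier := {p | ∃ f : E.core, p.1 = (E.coreToDom f : Lp ℝ 2 μ) ∧
    p.2 = ((Γ.tensor f (BoundedBorel.one X) : Γ.Tensors) : Γ.OneForms)}
  zero_mem' := ⟨0, by simp, by
    rw [tensor, TensorProduct.zero_tmul]; exact UniformSpace.Completion.coe_zero.symm⟩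
  add_mem' := by
    rintro _ _ ⟨f, hf, hf'⟩ ⟨g, hg, hg'⟩
    refine ⟨f + g, by simp [hf, hg], ?_⟩
    rw [tensor, TensorProduct.add_tmul, Prod.snd_add, hf', hg']
    exact (UniformSpace.Completion.coe_add _ _).symm
  smul_mem' := by
    rintro c _ ⟨f, hf, hf'⟩
    refine ⟨c • f, by simp [hf], ?_⟩
    rw [tensor, ← TensorProduct.smul_tmul', Prod.smul_snd, hf']
    exact (UniformSpace.Completion.coe_smul c (Γ.tensor f (BoundedBorel.one X))).symm

/-- The exterior derivative `∂`: the closure of `f ↦ f ⊗ 1`, as a closed densely defined operator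
`L²(X, μ) → 𝓗`. -/
def deriv (Γ : CarreDuChamp E) : Lp ℝ 2 μ →ₗ.[ℝ] Γ.OneForms :=
  Γ.derivGraph.topologicalClosure.toLinearPMap

/-- The codifferential `∂*`, the adjoint of the exterior derivative. -/
def coderiv (Γ : CarreDuChamp E) : Γ.OneForms →ₗ.[ℝ] Lp ℝ 2 μ := Γ.deriv.adjoint

/-- The graph of the Laplacian `-∂∂*` on one-forms. -/
def IsFormLaplacian (Γ : CarreDuChamp E) (η ζ : Γ.OneForms) : Prop :=
  ∃ (h : η ∈ Γ.coderiv.domain) (h' : Γ.coderiv ⟨η, h⟩ ∈ Γ.deriv.domain),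
    ζ = -Γ.deriv ⟨Γ.coderiv ⟨η, h⟩, h'⟩

/-- The semigroup on one-forms generated by `-∂∂*`. -/
def formSemigroup (Γ : CarreDuChamp E) : ℝ → Γ.OneForms →L[ℝ] Γ.OneForms :=
  semigroupGeneratedBy Γ.IsFormLaplacian

end CarreDuChamp

namespace DirichletForm

variable {X : Type*} [MeasurableSpace X] {μ : Measure X}

/-- The heat semigroup `P_t = exp(tΔ)` on `L²(X, μ)`. -/
def heatSemigroup (E : DirichletForm X μ) : ℝ → Lp ℝ 2 μ →L[ℝ] Lp ℝ 2 μ :=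
  semigroupGeneratedBy E.IsLaplacian

/-- `p_t(x, y)` is a heat kernel: it is jointly continuous on `(0, ∞) × X × X`, and it is the
integral kernel of the heat semigroup with respect to `μ`. -/
structure IsHeatKernel [TopologicalSpace X] (E : DirichletForm X μ) (p : ℝ → X → X → ℝ) :
    Prop where
  continuousOn : ContinuousOn (fun z : ℝ × X × X => p z.1 z.2.1 z.2.2) (Ioi 0 ×ˢ univ)
  kernel : ∀ t > 0, ∀ f : Lp ℝ 2 μ, ∀ᵐ x ∂μ, E.heatSemigroup t f x = ∫ y, p t x y * f y ∂μ

end DirichletForm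

/-! ### Semigroup domination, variation and perimeter -/

namespace CarreDuChamp

variable {X : Type*} [MetricSpace X] [CompactSpace X] [MeasurableSpace X] [BorelSpace X]
  {μ : Measure X} [IsProbabilityMeasure μ] {E : DirichletForm X μ}

/-- Semigroup domination with constant `C`:
`‖exp(-t∂∂*) η‖_{𝓗_x} ≤ C (P_t ‖η‖_{𝓗_·})(x)` for almost every `x`, all `η ∈ 𝓗`, `0 ≤ t ≤ 1`. -/
def SemigroupDomination (Γ : CarreDuChamp E) (C : ℝ) : Prop :=
  ∀ (η : Γ.OneForms) (t : ℝ), 0 ≤ t → t ≤ 1 →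
    ∀ᵐ x ∂μ, Γ.fibreNorm (Γ.formSemigroup t η) x ≤ C * E.heatSemigroup t (Γ.fibreNorm η) x

/-- `Var f`, the supremum of `⟨f, ∂*η⟩` over `η ∈ Dom ∂*` with `‖η‖_{𝓗_x} ≤ 1` almost everywhere
(the supremum is nonnegative, as `η = 0` is allowed). -/
def variation (Γ : CarreDuChamp E) (f : X → ℝ) : ℝ≥0∞ :=
  ⨆ (η : Γ.coderiv.domain) (_ : ∀ᵐ x ∂μ, Γ.fibreNorm η x ≤ 1),
    ENNReal.ofReal (∫ x, f x * Γ.coderiv η x ∂μ)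

/-- `BV(X)`: the bounded Borel functions of finite variation. -/
def BV (Γ : CarreDuChamp E) : Set (X → ℝ) := {f | f ∈ BoundedBorel X ∧ Γ.variation f < ∞}

/-- The perimeter `P(A) = Var 1_A`. -/
def perimeter (Γ : CarreDuChamp E) (A : Set X) : ℝ≥0∞ := Γ.variation (A.indicator fun _ => 1)

/-- Caccioppoli sets: Borel sets of finite perimeter. -/
def IsCaccioppoli (Γ : CarreDuChamp E) (A : Set X) : Prop :=
  MeasurableSet A ∧ (A.indicator fun _ => (1 : ℝ)) ∈ Γ.BV

end CarreDuChamp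
end

-- The proof measures how much heat leaves a set `A` in a short time, once through its perimeter and
-- once through the kernel bound.
--
-- Write `u_s = P_s 1_A`. For `0 ≤ f ≤ 1` and `0 < s ≤ 1`, semigroup domination yields the gradient
-- bound `‖∂ P_s f‖ ≤ C₁ / √s` almost everywhere (`fibreNorm_deriv_le`). Hence `(√s / C₁) ∂ u_s` is
-- an admissible field in the definition of the perimeter. Since `Δ = -∂*∂`, this gives `d/ds ⟨1_A,
-- u_s⟩ ≥ -C₁ P(A) / √s`. Integrating, `μ(A) - ⟨1_A, P_t 1_A⟩ ≤ 2 C₁ P(A) √t`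
-- (`measureReal_sub_inner_heatSemigroup_le`). The kernel bound gives `⟨1_A, P_t 1_A⟩ ≤ N t^(-Q/2)
-- μ(A)²`. At `t = (2 N μ(A))^(2/Q)` this is half of `μ(A)`, and it can be absorbed
-- (`rpow_le_of_heatContent`). The smallness of `μ(A)` is what makes `t ≤ 1`.
--
-- The gradient bound comes from a weighted reverse Poincaré inequality
-- (`mul_integral_fibreNorm_sq_le`). For a weight `0 ≤ ψ ≤ 1` the function `G(r) = ∫ P_{s-r}ψ (P_r
-- f)² dμ` has derivative `-2 ∫ P_{s-r}ψ ‖∂P_r f‖² dμ`. Because `∂ P_s f` is the form semigroup at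
-- time `s - r` applied to `∂ P_r f`, domination and Jensen's inequality show that `∫ ψ ‖∂P_s f‖²
-- dμ` is at most `C₁²` times the last integral, for each `r`. As `0 ≤ G ≤ ∫ ψ dμ` in the interior,
-- `s ∫ ψ ‖∂P_s f‖² dμ ≤ C₁² ∫ ψ dμ`, and `ψ` is arbitrary.
--
-- Three foundations carry this. First, both semigroups are specified only by their generators, so a
-- Hille-Yosida theorem, regularization and uniqueness for the Cauchy problem are proved for
-- abstract nonpositive self-adjoint operators. Secondly, `∂` and `∂*` form a closed adjoint pair
-- `G`, `G'`; von Neumann's argument makes `-G'G` and `-GG'` such operators, and `G` intertwines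
-- their semigroups. Thirdly, bounded functions in the form domain are an algebra and the heat
-- semigroup is Markovian; both follow from the unit contraction, through Riemann sums of
-- truncations and through the decrease of the distance to the positive cone.

/-! ### Nonpositive self-adjoint operators generate contraction semigroups -/

/-- The relation `A` is the graph of a nonpositive self-adjoint operator. -/
structure IsNonposSelfAdjoint {H : Type*} [NormedAddCommGroup H] [InnerProductSpace ℝ H]
    (A : H → H → Prop) : Prop where
  add : ∀ {u w v z}, A u w → A v z → A (u + v) (w + z)
  smul : ∀ (c : ℝ) {u w}, A u w → A (c • u) (c • w)
  eq_zero : ∀ {w}, A 0 w → w = 0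
  symm : ∀ {u w v z}, A u w → A v z → inner ℝ w v = inner ℝ u z
  nonpos : ∀ {u w}, A u w → inner ℝ w u ≤ 0
  surj : ∀ c > (0 : ℝ), ∀ f, ∃ u w, A u w ∧ u - c • w = f

-- Norm estimates along differentiable curves.

section DissipativeFlow

variable {H : Type*} [NormedAddCommGroup H] [InnerProductSpace ℝ H]

/-- Along a curve whose velocity has nonpositive scalar product with the position, the norm
decreases. -/
theorem norm_le_norm_of_inner_deriv_nonpos {u u' : ℝ → H} {a b : ℝ} (hab : a ≤ b)
    (hc : ContinuousOn u (Icc a b)) (hd : ∀ t ∈ Ioo a b, HasDerivAt u (u' t) t)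
    (h : ∀ t ∈ Ioo a b, inner ℝ (u' t) (u t) ≤ 0) : ‖u b‖ ≤ ‖u a‖ := by
  have hanti : AntitoneOn (fun t => ‖u t‖ ^ 2) (Icc a b) := by
    have hder : ∀ t ∈ Ioo a b, HasDerivAt (fun t => ‖u t‖ ^ 2) (2 * inner ℝ (u t) (u' t)) t :=
      fun t ht => (hd t ht).norm_sq
    refine antitoneOn_of_deriv_nonpos (convex_Icc a b) (hc.norm.pow 2) ?_ ?_
    · rw [interior_Icc]
      exact fun t ht => (hder t ht).differentiableAt.differentiableWithinAt
    · rw [interior_Icc]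
      intro t ht
      rw [(hder t ht).deriv, real_inner_comm]
      linarith [h t ht]
  have := hanti (left_mem_Icc.2 hab) (right_mem_Icc.2 hab) hab
  exact (sq_le_sq₀ (norm_nonneg _) (norm_nonneg _)).1 this

theorem norm_image_sub_le_of_hasDerivAt {F : Type*} [NormedAddCommGroup F] [NormedSpace ℝ F]
    {g g' : ℝ → F} {C t : ℝ} (ht : 0 ≤ t) (hg : ∀ r, HasDerivAt g (g' r) r)
    (hC : ∀ r, 0 ≤ r → r ≤ t → ‖g' r‖ ≤ C) : ‖g t - g 0‖ ≤ C * t := by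
  have := norm_image_sub_le_of_norm_deriv_le_segment' (f := g) (f' := g') (a := 0) (b := t)
    (fun r _ => (hg r).hasDerivWithinAt) (fun r hr => hC r hr.1 hr.2.le) t ⟨ht, le_rfl⟩
  simpa using this

end DissipativeFlow

-- Resolvents, Yosida approximation and the Hille-Yosida theorem.

namespace IsNonposSelfAdjoint

variable {H : Type*} [NormedAddCommGroup H] [InnerProductSpace ℝ H] {A : H → H → Prop}

theorem sub (hA : IsNonposSelfAdjoint A) {u w v z : H} (h : A u w) (h' : A v z) :
    A (u - v) (w - z) := by
  have := hA.add h (hA.smul (-1) h')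
  simpa [sub_eq_add_neg] using this

theorem zero (hA : IsNonposSelfAdjoint A) : A 0 0 := by
  obtain ⟨u, w, h, -⟩ := hA.surj 1 one_pos 0
  simpa using hA.smul 0 h

theorem unique (hA : IsNonposSelfAdjoint A) {u w z : H} (h : A u w) (h' : A u z) : w = z := by
  have := hA.sub h h'
  rw [sub_self] at this
  exact sub_eq_zero.1 (hA.eq_zero this)

/-- Pairing `u - c • w` with `u` gives at least `‖u‖²`, because `⟨w, u⟩ ≤ 0`. This is the
contractivity of the resolvent, and also its uniqueness. -/
theorem norm_le (hA : IsNonposSelfAdjoint A) {u w : H} (h : A u w) {c : ℝ} (hc : 0 ≤ c) :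
    ‖u‖ ≤ ‖u - c • w‖ := by
  have h1 : ‖u‖ ^ 2 ≤ inner ℝ (u - c • w) u := by
    rw [inner_sub_left, inner_smul_left, real_inner_self_eq_norm_sq]
    have := mul_nonpos_of_nonneg_of_nonpos hc (hA.nonpos h)
    simp only [conj_trivial]
    linarith
  have h2 := real_inner_le_norm (u - c • w) u
  by_contra! hlt
  have : 0 < ‖u‖ := (norm_nonneg _).trans_lt hlt
  nlinarith

/-- The domain as a submodule. -/
def domain (hA : IsNonposSelfAdjoint A) : Submodule ℝ H where
  carrier := {u | ∃ w, A u w}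
  zero_mem' := ⟨0, hA.zero⟩
  add_mem' := fun ⟨_, h⟩ ⟨_, h'⟩ => ⟨_, hA.add h h'⟩
  smul_mem' := fun c _ ⟨_, h⟩ => ⟨_, hA.smul c h⟩

/-- Solve `u - Au = z` for a vector `z` orthogonal to the domain. Pairing with `u` gives `‖u‖² =
⟨Au, u⟩ ≤ 0`, so `u` and `z` vanish. -/
theorem dense_domain [CompleteSpace H] (hA : IsNonposSelfAdjoint A) :
    Dense {u | ∃ w, A u w} := by
  change Dense (hA.domain : Set H)
  rw [Submodule.dense_iff_topologicalClosure_eq_top, Submodule.topologicalClosure_eq_top_iff,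
    Submodule.eq_bot_iff]
  intro z hz
  rw [Submodule.mem_orthogonal] at hz
  obtain ⟨u, w, h, rfl⟩ := hA.surj 1 one_pos z
  have h0 := hz u ⟨w, h⟩
  rw [one_smul, inner_sub_right, real_inner_self_eq_norm_sq, real_inner_comm] at h0
  have hu : u = 0 := by
    have := hA.nonpos h
    have h2 : ‖u‖ ^ 2 ≤ 0 := by linarith
    exact norm_eq_zero.1 (by nlinarith [norm_nonneg u])
  subst hu
  rw [hA.eq_zero h]; simp

/-- The resolvent `(1 - cA)⁻¹`. -/
theorem exists_resolvent (hA : IsNonposSelfAdjoint A) {c : ℝ} (hc : 0 < c) :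
    ∃ J : H →L[ℝ] H, (∀ f, ‖J f‖ ≤ ‖f‖) ∧ (∀ f, A (J f) (c⁻¹ • (J f - f))) ∧
      ∀ u w, A u w → J (u - c • w) = u := by
  choose u w h e using hA.surj c hc
  -- Uniqueness of solutions turns the arbitrarily chosen solution map into a linear one.
  have uniq : ∀ u w v z, A u w → A v z → u - c • w = v - c • z → u = v := by
    intro u w v z h h' e
    have h1 := hA.norm_le (hA.sub h h') hc.le
    have : u - v - c • (w - z) = 0 := by
      rw [smul_sub, sub_sub_sub_comm, e, sub_self]
    rw [this, norm_zero] at h1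
    exact sub_eq_zero.1 (norm_le_zero_iff.1 h1)
  let L : H →ₗ[ℝ] H :=
    { toFun := u
      map_add' := fun f g => uniq _ _ _ _ (h _) (hA.add (h f) (h g)) (by
        rw [e, smul_add, add_sub_add_comm, e, e])
      map_smul' := fun r f => uniq _ _ _ _ (h _) (hA.smul r (h f)) (by
        rw [e, smul_comm c r]
        change r • f = r • u f - r • c • w f
        rw [← smul_sub, e]) }
  have hL : ∀ f, ‖L f‖ ≤ 1 * ‖f‖ := fun f => by
    rw [one_mul]
    exact (hA.norm_le (h f) hc.le).trans_eq (by rw [e])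
  refine ⟨L.mkContinuous 1 hL, fun f => by simpa using hL f, fun f => ?_, fun v z hvz => ?_⟩
  · have : c⁻¹ • (u f - f) = w f := by
      nth_rewrite 2 [← e f]
      rw [sub_sub_cancel, smul_smul, inv_mul_cancel₀ hc.ne', one_smul]
    change A (u f) (c⁻¹ • (u f - f))
    rw [this]; exact h f
  · exact uniq _ _ _ _ (h _) hvz (e _)

variable [CompleteSpace H]

/-- A family of Yosida approximations: bounded operators `Y n`, with their exponentials. -/
theorem exists_yosida (hA : IsNonposSelfAdjoint A) :
    ∃ Y : ℕ → H →L[ℝ] H, (∀ m n, Commute (Y m) (Y n)) ∧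
      (∀ n u, inner ℝ (Y n u) u ≤ 0) ∧ (∀ n u w, A u w → ‖Y n u‖ ≤ ‖w‖) ∧
      (∀ u w, A u w → Tendsto (fun n => Y n u) atTop (𝓝 w)) := by
  have hc : ∀ n : ℕ, 0 < ((n : ℝ) + 1)⁻¹ := fun n => by positivity
  choose J hJn hJ hJ' using fun n : ℕ => hA.exists_resolvent (hc n)
  -- The Yosida operator `(n + 1)(J n - 1)` equals `J n A` on the domain; both its bound and its
  -- limit are read off from this.
  have e1 : ∀ (n : ℕ) u w, A u w → ((n : ℝ) + 1) • (J n u - u) = J n w := by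
    intro n u w h
    have h1 := hJ' n u w h
    rw [map_sub, map_smul, sub_eq_iff_eq_add] at h1
    have h2 : J n u - u = ((n : ℝ) + 1)⁻¹ • J n w := by
      rw [sub_eq_iff_eq_add, add_comm]; exact h1
    rw [h2, smul_smul, mul_inv_cancel₀ (by positivity), one_smul]
  -- `J m (J n f)` solves the `n`-th resolvent equation with right-hand side `J m f`, hence is `J n
  -- (J m f)`.
  have hcomm : ∀ m n f, J m (J n f) = J n (J m f) := by
    intro m n f
    have h1 := hJ n f
    have h2 := hJ m (J n f)
    rw [inv_inv] at h2
    rw [e1 m _ _ h1] at h2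
    have h3 := hJ' n _ _ h2
    rw [map_smul, map_sub, smul_smul, inv_inv, inv_mul_cancel₀ (by positivity), one_smul,
      ← map_sub, ← map_sub, sub_sub_cancel] at h3
    exact h3.symm
  refine ⟨fun n => ((n : ℝ) + 1) • (J n - 1), fun m n => ?_, fun n u => ?_, fun n u w h => ?_, ?_⟩
  · refine Commute.smul_left (Commute.smul_right ?_ _) _
    exact Commute.sub_left (Commute.sub_right (ContinuousLinearMap.ext (hcomm m n))
      (Commute.one_right _)) (Commute.one_left _)
  · simp only [smul_apply, sub_apply, one_apply_eq_self, inner_smul_left, inner_sub_left, conj_trivial,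
      real_inner_self_eq_norm_sq]
    refine mul_nonpos_of_nonneg_of_nonpos (by positivity) ?_
    have := (real_inner_le_norm (J n u) u).trans
      (mul_le_mul_of_nonneg_right (hJn n u) (norm_nonneg _))
    nlinarith
  · change ‖((n : ℝ) + 1) • (J n u - u)‖ ≤ ‖w‖
    rw [e1 n u w h]
    exact hJn n w
  · have hJt : ∀ u, Tendsto (fun n => J n u) atTop (𝓝 u) := by
      intro u
      rw [Metric.tendsto_atTop]
      intro ε hε
      obtain ⟨v, ⟨w, hvw⟩, hv⟩ := hA.dense_domain.exists_dist_lt u (ε := ε / 4) (by positivity)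
      obtain ⟨N, hN⟩ := exists_nat_gt (4 * ‖w‖ / ε)
      refine ⟨N, fun n hn => ?_⟩
      have h1 : ‖J n v - v‖ ≤ ε / 4 := by
        have h2 : J n v - v = ((n : ℝ) + 1)⁻¹ • J n w := by
          rw [← e1 n v w hvw, smul_smul, inv_mul_cancel₀ (by positivity), one_smul]
        rw [h2, norm_smul, Real.norm_of_nonneg (by positivity), inv_mul_le_iff₀ (by positivity)]
        refine (hJn n w).trans ?_
        rw [div_lt_iff₀ hε] at hN
        have : (N : ℝ) ≤ n := by exact_mod_cast hn
        nlinarith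
      rw [dist_eq_norm] at hv ⊢
      have h3 : J n u - u = J n (u - v) + (J n v - v) - (u - v) := by rw [map_sub]; abel
      rw [h3]
      have := hJn n (u - v)
      have h4 := norm_sub_le (J n (u - v) + (J n v - v)) (u - v)
      have h5 := norm_add_le (J n (u - v)) (J n v - v)
      linarith
    intro u w h
    refine (hJt w).congr fun n => ?_
    exact (e1 n u w h).symm

open NormedSpace in
/-- The Hille-Yosida theorem: a nonpositive self-adjoint operator generates a strongly continuous
semigroup. -/
theorem exists_semigroup (hA : IsNonposSelfAdjoint A) :
    ∃ S, IsSemigroupGeneratedBy S A := by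
  obtain ⟨Y, hcomm, hdiss, hbd, hlim⟩ := hA.exists_yosida
  set e : ℕ → ℝ → H →L[ℝ] H := fun n t => exp (t • Y n) with he
  have hder : ∀ n t, HasDerivAt (e n) (Y n * e n t) t := fun n t =>
    hasDerivAt_exp_smul_const' (Y n) t
  have hder' : ∀ n t x, HasDerivAt (fun t => e n t x) (Y n (e n t x)) t := fun n t x =>
    (hder n t).clm_apply (hasDerivAt_const t x) |>.congr_deriv (by simp)
  have he0 : ∀ n, e n 0 = 1 := fun n => by simp [he]
  have hcontr : ∀ n t, 0 ≤ t → ∀ x, ‖e n t x‖ ≤ ‖x‖ := by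
    intro n t ht x
    have := norm_le_norm_of_inner_deriv_nonpos (u := fun t => e n t x)
      (u' := fun t => Y n (e n t x)) ht
      (fun s _ => (hder' n s x).continuousAt.continuousWithinAt) (fun s _ => hder' n s x)
      (fun s _ => hdiss n _)
    simpa [he0] using this
  have hYe : ∀ m n t x, Y m (e n t x) = e n t (Y m x) := by
    intro m n t x
    have : Commute (Y m) (e n t) := ((hcomm m n).smul_right t).exp_right
    exact congrArg (fun L : H →L[ℝ] H => L x) this.eq
  -- The curve `r ↦ e m (t - r) (e n r u)` joins `e m t u` to `e n t u`. Commutation moves both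
  -- exponentials in front of `Y n u - Y m u` in its derivative.
  have hcauchy : ∀ m n t u, 0 ≤ t → ‖e n t u - e m t u‖ ≤ ‖Y n u - Y m u‖ * t := by
    intro m n t u ht
    have hd : ∀ r, HasDerivAt (fun r => e m (t - r) (e n r u))
        (e m (t - r) (e n r (Y n u - Y m u))) r := by
      intro r
      have h1 : HasDerivAt (fun r => e m (t - r)) (-(Y m * e m (t - r))) r := by
        have h := (hder m (t - r)).scomp r ((hasDerivAt_id r).const_sub t)
        simpa [Function.comp_def] using h
      refine (h1.clm_apply (hder' n r u)).congr_deriv ?_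
      simp only [neg_apply, mul_apply_eq_comp, map_sub, hYe]
      abel
    have := norm_image_sub_le_of_hasDerivAt ht hd (C := ‖Y n u - Y m u‖) fun r hr hrt =>
      (hcontr m _ (sub_nonneg.2 hrt) _).trans (hcontr n r hr _)
    simpa [he0] using this
  have hsmall : ∀ n t u, 0 ≤ t → ‖e n t u - u‖ ≤ ‖Y n u‖ * t := by
    intro n t u ht
    have := norm_image_sub_le_of_hasDerivAt ht (hder' n · u) (C := ‖Y n u‖) fun r hr hrt => by
      rw [hYe]; exact hcontr n r hr _
    simpa [he0] using this
  have hconv : ∀ t, 0 ≤ t → ∀ x, ∃ y, Tendsto (fun n => e n t x) atTop (𝓝 y) := by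
    intro t ht x
    refine cauchySeq_tendsto_of_complete (Metric.cauchySeq_iff'.2 fun ε hε => ?_)
    obtain ⟨v, ⟨w, hvw⟩, hv⟩ := hA.dense_domain.exists_dist_lt x (ε := ε / 4) (by positivity)
    have hY := (hlim v w hvw).cauchySeq
    obtain ⟨N, hN⟩ := Metric.cauchySeq_iff'.1 hY (ε / (4 * (t + 1))) (by positivity)
    refine ⟨N, fun n hn => ?_⟩
    have h1 := hcauchy N n t v ht
    have h2 := hN n hn
    rw [dist_eq_norm] at h2 hv ⊢
    have h3 : ‖e n t v - e N t v‖ ≤ ε / 4 := by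
      refine h1.trans ((mul_le_mul_of_nonneg_right h2.le ht).trans ?_)
      rw [div_mul_eq_mul_div, div_le_div_iff₀ (by positivity) (by positivity)]
      nlinarith
    have h4 : e n t x - e N t x = e n t (x - v) + (e n t v - e N t v) - e N t (x - v) := by
      simp only [map_sub]; abel
    rw [h4]
    have h5 := hcontr n t ht (x - v)
    have h6 := hcontr N t ht (x - v)
    have h7 := norm_sub_le (e n t (x - v) + (e n t v - e N t v)) (e N t (x - v))
    have h8 := norm_add_le (e n t (x - v)) (e n t v - e N t v)
    linarith
  choose! L hL using hconv
  let S : ℝ → H →L[ℝ] H := fun t => if ht : 0 ≤ t then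
    continuousLinearMapOfTendsto (fun n => e n t) (f := L t)
      (tendsto_pi_nhds.2 fun x => hL t ht x) else 0
  have hS : ∀ t, 0 ≤ t → ∀ x, Tendsto (fun n => e n t x) atTop (𝓝 (S t x)) := by
    intro t ht x
    have : S t x = L t x := by simp only [S, dif_pos ht]; rfl
    rw [this]; exact hL t ht x
  have hSc : ∀ t, 0 ≤ t → ∀ x, ‖S t x‖ ≤ ‖x‖ := fun t ht x =>
    le_of_tendsto (hS t ht x).norm (Eventually.of_forall fun n => hcontr n t ht x)
  have hSsmall : ∀ t, 0 ≤ t → ∀ u w, A u w → ‖S t u - u‖ ≤ ‖w‖ * t := fun t ht u w h =>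
    le_of_tendsto ((hS t ht u).sub_const u).norm (Eventually.of_forall fun n =>
      (hsmall n t u ht).trans (mul_le_mul_of_nonneg_right (hbd n u w h) ht))
  have hgen : ∀ u w, A u w → Tendsto (fun t : ℝ => t⁻¹ • (S t u - u)) (𝓝[>] 0) (𝓝 w) := by
    intro u w h
    -- The vector `w = Au` need not lie in the domain, so the velocity `e n r w - w` is controlled
    -- through a nearby `w₁` which does.
    have hkey : ∀ t, 0 ≤ t → ∀ w₁ w₂, A w₁ w₂ →
        ‖S t u - t • w - u‖ ≤ (2 * ‖w - w₁‖ + t * ‖w₂‖) * t := by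
      intro t ht w₁ w₂ h12
      have hn : ∀ n, ‖e n t u - t • Y n u - u‖
          ≤ (2 * ‖Y n u - w‖ + (2 * ‖w - w₁‖ + t * ‖w₂‖)) * t := by
        intro n
        have := norm_image_sub_le_of_hasDerivAt (g := fun r => e n r u - r • Y n u)
          (g' := fun r => Y n (e n r u) - Y n u) ht
          (C := 2 * ‖Y n u - w‖ + (2 * ‖w - w₁‖ + t * ‖w₂‖))
          (fun r => (hder' n r u).sub (by simpa using (hasDerivAt_id r).smul_const (Y n u)))
          (fun r hr hrt => by
            have e1 : Y n (e n r u) - Y n u = e n r (Y n u - w) - (Y n u - w)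
                + (e n r (w - w₁) - (w - w₁)) + (e n r w₁ - w₁) := by
              rw [hYe]; simp only [map_sub]; abel
            rw [e1]
            have a1 := norm_sub_le (e n r (Y n u - w)) (Y n u - w)
            have a2 := norm_sub_le (e n r (w - w₁)) (w - w₁)
            have a3 := hcontr n r hr (Y n u - w)
            have a4 := hcontr n r hr (w - w₁)
            have a5 := hsmall n r w₁ hr
            have a6 := hbd n w₁ w₂ h12
            have a7 : ‖Y n w₁‖ * r ≤ t * ‖w₂‖ := by
              rw [mul_comm t]
              exact mul_le_mul a6 hrt hr (norm_nonneg _)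
            refine (norm_add₃_le).trans ?_
            linarith)
        simpa [he0] using this
      refine le_of_tendsto_of_tendsto
        (((hS t ht u).sub ((hlim u w h).const_smul t)).sub_const u).norm ?_
        (Eventually.of_forall hn)
      have h0 : Tendsto (fun n => ‖Y n u - w‖) atTop (𝓝 0) :=
        tendsto_iff_norm_sub_tendsto_zero.1 (hlim u w h)
      simpa using ((h0.const_mul 2).add_const (2 * ‖w - w₁‖ + t * ‖w₂‖)).mul_const t
    rw [Metric.tendsto_nhdsWithin_nhds]
    intro ε hε
    obtain ⟨w₁, ⟨w₂, h12⟩, hw⟩ := hA.dense_domain.exists_dist_lt w (ε := ε / 4) (by positivity)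
    refine ⟨ε / (4 * (‖w₂‖ + 1)), by positivity, fun t ht hd => ?_⟩
    rw [mem_Ioi] at ht
    rw [dist_zero_right, Real.norm_of_nonneg ht.le] at hd
    rw [dist_eq_norm] at hw ⊢
    have h1 := hkey t ht.le w₁ w₂ h12
    have h2 : t⁻¹ • (S t u - u) - w = t⁻¹ • (S t u - t • w - u) := by
      rw [sub_right_comm, smul_sub t⁻¹ _ (t • w), smul_smul, inv_mul_cancel₀ ht.ne', one_smul]
    rw [h2, norm_smul, norm_inv, Real.norm_of_nonneg ht.le, inv_mul_lt_iff₀ ht]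
    refine h1.trans_lt ?_
    rw [mul_comm t ε]
    refine mul_lt_mul_of_pos_right ?_ ht
    rw [lt_div_iff₀ (by positivity)] at hd
    nlinarith [norm_nonneg w₂]
  refine ⟨S, ⟨?_, ?_, ?_, ?_⟩⟩
  · ext x
    refine tendsto_nhds_unique (hS 0 le_rfl x) ?_
    simp [he0]
  · intro s t hs ht
    ext x
    refine tendsto_nhds_unique (hS (s + t) (add_nonneg hs ht) x) ?_
    have hadd : ∀ n, e n (s + t) x = e n s (e n t x) := by
      intro n
      simp only [he, add_smul]
      let : NormedAlgebra ℚ (H →L[ℝ] H) := .restrictScalars ℚ ℝ _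
      rw [exp_add_of_commute ((Commute.refl (Y n)).smul_left s |>.smul_right t)]
      rfl
    simp only [hadd, ContinuousLinearMap.comp_apply]
    have h1 : Tendsto (fun n => e n s (e n t x - S t x)) atTop (𝓝 0) := by
      refine squeeze_zero_norm (fun n => hcontr n s hs _) ?_
      exact tendsto_iff_norm_sub_tendsto_zero.1 (hS t ht x)
    have := h1.add (hS s hs (S t x))
    simpa using this
  · intro u
    rw [Metric.tendsto_nhdsWithin_nhds]
    intro ε hε
    obtain ⟨v, ⟨w, hvw⟩, hv⟩ := hA.dense_domain.exists_dist_lt u (ε := ε / 4) (by positivity)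
    refine ⟨ε / (4 * (‖w‖ + 1)), by positivity, fun t ht hd => ?_⟩
    rw [mem_Ioi] at ht
    rw [dist_zero_right, Real.norm_of_nonneg ht.le, lt_div_iff₀ (by positivity)] at hd
    rw [dist_eq_norm] at hv ⊢
    have e1 : S t u - u = S t (u - v) + (S t v - v) - (u - v) := by rw [map_sub]; abel
    rw [e1]
    have h1 := hSc t ht.le (u - v)
    have h2 := hSsmall t ht.le v w hvw
    have h3 := norm_sub_le (S t (u - v) + (S t v - v)) (u - v)
    have h4 := norm_add_le (S t (u - v)) (S t v - v)
    nlinarith [norm_nonneg w]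
  · refine fun u w => ⟨hgen u w, fun h => ?_⟩
    -- The generator cannot properly extend `A`. Choose `v` in the domain with `v - Av = u - w`;
    -- contractivity makes the generator dissipative at `u - v`, which forces `u = v`.
    obtain ⟨v, z, hvz, e1⟩ := hA.surj 1 one_pos (u - w)
    have h1 := h.sub (hgen v z hvz)
    have h2 : inner ℝ (w - z) (u - v) ≤ 0 := by
      refine le_of_tendsto (h1.inner (tendsto_const_nhds (x := u - v))) ?_
      filter_upwards [self_mem_nhdsWithin] with t ht
      rw [mem_Ioi] at ht
      rw [← smul_sub, sub_sub_sub_comm, ← map_sub, inner_smul_left, inner_sub_left,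
        real_inner_self_eq_norm_sq]
      refine mul_nonpos_of_nonneg_of_nonpos (by simpa using ht.le) ?_
      have := (real_inner_le_norm (S t (u - v)) (u - v)).trans
        (mul_le_mul_of_nonneg_right (hSc t ht.le (u - v)) (norm_nonneg _))
      nlinarith
    have h3 : w - z = u - v := by
      rw [one_smul] at e1
      have : w = u - (v - z) := by rw [e1]; abel
      rw [this]; abel
    rw [h3, real_inner_self_eq_norm_sq] at h2
    have h4 : u - v = 0 := norm_eq_zero.1 (by nlinarith [norm_nonneg (u - v)])
    rw [h4, sub_eq_zero] at h3
    rw [sub_eq_zero] at h4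
    rw [h3, h4]; exact hvz

end IsNonposSelfAdjoint

/-! ### Properties of the semigroup of a nonpositive self-adjoint operator -/

namespace IsSemigroupGeneratedBy

variable {H : Type*} [NormedAddCommGroup H] [InnerProductSpace ℝ H] [CompleteSpace H]
  {A : H → H → Prop} {S : ℝ → H →L[ℝ] H}

omit [CompleteSpace H] in
theorem apply_zero (hS : IsSemigroupGeneratedBy S A) (x : H) : S 0 x = x := by rw [hS.zero]; rfl

omit [CompleteSpace H] in
theorem apply_add (hS : IsSemigroupGeneratedBy S A) {s t : ℝ} (hs : 0 ≤ s) (ht : 0 ≤ t) (x : H) :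
    S (s + t) x = S s (S t x) := by rw [hS.add s t hs ht]; rfl

/-- If it failed, there would be times `t n → 0` with `‖S (t n)‖ > n`. Strong convergence at zero
bounds each orbit along them, contradicting the uniform boundedness principle. -/
theorem locally_bounded (hS : IsSemigroupGeneratedBy S A) :
    ∃ δ > 0, ∃ M, ∀ t, 0 < t → t ≤ δ → ‖S t‖ ≤ M := by
  by_contra! hcon
  choose t ht0 ht1 ht using fun n : ℕ => hcon (1 / ((n : ℝ) + 1)) (by positivity) n
  have htt : Tendsto t atTop (𝓝[>] 0) := by
    refine tendsto_nhdsWithin_iff.2 ⟨?_, Eventually.of_forall ht0⟩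
    exact squeeze_zero (fun n => (ht0 n).le) ht1 tendsto_one_div_add_atTop_nhds_zero_nat
  obtain ⟨C, hC⟩ := banach_steinhaus (g := fun n => S (t n)) fun x => by
    obtain ⟨C, hC⟩ := ((hS.tendsto_zero x).comp htt).norm.bddAbove_range
    exact ⟨C, fun n => hC ⟨n, rfl⟩⟩
  obtain ⟨n, hn⟩ := exists_nat_gt C
  exact absurd (hC n) (not_le.2 (hn.trans (ht n)))

/-- Left continuity with a moving argument. Norm bounds are available only on a short interval `(0,
δ]`, so `t - k` is split as `(t - d) + (d - k)` with the first time fixed and the second in that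
interval. -/
theorem tendsto_left (hS : IsSemigroupGeneratedBy S A) {t : ℝ} (ht : 0 < t) {y : ℝ → H} {z : H}
    (hy : Tendsto y (𝓝[>] 0) (𝓝 z)) : Tendsto (fun k => S (t - k) (y k)) (𝓝[>] 0) (𝓝 (S t z)) := by
  obtain ⟨δ, hδ, M, hM⟩ := hS.locally_bounded
  set d := min δ t with hd
  have hd0 : 0 < d := lt_min hδ ht
  have h1 : Tendsto (fun k => S (t - k) (y k - S k z)) (𝓝[>] 0) (𝓝 0) := by
    have h2 : Tendsto (fun k => ‖S (t - d)‖ * (M * ‖y k - S k z‖)) (𝓝[>] 0) (𝓝 0) := by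
      have := (hy.sub (hS.tendsto_zero z)).norm
      rw [sub_self, norm_zero] at this
      simpa using (this.const_mul M).const_mul ‖S (t - d)‖
    refine squeeze_zero_norm' ?_ h2
    filter_upwards [Ioo_mem_nhdsGT hd0] with k hk
    have e1 : t - k = (t - d) + (d - k) := by ring
    rw [e1, hS.apply_add (sub_nonneg.2 (min_le_right _ _)) (sub_nonneg.2 hk.2.le)]
    refine (ContinuousLinearMap.le_opNorm _ _).trans ?_
    gcongr
    refine (ContinuousLinearMap.le_opNorm _ _).trans ?_
    gcongr
    exact hM _ (sub_pos.2 hk.2) (by have := min_le_left δ t; linarith [hk.1])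
  have h3 : Tendsto (fun k => S (t - k) (y k - S k z) + S t z) (𝓝[>] 0) (𝓝 (0 + S t z)) :=
    h1.add_const _
  rw [zero_add] at h3
  refine h3.congr' ?_
  filter_upwards [Ioo_mem_nhdsGT ht] with k hk
  rw [map_sub, ← hS.apply_add (sub_nonneg.2 hk.2.le) hk.1.le, sub_add_cancel, sub_add_cancel]

omit [CompleteSpace H] in
theorem tendsto_right (hS : IsSemigroupGeneratedBy S A) {t : ℝ} (ht : 0 ≤ t) (x : H) :
    Tendsto (fun k => S (t + k) x) (𝓝[>] 0) (𝓝 (S t x)) := by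
  refine (((S t).continuous.tendsto x).comp (hS.tendsto_zero x)).congr' ?_
  filter_upwards [self_mem_nhdsWithin] with k hk
  exact (hS.apply_add ht (le_of_lt hk) x).symm

theorem continuousOn (hS : IsSemigroupGeneratedBy S A) (x : H) :
    ContinuousOn (fun t => S t x) (Ici 0) := by
  have hr : ∀ t, 0 ≤ t → ContinuousWithinAt (fun t => S t x) (Ioi t) t := by
    intro t ht
    have h1 : Tendsto (fun s => s - t) (𝓝[>] t) (𝓝[>] 0) := by
      refine tendsto_nhdsWithin_iff.2 ⟨?_, ?_⟩
      · refine Tendsto.mono_left ?_ nhdsWithin_le_nhds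
        exact (continuous_id.sub continuous_const).tendsto' _ _ (sub_self t)
      · filter_upwards [self_mem_nhdsWithin] with s hs using mem_Ioi.2 (sub_pos.2 hs)
    simpa [ContinuousWithinAt, Function.comp_def] using (hS.tendsto_right ht x).comp h1
  intro t ht
  rcases (mem_Ici.1 ht).eq_or_lt with rfl | ht0
  · exact continuousWithinAt_Ioi_iff_Ici.1 (hr 0 le_rfl)
  · refine ContinuousAt.continuousWithinAt ?_
    refine continuousAt_iff_continuous_left'_right'.2 ⟨?_, hr t ht⟩
    have h1 : Tendsto (fun s => t - s) (𝓝[<] t) (𝓝[>] 0) := by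
      refine tendsto_nhdsWithin_iff.2 ⟨?_, ?_⟩
      · refine Tendsto.mono_left ?_ nhdsWithin_le_nhds
        exact (continuous_const.sub continuous_id).tendsto' _ _ (sub_self t)
      · filter_upwards [self_mem_nhdsWithin] with s hs using mem_Ioi.2 (sub_pos.2 hs)
    have := (hS.tendsto_left ht0 (tendsto_const_nhds (x := x))).comp h1
    simpa [ContinuousWithinAt, Function.comp_def] using this

omit [CompleteSpace H] in
theorem generator_apply (hS : IsSemigroupGeneratedBy S A) {u w : H} (h : A u w) {t : ℝ}
    (ht : 0 ≤ t) : A (S t u) (S t w) := by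
  rw [hS.generator]
  refine (((S t).continuous.tendsto w).comp ((hS.generator u w).1 h)).congr' ?_
  filter_upwards [self_mem_nhdsWithin] with k hk
  rw [Function.comp_apply, map_smul, map_sub, ← hS.apply_add ht (le_of_lt hk),
    ← hS.apply_add (le_of_lt hk) ht, add_comm]

/-- The left difference quotient is `S (t + k)` applied to a quotient at time zero, so operator and
argument vary together; `tendsto_left` handles this. -/
theorem hasDerivAt_of_generator (hS : IsSemigroupGeneratedBy S A) {u w : H} (h : A u w) {t : ℝ}
    (ht : 0 < t) : HasDerivAt (fun t => S t u) (S t w) t := by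
  rw [hasDerivAt_iff_tendsto_slope_zero, ← nhdsLT_sup_nhdsGT]
  have hg := (hS.generator u w).1 h
  refine Tendsto.sup ?_ ?_
  · have h1 : Tendsto (fun s : ℝ => -s) (𝓝[<] 0) (𝓝[>] 0) := by
      simpa using tendsto_neg_nhdsLT (a := (0 : ℝ))
    refine ((hS.tendsto_left ht hg).comp h1).congr' ?_
    filter_upwards [Ioo_mem_nhdsLT (neg_lt_zero.2 ht)] with k hk
    have hk1 : 0 ≤ t + k := by linarith [hk.1]
    have hk2 : 0 ≤ -k := by linarith [hk.2]
    simp only [Function.comp_apply, sub_neg_eq_add]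
    rw [map_smul, map_sub, ← hS.apply_add hk1 hk2, inv_neg, neg_smul, ← smul_neg, neg_sub]
    congr 4; ring
  · refine (((S t).continuous.tendsto w).comp hg).congr' ?_
    filter_upwards [self_mem_nhdsWithin] with k hk
    rw [Function.comp_apply, map_smul, map_sub, ← hS.apply_add ht.le (le_of_lt hk)]

variable (hA : IsNonposSelfAdjoint A)
include hA

theorem norm_apply_le (hS : IsSemigroupGeneratedBy S A) {t : ℝ} (ht : 0 ≤ t) (x : H) :
    ‖S t x‖ ≤ ‖x‖ := by
  refine hA.dense_domain.induction (P := fun x => ‖S t x‖ ≤ ‖x‖) ?_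
    (isClosed_le (by fun_prop) (by fun_prop)) x
  rintro u ⟨w, h⟩
  have := norm_le_norm_of_inner_deriv_nonpos (u := fun t => S t u) (u' := fun t => S t w) ht
    ((hS.continuousOn u).mono Icc_subset_Ici_self)
    (fun s hs => hS.hasDerivAt_of_generator h hs.1)
    (fun s hs => hA.nonpos (hS.generator_apply h hs.1.le))
  simpa [hS.apply_zero] using this

/-- For `u`, `v` in the domain, `r ↦ ⟨S r u, S (t - r) v⟩` has zero derivative by the symmetry of
`A`; its two end values are the two sides. Density does the rest. -/
theorem symm (hS : IsSemigroupGeneratedBy S A) {t : ℝ} (ht : 0 ≤ t) (x y : H) :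
    inner ℝ (S t x) y = inner ℝ x (S t y) := by
  rcases ht.eq_or_lt with rfl | ht
  · rw [hS.apply_zero, hS.apply_zero]
  refine hA.dense_domain.induction (P := fun x => inner ℝ (S t x) y = inner ℝ x (S t y)) ?_
    (isClosed_eq (by fun_prop) (by fun_prop)) x
  rintro u ⟨w, h⟩
  refine hA.dense_domain.induction (P := fun y => inner ℝ (S t u) y = inner ℝ u (S t y)) ?_
    (isClosed_eq (by fun_prop) (by fun_prop)) y
  rintro v ⟨z, h'⟩
  have hc : ContinuousOn (fun r => inner ℝ (S r u) (S (t - r) v)) (Icc 0 t) := by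
    refine ((hS.continuousOn u).mono Icc_subset_Ici_self).inner
      ((hS.continuousOn v).comp (by fun_prop) fun r hr => ?_)
    exact sub_nonneg.2 hr.2
  have hd : ∀ r ∈ Ioo 0 t, HasDerivAt (fun r => inner ℝ (S r u) (S (t - r) v)) 0 r := by
    intro r hr
    have h1 := hS.hasDerivAt_of_generator h hr.1
    have h2 : HasDerivAt (fun r => S (t - r) v) (-S (t - r) z) r := by
      have := (hS.hasDerivAt_of_generator h' (sub_pos.2 hr.2)).scomp r
        ((hasDerivAt_id r).const_sub t)
      simpa [Function.comp_def] using this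
    refine (h1.inner ℝ h2).congr_deriv ?_
    have := hA.symm (hS.generator_apply h hr.1.le) (hS.generator_apply h' (sub_pos.2 hr.2).le)
    rw [inner_neg_right, this]; ring
  obtain ⟨c, -, hc⟩ := exists_hasDerivAt_eq_slope _ (fun _ => 0) ht hc hd
  have h3 := (div_eq_zero_iff.1 hc.symm).resolve_right (by linarith)
  simp only [sub_self, hS.apply_zero, sub_zero] at h3
  linarith

/-- Analyticity of the semigroup by convexity. The function `φ(r) = ⟨S r u, u⟩` has `φ' ≤ 0` and
`φ''(r) = ‖S (r/2) w‖²`, which decreases in `r`. Convexity on `[0, t]` gives `-t φ'(t) ≤ ‖u‖²`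
(`m1`). The mean value theorem for `φ'` on `[t, 2t]` gives `t ‖S t w‖² ≤ -φ'(t)` (`m2`). Combining
the two gives `(t ‖S t w‖)² ≤ ‖u‖²`. -/
theorem norm_generator_le (hS : IsSemigroupGeneratedBy S A) {u w : H} (h : A u w) {t : ℝ}
    (ht : 0 < t) : ‖S t w‖ ≤ t⁻¹ * ‖u‖ := by
  have hsq : ∀ x r, 0 ≤ r → inner ℝ (S r x) x = ‖S (r / 2) x‖ ^ 2 := by
    intro x r hr
    have : r = r / 2 + r / 2 := by ring
    nth_rewrite 1 [this]
    rw [hS.apply_add (by positivity) (by positivity), hS.symm hA (by positivity),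
      real_inner_self_eq_norm_sq]
  have hd1 : ∀ r, 0 < r → HasDerivAt (fun r => inner ℝ (S r u) u) (inner ℝ (S r w) u) r := by
    intro r hr
    simpa using (hS.hasDerivAt_of_generator h hr).inner ℝ (hasDerivAt_const r u)
  have hd2 : ∀ r, 0 < r → HasDerivAt (fun r => inner ℝ (S r w) u) (inner ℝ (S r w) w) r := by
    intro r hr
    have h1 := (hS.hasDerivAt_of_generator h hr).inner ℝ (hasDerivAt_const r w)
    simp only [inner_zero_right, zero_add] at h1
    refine h1.congr_of_eventuallyEq ?_
    filter_upwards [lt_mem_nhds hr] with s hs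
    rw [hS.symm hA hs.le, real_inner_comm]
  have hnp : ∀ r, 0 ≤ r → inner ℝ (S r w) u ≤ 0 := by
    intro r hr
    have : r = r / 2 + r / 2 := by ring
    rw [this, hS.apply_add (by positivity) (by positivity), hS.symm hA (by positivity)]
    exact hA.nonpos (hS.generator_apply h (by positivity))
  have m1 : -inner ℝ (S t w) u * t ≤ ‖u‖ ^ 2 := by
    obtain ⟨c, hc, e⟩ := exists_hasDerivAt_eq_slope (fun r => inner ℝ (S r u) u)
      (fun r => inner ℝ (S r w) u) ht
      (((hS.continuousOn u).mono Icc_subset_Ici_self).inner continuousOn_const)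
      (fun r hr => hd1 r hr.1)
    obtain ⟨c', hc', e'⟩ := exists_hasDerivAt_eq_slope (fun r => inner ℝ (S r w) u)
      (fun r => inner ℝ (S r w) w) hc.2
      (fun r hr => (hd2 r (hc.1.trans_le hr.1)).continuousAt.continuousWithinAt)
      (fun r hr => hd2 r (hc.1.trans hr.1))
    have e1 : 0 ≤ inner ℝ (S c' w) w := by rw [hsq w c' (hc.1.trans hc'.1).le]; positivity
    rw [e', div_nonneg_iff] at e1
    have e2 : inner ℝ (S c w) u ≤ inner ℝ (S t w) u := by
      rcases e1 with h1 | h1 <;> linarith [h1.1, h1.2, hc.2]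
    rw [eq_div_iff (by linarith [hc.1, hc.2] : t - 0 ≠ 0)] at e
    simp only [sub_zero, hS.apply_zero, real_inner_self_eq_norm_sq] at e
    have := hsq u t ht.le
    nlinarith [sq_nonneg ‖S (t / 2) u‖]
  have m2 : ‖S t w‖ ^ 2 * t ≤ -inner ℝ (S t w) u := by
    obtain ⟨c, hc, e⟩ := exists_hasDerivAt_eq_slope (fun r => inner ℝ (S r w) u)
      (fun r => inner ℝ (S r w) w) (by linarith : t < 2 * t)
      (fun r hr => (hd2 r (ht.trans_le hr.1)).continuousAt.continuousWithinAt)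
      (fun r hr => hd2 r (ht.trans hr.1))
    have e1 : ‖S t w‖ ≤ ‖S (c / 2) w‖ := by
      have : t = (t - c / 2) + c / 2 := by ring
      nth_rewrite 1 [this]
      rw [hS.apply_add (by linarith [hc.2]) (by linarith [hc.1])]
      exact hS.norm_apply_le hA (by linarith [hc.2]) _
    rw [hsq w c (by linarith [hc.1]), eq_div_iff (by linarith : 2 * t - t ≠ 0)] at e
    have e2 : ‖S t w‖ ^ 2 ≤ ‖S (c / 2) w‖ ^ 2 := by gcongr
    have := hnp (2 * t) (by linarith)
    nlinarith
  have m3 : (‖S t w‖ * t) ^ 2 ≤ ‖u‖ ^ 2 := by nlinarith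
  rw [inv_mul_eq_div, le_div_iff₀ ht]
  exact (sq_le_sq₀ (by positivity) (norm_nonneg _)).1 m3

-- The graph is closed because membership is encoded by `J (u - w) = u` with the bounded resolvent
-- `J`.
omit [CompleteSpace H] in
theorem _root_.IsNonposSelfAdjoint.mem_of_tendsto {u w : ℕ → H} {u₀ w₀ : H}
    (h : ∀ n, A (u n) (w n)) (hu : Tendsto u atTop (𝓝 u₀)) (hw : Tendsto w atTop (𝓝 w₀)) :
    A u₀ w₀ := by
  obtain ⟨J, -, hJ, hJ'⟩ := hA.exists_resolvent one_pos
  have h1 : J (u₀ - (1 : ℝ) • w₀) = u₀ := by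
    refine tendsto_nhds_unique ((J.continuous.tendsto _).comp (hu.sub (hw.const_smul (1 : ℝ)))) ?_
    exact hu.congr fun n => (hJ' _ _ (h n)).symm
  have h2 := hJ (u₀ - (1 : ℝ) • w₀)
  rw [h1] at h2
  simpa using h2

/-- The semigroup maps into the domain of its generator. -/
theorem exists_generator (hS : IsSemigroupGeneratedBy S A) {t : ℝ} (ht : 0 < t) (f : H) :
    ∃ w, A (S t f) w ∧ ‖w‖ ≤ t⁻¹ * ‖f‖ := by
  obtain ⟨u, hu, hlim⟩ := mem_closure_iff_seq_limit.1 (hA.dense_domain f)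
  choose w hw using hu
  -- The bound `‖S t w‖ ≤ t⁻¹ ‖u‖` does not involve `‖w‖`, so `A S t` extends from the domain to
  -- every `f`.
  have hcau : CauchySeq fun n => S t (w n) := by
    rw [Metric.cauchySeq_iff']
    intro ε hε
    obtain ⟨N, hN⟩ := Metric.cauchySeq_iff'.1 hlim.cauchySeq (ε * t) (by positivity)
    refine ⟨N, fun n hn => ?_⟩
    have h1 := hS.norm_generator_le hA (hA.sub (hw n) (hw N)) ht
    have h2 := hN n hn
    rw [dist_eq_norm] at h2 ⊢
    rw [← map_sub]
    refine h1.trans_lt ?_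
    rwa [inv_mul_lt_iff₀ ht, mul_comm]
  obtain ⟨z, hz⟩ := cauchySeq_tendsto_of_complete hcau
  refine ⟨z, hA.mem_of_tendsto (fun n => hS.generator_apply (hw n) ht.le)
    (((S t).continuous.tendsto f).comp hlim) hz, ?_⟩
  exact le_of_tendsto_of_tendsto hz.norm (hlim.norm.const_mul _)
    (Eventually.of_forall fun n => hS.norm_generator_le hA (hw n) ht)

/-- After time `t / 2` the orbit starts in the domain, where differentiability is known. -/
theorem hasDerivAt (hS : IsSemigroupGeneratedBy S A) {t : ℝ} (ht : 0 < t) {f w : H}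
    (h : A (S t f) w) : HasDerivAt (fun t => S t f) w t := by
  have ht2 : 0 < t / 2 := by positivity
  obtain ⟨z, hz, -⟩ := hS.exists_generator hA ht2 f
  have h1 : S (t / 2) z = w := by
    have h2 := hS.generator_apply hz ht2.le
    rw [← hS.apply_add ht2.le ht2.le, add_halves] at h2
    exact hA.unique h2 h
  have h3 : HasDerivAt (fun s => S (s - t / 2) (S (t / 2) f)) w t := by
    have h4 : HasDerivAt (fun s => S s (S (t / 2) f)) w (t - t / 2) := by
      rw [sub_half, ← h1]
      exact hS.hasDerivAt_of_generator hz ht2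
    exact h4.comp_sub_const t (t / 2)
  refine h3.congr_of_eventuallyEq ?_
  filter_upwards [lt_mem_nhds (half_lt_self ht)] with s hs
  rw [← hS.apply_add (sub_nonneg.2 hs.le) ht2.le, sub_add_cancel]

/-- Uniqueness for the Cauchy problem `v' = A v`. -/
theorem eq_of_hasDerivAt (hS : IsSemigroupGeneratedBy S A) {v v' : ℝ → H} {T : ℝ} (hT : 0 ≤ T)
    (hc : ContinuousOn v (Icc 0 T)) (hd : ∀ t ∈ Ioo 0 T, HasDerivAt v (v' t) t)
    (h : ∀ t ∈ Ioo 0 T, A (v t) (v' t)) : v T = S T (v 0) := by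
  choose! z hz _ using fun t (ht : 0 < t) => hS.exists_generator hA ht (v 0)
  have := norm_le_norm_of_inner_deriv_nonpos (u := fun t => S t (v 0) - v t)
    (u' := fun t => z t - v' t) hT
    (((hS.continuousOn _).mono Icc_subset_Ici_self).sub hc)
    (fun t ht => (hS.hasDerivAt hA ht.1 (hz t ht.1)).sub (hd t ht))
    (fun t ht => hA.nonpos (hA.sub (hz t ht.1) (h t ht)))
  rw [hS.apply_zero, sub_self, norm_zero, norm_le_zero_iff, sub_eq_zero] at this
  exact this.symm

end IsSemigroupGeneratedBy

/-- Existence of one semigroup with this generator makes the choice behind `semigroupGeneratedBy`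
meaningful. -/
theorem semigroupGeneratedBy_spec {H : Type*} [NormedAddCommGroup H] [InnerProductSpace ℝ H]
    [CompleteSpace H] {A : H → H → Prop} (hA : IsNonposSelfAdjoint A) :
    IsSemigroupGeneratedBy (semigroupGeneratedBy A) A :=
  Classical.epsilon_spec hA.exists_semigroup

/-! ### Pairs of mutually adjoint operators -/

/-- `G` and `G'` are the graphs of two densely defined closed operators which are adjoint to each
other. -/
structure IsAdjointPair {H K : Type*} [NormedAddCommGroup H] [InnerProductSpace ℝ H]
    [NormedAddCommGroup K] [InnerProductSpace ℝ K]
    (G : Submodule ℝ (H × K)) (G' : Submodule ℝ (K × H)) : Prop where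
  mem_right : ∀ y w, (y, w) ∈ G' ↔ ∀ x z, (x, z) ∈ G → inner ℝ w x = inner ℝ y z
  mem_left : ∀ x z, (x, z) ∈ G ↔ ∀ y w, (y, w) ∈ G' → inner ℝ w x = inner ℝ y z
  unique_left : ∀ z, (0, z) ∈ G → z = 0
  unique_right : ∀ w, (0, w) ∈ G' → w = 0

/-- The graph of the operator `-G' G`. -/
def negComp {H K : Type*} [AddCommGroup H] [Module ℝ H] [AddCommGroup K] [Module ℝ K]
    (G : Submodule ℝ (H × K)) (G' : Submodule ℝ (K × H)) (u w : H) : Prop :=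
  ∃ z, (u, z) ∈ G ∧ (z, -w) ∈ G'

namespace IsAdjointPair

variable {H K : Type*} [NormedAddCommGroup H] [InnerProductSpace ℝ H]
  [NormedAddCommGroup K] [InnerProductSpace ℝ K]
  {G : Submodule ℝ (H × K)} {G' : Submodule ℝ (K × H)}

theorem swap (h : IsAdjointPair G G') : IsAdjointPair G' G where
  mem_right y w := (h.mem_left y w).trans
    (forall₂_congr fun _ _ => imp_congr_right fun _ => by
      rw [eq_comm, real_inner_comm, real_inner_comm y])
  mem_left y w := (h.mem_right y w).trans
    (forall₂_congr fun _ _ => imp_congr_right fun _ => by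
      rw [eq_comm, real_inner_comm, real_inner_comm w])
  unique_left := h.unique_right
  unique_right := h.unique_left

theorem inner_eq (h : IsAdjointPair G G') {x z y w} (h1 : (x, z) ∈ G) (h2 : (y, w) ∈ G') :
    inner ℝ w x = inner ℝ y z := (h.mem_right y w).1 h2 x z h1

theorem isClosed_left (h : IsAdjointPair G G') : IsClosed (G : Set (H × K)) := by
  have : (G : Set (H × K)) = ⋂ (p : K × H) (_ : p ∈ G'), {q | inner ℝ p.2 q.1 = inner ℝ p.1 q.2} := by
    ext ⟨x, z⟩
    simp only [SetLike.mem_coe, h.mem_left, mem_iInter, mem_ofPred_eq, Prod.forall]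
  rw [this]
  exact isClosed_biInter fun p _ => isClosed_eq (by fun_prop) (by fun_prop)

theorem unique (h : IsAdjointPair G G') {x z z'} (h1 : (x, z) ∈ G) (h2 : (x, z') ∈ G) : z = z' := by
  have := G.sub_mem h1 h2
  rw [Prod.mk_sub_mk, sub_self] at this
  exact sub_eq_zero.1 (h.unique_left _ this)

/-- Von Neumann's theorem on `G'G`. The algebraic properties follow from adjointness; surjectivity
comes from the orthogonal projection onto the closed graph of `G`. -/
theorem isNonposSelfAdjoint [CompleteSpace H] [CompleteSpace K] (h : IsAdjointPair G G') :
    IsNonposSelfAdjoint (negComp G G') where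
  add := by
    rintro u w v z ⟨a, h1, h2⟩ ⟨b, h3, h4⟩
    exact ⟨a + b, G.add_mem h1 h3, by simpa [add_comm] using G'.add_mem h2 h4⟩
  smul := by
    rintro c u w ⟨a, h1, h2⟩
    exact ⟨c • a, G.smul_mem c h1, by simpa using G'.smul_mem c h2⟩
  eq_zero := by
    rintro w ⟨a, h1, h2⟩
    rw [h.unique_left a h1] at h2
    simpa using h.unique_right _ h2
  symm := by
    rintro u w v z ⟨a, h1, h2⟩ ⟨b, h3, h4⟩
    have e1 := h.inner_eq h3 h2
    have e2 := h.inner_eq h1 h4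
    rw [inner_neg_left] at e1 e2
    rw [real_inner_comm z u, ← neg_inj, e1, e2, real_inner_comm]
  nonpos := by
    rintro u w ⟨a, h1, h2⟩
    have e1 := h.inner_eq h1 h2
    rw [inner_neg_left, real_inner_self_eq_norm_sq] at e1
    nlinarith [sq_nonneg ‖a‖]
  surj := by
    intro c hc f
    -- The second component of the graph is scaled by `√c`, so that orthogonality of `(f, 0) - p` to
    -- it reads `f - u = c G'G u` for `u = p.fst`.
    set s := √c with hs
    have hs0 : 0 < s := Real.sqrt_pos.2 hc
    let L : WithLp 2 (H × K) →L[ℝ] H × K :=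
      (ContinuousLinearMap.prodMap (ContinuousLinearMap.id ℝ H)
        (s⁻¹ • ContinuousLinearMap.id ℝ K)).comp
        (WithLp.prodContinuousLinearEquiv 2 ℝ H K).toContinuousLinearMap
    let F : Submodule ℝ (WithLp 2 (H × K)) := G.comap L.toLinearMap
    have hF : IsClosed (F : Set (WithLp 2 (H × K))) := h.isClosed_left.preimage L.continuous
    have : CompleteSpace F := hF.completeSpace_coe
    obtain ⟨p, hp, q, hq, e⟩ := F.exists_add_mem_mem_orthogonal (WithLp.toLp 2 (f, (0 : K)))
    have hp' : (p.fst, s⁻¹ • p.snd) ∈ G := hp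
    have e1 : q.fst = f - p.fst := by
      have := congrArg (fun r : WithLp 2 (H × K) => r.fst) e
      simp only [WithLp.add_fst] at this
      exact eq_sub_of_add_eq' this.symm
    have e2 : q.snd = -p.snd := by
      have := congrArg (fun r : WithLp 2 (H × K) => r.snd) e
      simp only [WithLp.add_snd] at this
      exact eq_neg_of_add_eq_zero_right this.symm
    refine ⟨p.fst, c⁻¹ • (p.fst - f), ⟨s⁻¹ • p.snd, hp', ?_⟩, ?_⟩
    · rw [h.mem_right]
      intro x z hxz
      have hF' : WithLp.toLp 2 (x, s • z) ∈ F := by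
        change (x, s⁻¹ • s • z) ∈ G
        rwa [smul_smul, inv_mul_cancel₀ hs0.ne', one_smul]
      have h3 := (F.mem_orthogonal' q).1 hq _ hF'
      rw [WithLp.prod_inner_apply] at h3
      change inner ℝ q.fst x + inner ℝ q.snd (s • z) = 0 at h3
      rw [e1, e2, inner_neg_left, inner_smul_right] at h3
      rw [← smul_neg, neg_sub, inner_smul_left, inner_smul_left, conj_trivial, conj_trivial]
      have h4 : inner ℝ (f - p.fst) x = s * inner ℝ p.snd z := by linarith
      rw [h4, ← Real.mul_self_sqrt hc.le, ← hs]
      field_simp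
    · rw [smul_smul, mul_inv_cancel₀ hc.ne', one_smul, sub_sub_cancel]

/-- The semigroups generated by `-G' G` and `-G G'` are intertwined by `G`. -/
theorem intertwine [CompleteSpace H] [CompleteSpace K] (h : IsAdjointPair G G')
    {P : ℝ → H →L[ℝ] H} {R : ℝ → K →L[ℝ] K}
    (hP : IsSemigroupGeneratedBy P (negComp G G')) (hR : IsSemigroupGeneratedBy R (negComp G' G))
    {t r : ℝ} (ht : 0 < t) (hr : 0 ≤ r) (f : H) {z : K} (hz : (P t f, z) ∈ G) :
    (P (t + r) f, R r z) ∈ G := by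
  have hA := h.isNonposSelfAdjoint
  have hA' := h.swap.isNonposSelfAdjoint
  have ht2 : 0 < t / 2 := by positivity
  choose w hw hwb using fun x => hP.exists_generator hA ht2 x
  choose v hv hv' using hw
  let L : H →ₗ[ℝ] K :=
    { toFun := v
      map_add' := fun x y => h.unique (hv (x + y)) (by
        rw [map_add]; exact G.add_mem (hv x) (hv y))
      map_smul' := fun c x => h.unique (hv (c • x)) (by
        rw [map_smul]; exact G.smul_mem c (hv x)) }
  -- `G P (t/2)` is bounded: adjointness gives `‖G P (t/2) x‖² = -⟨A P (t/2) x, P (t/2) x⟩` with `A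
  -- = -G'G`. One half of the time is spent on this bound, the other on differentiability of the
  -- orbit.
  have hLb : ∀ x, ‖L x‖ ≤ √((t / 2)⁻¹) * ‖x‖ := by
    intro x
    have h1 := h.inner_eq (hv x) (hv' x)
    rw [real_inner_self_eq_norm_sq, inner_neg_left] at h1
    have h2 : ‖v x‖ ^ 2 ≤ (t / 2)⁻¹ * ‖x‖ ^ 2 := by
      rw [← h1, ← inner_neg_left]
      refine (real_inner_le_norm _ _).trans ?_
      rw [norm_neg, sq, ← mul_assoc]
      exact mul_le_mul (hwb x) (hP.norm_apply_le hA ht2.le x) (norm_nonneg _) (by positivity)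
    refine (sq_le_sq₀ (norm_nonneg _) (by positivity)).1 ?_
    rw [mul_pow, Real.sq_sqrt (by positivity)]
    exact h2
  let Lc : H →L[ℝ] K := L.mkContinuous _ hLb
  have hLc : ∀ x, (P (t / 2) x, Lc x) ∈ G := hv
  choose! a ha _ using fun s (hs : 0 < s) => hP.exists_generator hA hs f
  have hshift : ∀ s, 0 ≤ s → P (t + s) f = P (t / 2) (P (t / 2 + s) f) := by
    intro s hs
    rw [← hP.apply_add ht2.le (by positivity)]
    congr 2; ring
  have hmem : ∀ s, 0 ≤ s → (P (t + s) f, Lc (P (t / 2 + s) f)) ∈ G := by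
    intro s hs
    rw [hshift s hs]
    exact hLc _
  -- The image under `G` of the orbit solves the Cauchy problem for `-GG'`, so uniqueness identifies
  -- it with the orbit of `R`.
  have key := hR.eq_of_hasDerivAt hA' (v := fun s => Lc (P (t / 2 + s) f))
    (v' := fun s => Lc (a (t / 2 + s))) hr
    (Lc.continuous.comp_continuousOn ((hP.continuousOn f).comp (by fun_prop)
      fun s hs => mem_Ici.2 (by linarith [hs.1])))
    (fun s hs => by
      have h1 : 0 < t / 2 + s := by linarith [hs.1]
      have h2 := (hP.hasDerivAt hA h1 (ha _ h1)).comp_const_add (t / 2) s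
      exact Lc.hasFDerivAt.comp_hasDerivAt s h2)
    (fun s hs => by
      have h1 : 0 < t / 2 + s := by linarith [hs.1]
      have h2 := hP.generator_apply (ha _ h1) ht2.le
      rw [← hshift s hs.1.le] at h2
      obtain ⟨z', hz', hz''⟩ := h2
      rw [h.unique hz' (hmem s hs.1.le)] at hz''
      exact ⟨_, hz'', by simpa using G.neg_mem (hLc (a (t / 2 + s)))⟩)
  have hz0 : z = Lc (P (t / 2 + 0) f) := h.unique hz (by simpa using hmem 0 le_rfl)
  rw [hz0]
  rw [← key]
  exact hmem r hr

/-- A closed, densely defined operator and its adjoint. -/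
theorem of_isClosed [CompleteSpace H] [CompleteSpace K] (hG : IsClosed (G : Set (H × K)))
    (hu : ∀ z, (0, z) ∈ G → z = 0) (hd : Dense {x | ∃ z, (x, z) ∈ G})
    (hG' : ∀ y w, (y, w) ∈ G' ↔ ∀ x z, (x, z) ∈ G → inner ℝ w x = inner ℝ y z) :
    IsAdjointPair G G' where
  mem_right := hG'
  unique_left := hu
  unique_right w hw := by
    refine hd.eq_zero_of_inner_left ℝ ?_
    rintro x ⟨z, hxz⟩
    rw [(hG' 0 w).1 hw x z hxz, inner_zero_left]
  mem_left x z := by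
    refine ⟨fun h y w h' => (hG' y w).1 h' x z h, fun h => ?_⟩
    let F : Submodule ℝ (WithLp 2 (H × K)) :=
      G.comap (WithLp.prodContinuousLinearEquiv 2 ℝ H K).toLinearEquiv.toLinearMap
    have hF : IsClosed (F : Set (WithLp 2 (H × K))) :=
      hG.preimage (WithLp.prodContinuousLinearEquiv 2 ℝ H K).continuous
    have : CompleteSpace F := hF.completeSpace_coe
    obtain ⟨p, hp, q, hq, e⟩ := F.exists_add_mem_mem_orthogonal (WithLp.toLp 2 (x, z))
    -- The graph of the adjoint is the rotated orthogonal complement of the graph. Testing the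
    -- hypothesis on the residual `q` then gives `‖q.fst‖² + ‖q.snd‖² = 0`.
    have hq' : (-q.snd, q.fst) ∈ G' := by
      rw [hG']
      intro x' z' h'
      have hF' : WithLp.toLp 2 (x', z') ∈ F := h'
      have h3 := (F.mem_orthogonal' q).1 hq _ hF'
      rw [WithLp.prod_inner_apply] at h3
      change inner ℝ q.fst x' + inner ℝ q.snd z' = 0 at h3
      rw [inner_neg_left]; linarith
    have h1 := h _ _ hq'
    have h2 := (F.mem_orthogonal' q).1 hq _ hp
    rw [WithLp.prod_inner_apply] at h2
    change inner ℝ q.fst p.fst + inner ℝ q.snd p.snd = 0 at h2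
    have e1 : x = p.fst + q.fst := congrArg (fun r : WithLp 2 (H × K) => r.fst) e
    have e2 : z = p.snd + q.snd := congrArg (fun r : WithLp 2 (H × K) => r.snd) e
    rw [e1, e2, inner_add_right, inner_neg_left, inner_add_right, real_inner_self_eq_norm_sq,
      real_inner_self_eq_norm_sq] at h1
    have hq1 : q.fst = 0 := norm_eq_zero.1 (by nlinarith [norm_nonneg q.fst, norm_nonneg q.snd])
    have hq2 : q.snd = 0 := norm_eq_zero.1 (by nlinarith [norm_nonneg q.fst, norm_nonneg q.snd])
    rw [e1, e2, hq1, hq2, add_zero, add_zero]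
    exact hp

end IsAdjointPair

/-! ### Dirichlet forms on functions -/

-- Riemann sums of paths whose increments have nonnegative mutual products.

section BilinearForm

variable {V : Type*} [AddCommGroup V] [Module ℝ V] (B : V →ₗ[ℝ] V →ₗ[ℝ] ℝ)

/-- A nonnegative symmetric form dominates its values on combinations of vectors with nonnegative
mutual products. -/
theorem form_sum_smul_le {N : ℕ} (f : ℕ → V) (hf : ∀ i < N, ∀ j < N, 0 ≤ B (f i) (f j)) (c : ℕ → ℝ)
    {L : ℝ} (hc : ∀ i < N, |c i| ≤ L) :
    B (∑ i ∈ Finset.range N, c i • f i) (∑ i ∈ Finset.range N, c i • f i)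
      ≤ L ^ 2 * B (∑ i ∈ Finset.range N, f i) (∑ i ∈ Finset.range N, f i) := by
  simp only [map_sum, LinearMap.sum_apply, map_smul, LinearMap.smul_apply, Finset.mul_sum,
    smul_eq_mul]
  refine Finset.sum_le_sum fun i hi => Finset.sum_le_sum fun j hj => ?_
  rw [Finset.mem_range] at hi hj
  rw [← mul_assoc]
  refine mul_le_mul_of_nonneg_right ?_ (hf j hj i hi)
  calc c i * c j ≤ |c i * c j| := le_abs_self _
    _ = |c i| * |c j| := abs_mul _ _
    _ ≤ L * L := mul_le_mul (hc i hi) (hc j hj) (abs_nonneg _) ((abs_nonneg _).trans (hc i hi))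
    _ = L ^ 2 := (sq L).symm

theorem sum_range_mul_eq {M : Type*} [AddCommMonoid M] (h : ℕ → M) (n m : ℕ) :
    ∑ k ∈ Finset.range (n * m), h k
      = ∑ i ∈ Finset.range n, ∑ j ∈ Finset.range m, h (i * m + j) := by
  induction n with
  | zero => simp
  | succ n ih => rw [Finset.sum_range_succ, ← ih, Nat.succ_mul, Finset.sum_range_add]

/-- Left Riemann sums with `n` equal steps, for the integral of `2s` against a path in `V`. -/
noncomputable def riemannSum (g : ℝ → V) (n : ℕ) : V :=
  ∑ i ∈ Finset.range n, (2 * (i : ℝ) / n) • (g ((i + 1 : ℕ) / n) - g ((i : ℕ) / n))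

/-- On the refined grid the coefficient is constant on blocks of length `m`, whence the integer
quotient `k / m`; within each block the increments telescope. -/
theorem riemannSum_refine (g : ℝ → V) {n m : ℕ} (hn : 0 < n) (hm : 0 < m) :
    riemannSum g n = ∑ k ∈ Finset.range (n * m), (2 * ((k / m : ℕ) : ℝ) / n) •
      (g ((k + 1 : ℕ) / (n * m : ℕ)) - g ((k : ℕ) / (n * m : ℕ))) := by
  rw [sum_range_mul_eq, riemannSum]
  refine Finset.sum_congr rfl fun i _ => ?_
  have h1 : ∀ j ∈ Finset.range m, (2 * (((i * m + j) / m : ℕ) : ℝ) / n) •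
      (g ((i * m + j + 1 : ℕ) / (n * m : ℕ)) - g ((i * m + j : ℕ) / (n * m : ℕ)))
      = (2 * (i : ℝ) / n) • (g ((i * m + (j + 1) : ℕ) / (n * m : ℕ))
        - g ((i * m + j : ℕ) / (n * m : ℕ))) := by
    intro j hj
    rw [Finset.mem_range] at hj
    have : (i * m + j) / m = i := by
      rw [mul_comm, Nat.mul_add_div hm, Nat.div_eq_of_lt hj, add_zero]
    rw [this, add_assoc]
  rw [Finset.sum_congr rfl h1, ← Finset.smul_sum,
    Finset.sum_range_sub (fun j : ℕ => g ((i * m + j : ℕ) / (n * m : ℕ)))]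
  have hn' : (n : ℝ) ≠ 0 := by positivity
  have hm' : (m : ℝ) ≠ 0 := by positivity
  have e1 : ((i * m + m : ℕ) : ℝ) / (n * m : ℕ) = (i + 1 : ℕ) / n := by
    push_cast; field_simp
  have e2 : ((i * m + 0 : ℕ) : ℝ) / (n * m : ℕ) = (i : ℕ) / n := by
    push_cast; field_simp; ring
  rw [e1, e2]

/-- On the common grid of `n * m` steps the two coefficients at an index differ by at most `2 (1/n +
1/m)`. Nonnegative mutual products let `form_sum_smul_le` pull this factor out, leaving the form of
the total increment. -/
theorem form_riemannSum_sub_le (hB : ∀ u, 0 ≤ B u u) (hs : ∀ u v, B u v = B v u) (g : ℝ → V)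
    (hg : ∀ a b c d, 0 ≤ a → a < b → b ≤ c → c < d → 0 ≤ B (g b - g a) (g d - g c))
    {n m : ℕ} (hn : 0 < n) (hm : 0 < m) :
    B (riemannSum g n - riemannSum g m) (riemannSum g n - riemannSum g m)
      ≤ (2 * (1 / n + 1 / m)) ^ 2 * B (g 1 - g 0) (g 1 - g 0) := by
  have hn' : (0 : ℝ) < n := by positivity
  have hm' : (0 : ℝ) < m := by positivity
  set f : ℕ → V := fun k => g ((k + 1 : ℕ) / (n * m : ℕ)) - g ((k : ℕ) / (n * m : ℕ)) with hf
  have e1 : riemannSum g n - riemannSum g m = ∑ k ∈ Finset.range (n * m),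
      (2 * ((k / m : ℕ) : ℝ) / n - 2 * ((k / n : ℕ) : ℝ) / m) • f k := by
    rw [riemannSum_refine g hn hm, riemannSum_refine g hm hn, mul_comm m n,
      ← Finset.sum_sub_distrib]
    exact Finset.sum_congr rfl fun k _ => (sub_smul _ _ _).symm
  have e2 : ∑ k ∈ Finset.range (n * m), f k = g 1 - g 0 := by
    rw [hf, Finset.sum_range_sub (fun k : ℕ => g ((k : ℕ) / (n * m : ℕ)))]
    have : ((n * m : ℕ) : ℝ) ≠ 0 := by push_cast; positivity
    rw [div_self this, Nat.cast_zero, zero_div]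
  rw [e1, ← e2]
  refine form_sum_smul_le B f (fun i _ j _ => ?_) _ fun k _ => ?_
  · have hnm : (0 : ℝ) < (n * m : ℕ) := by push_cast; positivity
    have hlt : ∀ i j : ℕ, i < j → 0 ≤ B (f i) (f j) := by
      intro i j hij
      refine hg _ _ _ _ (by positivity) ?_ ?_ ?_
      · rw [div_lt_div_iff_of_pos_right hnm]; exact_mod_cast i.lt_succ_self
      · rw [div_le_div_iff_of_pos_right hnm]; exact_mod_cast hij
      · rw [div_lt_div_iff_of_pos_right hnm]; exact_mod_cast j.lt_succ_self
    rcases lt_trichotomy i j with h | rfl | h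
    · exact hlt i j h
    · exact hB _
    · rw [hs]; exact hlt j i h
  · have hq : ∀ a b : ℕ, 0 < a → 0 < b → (k : ℝ) / (a * b) - 1 / a ≤ ((k / b : ℕ) : ℝ) / a ∧
        ((k / b : ℕ) : ℝ) / a ≤ (k : ℝ) / (a * b) := by
      intro a b ha hb
      have ha' : (0 : ℝ) < a := by positivity
      have hb' : (0 : ℝ) < b := by positivity
      constructor
      · have h1 : k < (k / b + 1) * b := by
          rw [mul_comm]; exact Nat.lt_mul_div_succ k hb
        have h2 : (k : ℝ) < ((k / b : ℕ) + 1) * b := by exact_mod_cast h1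
        rw [sub_le_iff_le_add, ← add_div, div_le_div_iff₀ (by positivity) ha']
        nlinarith
      · have h1 : (k / b) * b ≤ k := Nat.div_mul_le_self k b
        have h2 : ((k / b : ℕ) : ℝ) * b ≤ k := by exact_mod_cast h1
        rw [div_le_div_iff₀ ha' (by positivity)]
        nlinarith
    have h1 := hq n m hn hm
    have h2 := hq m n hm hn
    rw [mul_comm (m : ℝ)] at h2
    have h3 : (0 : ℝ) ≤ 1 / n := by positivity
    have h4 : (0 : ℝ) ≤ 1 / m := by positivity
    rw [mul_div_assoc, mul_div_assoc, abs_le]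
    constructor <;> linarith [h1.1, h1.2, h2.1, h2.2]

/-- Telescope `s²` over the increments of `min s a²`. In each step `b² - a²` and the contribution to
the Riemann sum differ by at most `(b - a) / n`, where `b - a` is the increment of `min s ·`; these
increments sum to `s ≤ 1`. -/
theorem abs_riemannSum_min_sub_sq_le {s : ℝ} (hs0 : 0 ≤ s) (hs1 : s ≤ 1) {n : ℕ} (hn : 0 < n) :
    |riemannSum (fun a => min s a) n - s ^ 2| ≤ 1 / n := by
  have hn' : (0 : ℝ) < n := by positivity
  have e1 : s ^ 2 = ∑ i ∈ Finset.range n,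
      ((min s ((i + 1 : ℕ) / n)) ^ 2 - (min s ((i : ℕ) / n)) ^ 2) := by
    rw [Finset.sum_range_sub (fun i : ℕ => (min s ((i : ℕ) / n)) ^ 2), div_self hn'.ne',
      Nat.cast_zero, zero_div, min_eq_left hs1, min_eq_right hs0]
    ring
  have e2 : s = ∑ i ∈ Finset.range n, (min s ((i + 1 : ℕ) / n) - min s ((i : ℕ) / n)) := by
    rw [Finset.sum_range_sub (fun i : ℕ => min s ((i : ℕ) / n)), div_self hn'.ne',
      Nat.cast_zero, zero_div, min_eq_left hs1, min_eq_right hs0, sub_zero]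
  have hterm : ∀ i ∈ Finset.range n,
      |(2 * (i : ℝ) / n) • (min s ((i + 1 : ℕ) / n) - min s ((i : ℕ) / n))
        - ((min s ((i + 1 : ℕ) / n)) ^ 2 - (min s ((i : ℕ) / n)) ^ 2)|
      ≤ 1 / n * (min s ((i + 1 : ℕ) / n) - min s ((i : ℕ) / n)) := by
    intro i _
    have e3 : ((i + 1 : ℕ) : ℝ) / n = i / n + 1 / n := by push_cast; ring
    have h1n : (0 : ℝ) < 1 / n := by positivity
    rw [e3, mul_div_assoc, smul_eq_mul]
    generalize (i : ℝ) / n = a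
    generalize (1 : ℝ) / n = d at *
    rcases le_total s a with h | h
    · rw [min_eq_left h, min_eq_left (by linarith)]; simp
    · rw [min_eq_right h]
      have h1 : a ≤ min s (a + d) := le_min h (by linarith)
      have h2 : min s (a + d) ≤ a + d := min_le_right _ _
      generalize min s (a + d) = b at *
      rw [abs_le]
      constructor <;> nlinarith
  rw [riemannSum]
  rw [e1, ← Finset.sum_sub_distrib]
  refine (Finset.abs_sum_le_sum_abs _ _).trans ((Finset.sum_le_sum hterm).trans ?_)
  rw [← Finset.mul_sum, ← e2]
  have : (0 : ℝ) < 1 / n := by positivity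
  nlinarith

end BilinearForm

-- Truncations, and bounded elements of the domain as an algebra.

namespace DirichletForm

variable {X : Type*} [MeasurableSpace X] {μ : Measure X}

/-- The functions whose class belongs to the domain of the form. -/
def funDom (E : DirichletForm X μ) : Submodule ℝ (X → ℝ) where
  carrier := {F | ∃ h : MemLp F 2 μ, h.toLp F ∈ E.dom}
  zero_mem' := ⟨MemLp.zero, by
    rw [MemLp.toLp_zero]; exact E.dom.zero_mem⟩
  add_mem' := by
    rintro F G ⟨hF, hF'⟩ ⟨hG, hG'⟩
    exact ⟨hF.add hG, by rw [MemLp.toLp_add hF hG]; exact E.dom.add_mem hF' hG'⟩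
  smul_mem' := by
    rintro c F ⟨hF, hF'⟩
    exact ⟨hF.const_smul c, by rw [MemLp.toLp_const_smul c hF]; exact E.dom.smul_mem c hF'⟩

/-- The class of a function in the domain. -/
noncomputable def cls (E : DirichletForm X μ) : E.funDom →ₗ[ℝ] E.dom where
  toFun F := ⟨F.2.choose.toLp F.1, F.2.choose_spec⟩
  map_add' F G := Subtype.ext (MemLp.toLp_add F.2.choose G.2.choose)
  map_smul' c F := Subtype.ext (MemLp.toLp_const_smul c F.2.choose)

/-- The form on functions. -/
noncomputable def energy (E : DirichletForm X μ) : E.funDom →ₗ[ℝ] E.funDom →ₗ[ℝ] ℝ :=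
  E.form.compl₁₂ E.cls E.cls

variable {E : DirichletForm X μ}

theorem energy_apply (F G : E.funDom) : E.energy F G = E.form (E.cls F) (E.cls G) := rfl

theorem coeFn_cls (F : E.funDom) : ((E.cls F : Lp ℝ 2 μ) : X → ℝ) =ᵐ[μ] F.1 :=
  MemLp.coeFn_toLp F.2.choose

theorem coeFn_mem_funDom (u : E.dom) : ((u : Lp ℝ 2 μ) : X → ℝ) ∈ E.funDom :=
  ⟨Lp.memLp _, by rw [Lp.toLp_coeFn]; exact u.2⟩

theorem cls_eq_of_ae {F : E.funDom} {u : E.dom} (h : F.1 =ᵐ[μ] (u : Lp ℝ 2 μ)) : E.cls F = u :=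
  Subtype.ext (Lp.ext ((coeFn_cls F).trans h))

theorem energy_symm (F G : E.funDom) : E.energy F G = E.energy G F := E.symm _ _

theorem energy_nonneg (F : E.funDom) : 0 ≤ E.energy F F := E.nonneg _

theorem energy_add_self (F G : E.funDom) : E.energy (F + G) (F + G)
    = E.energy F F + 2 * E.energy F G + E.energy G G := by
  simp only [map_add, LinearMap.add_apply, energy_symm G F]; ring

theorem exists_truncation (F : E.funDom) {a : ℝ} (ha : 0 < a) :
    ∃ G : E.funDom, (∀ x, G.1 x = max 0 (min (F.1 x) a)) ∧ E.energy G G ≤ E.energy F F := by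
  have h1 : MemLp (fun x => max 0 (min ((a⁻¹ • F).1 x) 1)) 2 μ := by
    have hm := (a⁻¹ • F).2.choose
    refine hm.mono (by
      exact (aestronglyMeasurable_const.sup (hm.1.inf aestronglyMeasurable_const)))
      (Eventually.of_forall fun x => ?_)
    rw [Real.norm_eq_abs, Real.norm_eq_abs, abs_of_nonneg (le_max_left _ _)]
    exact max_le (abs_nonneg _) ((min_le_left _ _).trans (le_abs_self _))
  obtain ⟨hv, hle⟩ := E.markov (E.cls (a⁻¹ • F)) (h1.toLp _) (by
    filter_upwards [h1.coeFn_toLp, coeFn_cls (a⁻¹ • F)] with x h2 h3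
    rw [h2, h3])
  let G₀ : E.funDom := ⟨_, h1, hv⟩
  have hG₀ : E.energy G₀ G₀ ≤ E.energy (a⁻¹ • F) (a⁻¹ • F) := hle
  refine ⟨a • G₀, fun x => ?_, ?_⟩
  · change a * max 0 (min (a⁻¹ * F.1 x) 1) = _
    rw [mul_max_of_nonneg _ _ ha.le, mul_min_of_nonneg _ _ ha.le, mul_zero, mul_one,
      mul_inv_cancel_left₀ ha.ne']
  · simp only [map_smul, LinearMap.smul_apply, smul_eq_mul] at hG₀ ⊢
    calc a * (a * E.energy G₀ G₀) ≤ a * (a * (a⁻¹ * (a⁻¹ * E.energy F F))) := by gcongr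
      _ = E.energy F F := by field_simp

/-- If truncation at level `a` removes every positive multiple of `G` from `F + εG`, then
`𝓔(F, G) ≥ 0`. -/
theorem energy_nonneg_of_truncation (F G : E.funDom) {a : ℝ} (ha : 0 < a)
    (h : ∀ ε > 0, ∀ x, max 0 (min (F.1 x + ε * G.1 x) a) = F.1 x) : 0 ≤ E.energy F G := by
  by_contra! hneg
  -- Truncation sends `F + εG` back to `F` without raising the energy, so the part of `𝓔(F + εG, F +
  -- εG) - 𝓔(F, F)` beyond zero is nonnegative; divide by `ε`.
  have key : ∀ ε > 0, 0 ≤ 2 * E.energy F G + ε * E.energy G G := by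
    intro ε hε
    obtain ⟨K, hK, hle⟩ := exists_truncation (F + ε • G) ha
    have : K = F := Subtype.ext (funext fun x => (hK x).trans (h ε hε x))
    rw [this, energy_add_self] at hle
    simp only [map_smul, LinearMap.smul_apply, smul_eq_mul] at hle
    have h2 : 0 ≤ ε * (2 * E.energy F G + ε * E.energy G G) := by linarith
    exact nonneg_of_mul_nonneg_right h2 hε
  have hG := energy_nonneg G
  -- This `ε` keeps the quadratic term below `-𝓔(F, G)`, half of the linear defect; the `+ 1` avoids
  -- division by zero.
  have h1 := key (-E.energy F G / (E.energy G G + 1)) (by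
    apply div_pos <;> linarith)
  have h2 : -E.energy F G / (E.energy G G + 1) * E.energy G G ≤ -E.energy F G := by
    rw [div_mul_eq_mul_div, div_le_iff₀ (by linarith)]
    nlinarith
  linarith

theorem exists_posPart (F : E.funDom) {M : ℝ} (hM : ∀ x, |F.1 x| ≤ M) :
    ∃ G : E.funDom, ∀ x, G.1 x = max 0 (F.1 x) := by
  by_cases hM0 : 0 < M
  · obtain ⟨G, hG, -⟩ := exists_truncation F hM0
    refine ⟨G, fun x => ?_⟩
    rw [hG, min_eq_left ((le_abs_self _).trans (hM x))]
  · refine ⟨0, fun x => ?_⟩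
    have := abs_nonpos_iff.1 ((hM x).trans (not_lt.1 hM0))
    rw [this, max_self]; rfl

/-- The energy of a bounded function against its negative part is nonpositive. -/
theorem exists_negPart (F : E.funDom) {M : ℝ} (hM : ∀ x, |F.1 x| ≤ M) :
    ∃ N : E.funDom, (∀ x, N.1 x = max 0 (-F.1 x)) ∧ E.energy F N ≤ 0 := by
  obtain ⟨N, hN⟩ := exists_posPart (-F) (M := M) (fun x => by simpa using hM x)
  obtain ⟨P, hP⟩ := exists_posPart F hM
  have hN' : ∀ x, N.1 x = max 0 (-F.1 x) := hN
  refine ⟨N, hN', ?_⟩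
  have e1 : F = P - N := Subtype.ext (funext fun x => by
    change F.1 x = P.1 x - N.1 x
    rw [hP, hN', max_comm 0, max_comm 0, max_zero_sub_max_neg_zero_eq_self])
  -- The two parts have disjoint supports: subtracting a multiple of `N` only makes `P` negative
  -- where it is zero, and truncation undoes this. The level `|M| + 1` is positive and exceeds `P`.
  have h1 : 0 ≤ E.energy P (-N) := by
    refine energy_nonneg_of_truncation P (-N) (a := |M| + 1) (by positivity) fun ε hε x => ?_
    change max 0 (min (P.1 x + ε * (-N.1 x)) (|M| + 1)) = P.1 x
    rw [hP, hN']
    have h2 := hM x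
    have h3 := le_abs_self M
    have h4 := le_abs_self (F.1 x)
    rcases le_total 0 (F.1 x) with h | h
    · rw [max_eq_right h, max_eq_left (by linarith : -F.1 x ≤ 0), neg_zero, mul_zero, add_zero,
        min_eq_left (by linarith), max_eq_right h]
    · rw [max_eq_left h, max_eq_right (by linarith : 0 ≤ -F.1 x), neg_neg, zero_add,
        max_eq_left ((min_le_left _ _).trans (by nlinarith))]
  have h2 := energy_nonneg N
  rw [e1, map_sub, LinearMap.sub_apply]
  rw [map_neg] at h1
  linarith

variable [IsProbabilityMeasure μ]

/-- The energy bound makes the sequence Cauchy in the form norm, so it has a limit in the domain;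
uniform convergence identifies that limit with `F₀` in `L²`. -/
theorem mem_funDom_of_uniform_limit (F : ℕ → E.funDom) (F₀ : X → ℝ) (hF₀ : AEStronglyMeasurable F₀ μ)
    {M : ℝ} (hM : ∀ x, |F₀ x| ≤ M) {K : ℝ}
    (hE : ∀ m n, E.energy (F m - F n) (F m - F n) ≤ K * (1 / ((m : ℝ) + 1) + 1 / ((n : ℝ) + 1)) ^ 2)
    (hu : ∀ n x, |(F n).1 x - F₀ x| ≤ 1 / ((n : ℝ) + 1)) : F₀ ∈ E.funDom := by
  have hF₀' : MemLp F₀ 2 μ := MemLp.of_bound hF₀ M (Eventually.of_forall hM)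
  have hn : ∀ n, ‖((E.cls (F n) : E.dom) : Lp ℝ 2 μ) - hF₀'.toLp F₀‖ ≤ 1 / ((n : ℝ) + 1) := by
    intro n
    have := Lp.norm_le_of_ae_bound (p := 2) (f := ((E.cls (F n) : E.dom) : Lp ℝ 2 μ) - hF₀'.toLp F₀)
      (C := 1 / ((n : ℝ) + 1)) (by positivity) (by
        filter_upwards [Lp.coeFn_sub ((E.cls (F n) : E.dom) : Lp ℝ 2 μ) (hF₀'.toLp F₀),
          hF₀'.coeFn_toLp, coeFn_cls (F n)] with x h1 h2 h3
        rw [h1, Pi.sub_apply, h2, h3]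
        exact hu n x)
    simpa [measureUnivNNReal] using this
  have hlim0 : Tendsto (fun n : ℕ => 1 / ((n : ℝ) + 1)) atTop (𝓝 0) :=
    tendsto_one_div_add_atTop_nhds_zero_nat
  have hlim : Tendsto (fun n => ((E.cls (F n) : E.dom) : Lp ℝ 2 μ)) atTop (𝓝 (hF₀'.toLp F₀)) :=
    tendsto_iff_norm_sub_tendsto_zero.2 (squeeze_zero (fun _ => norm_nonneg _) hn hlim0)
  obtain ⟨v, hv⟩ := E.closed (fun n => E.cls (F n)) (by
    intro ε hε
    have hc : Tendsto (fun n : ℕ => (|K| + 1) * (2 * (1 / ((n : ℝ) + 1))) ^ 2) atTop (𝓝 0) := by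
      simpa using ((hlim0.const_mul 2).pow 2).const_mul (|K| + 1)
    obtain ⟨N, hN⟩ := (hc.eventually (gt_mem_nhds hε)).exists
    refine ⟨N, fun m hm n hn' => ?_⟩
    have a1 : (1 : ℝ) / ((m : ℝ) + 1) ≤ 1 / ((N : ℝ) + 1) := Nat.one_div_le_one_div hm
    have a2 : (1 : ℝ) / ((n : ℝ) + 1) ≤ 1 / ((N : ℝ) + 1) := Nat.one_div_le_one_div hn'
    have a3 : (0 : ℝ) < 1 / ((m : ℝ) + 1) := by positivity
    have a4 : (0 : ℝ) < 1 / ((n : ℝ) + 1) := by positivity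
    have h1 := hE m n
    rw [energy_apply, map_sub] at h1
    have h2 : ‖E.cls (F m) - E.cls (F n)‖ ≤ 1 / ((m : ℝ) + 1) + 1 / ((n : ℝ) + 1) := by
      have e : ((E.cls (F m) - E.cls (F n) : E.dom) : Lp ℝ 2 μ)
          = ((E.cls (F m) : Lp ℝ 2 μ) - hF₀'.toLp F₀) - ((E.cls (F n) : Lp ℝ 2 μ) - hF₀'.toLp F₀) := by
        simp
      change ‖((E.cls (F m) - E.cls (F n) : E.dom) : Lp ℝ 2 μ)‖ ≤ _
      rw [e]
      exact (norm_sub_le _ _).trans (add_le_add (hn m) (hn n))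
    have h3 : (1 / ((m : ℝ) + 1) + 1 / ((n : ℝ) + 1)) ^ 2 ≤ (2 * (1 / ((N : ℝ) + 1))) ^ 2 := by
      gcongr; linarith
    have h4 : ‖E.cls (F m) - E.cls (F n)‖ ^ 2 ≤ (1 / ((m : ℝ) + 1) + 1 / ((n : ℝ) + 1)) ^ 2 := by
      gcongr
    have h5 : K * (1 / ((m : ℝ) + 1) + 1 / ((n : ℝ) + 1)) ^ 2
        ≤ |K| * (1 / ((m : ℝ) + 1) + 1 / ((n : ℝ) + 1)) ^ 2 := by
      gcongr; exact le_abs_self K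
    refine lt_of_le_of_lt ?_ hN
    nlinarith [abs_nonneg K])
  have hv2 : Tendsto (fun n => ((E.cls (F n) : E.dom) : Lp ℝ 2 μ)) atTop (𝓝 (v : Lp ℝ 2 μ)) := by
    rw [tendsto_iff_norm_sub_tendsto_zero]
    have h1 : Tendsto (fun n => ‖E.cls (F n) - v‖ ^ 2) atTop (𝓝 0) :=
      squeeze_zero (fun _ => sq_nonneg _) (fun n => by linarith [E.nonneg (E.cls (F n) - v)]) hv
    have h2 := (Real.continuous_sqrt.tendsto 0).comp h1
    rw [Real.sqrt_zero] at h2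
    refine h2.congr fun n => ?_
    rw [Function.comp_apply, Real.sqrt_sq (norm_nonneg _)]
    rfl
  have : hF₀'.toLp F₀ = v := tendsto_nhds_unique hlim hv2
  exact ⟨hF₀', this ▸ v.2⟩

/-- Layer by layer, `F² = ∫ 2a d(F ∧ a)` over `a` in `[0, 1]`. The Riemann sums are combinations of
truncations, converge uniformly, and are Cauchy in energy by `form_riemannSum_sub_le`. -/
theorem sq_mem_funDom_of_unit (F : E.funDom) (h0 : ∀ x, 0 ≤ F.1 x) (h1 : ∀ x, F.1 x ≤ 1) :
    (fun x => F.1 x ^ 2) ∈ E.funDom := by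
  have hg : ∀ a : ℝ, ∃ G : E.funDom, ∀ x, G.1 x = max 0 (min (F.1 x) a) := by
    intro a
    by_cases ha : 0 < a
    · obtain ⟨G, hG, -⟩ := exists_truncation F ha
      exact ⟨G, hG⟩
    · exact ⟨0, fun x => (max_eq_left ((min_le_right _ _).trans (not_lt.1 ha))).symm⟩
  choose g hg using hg
  have hg' : ∀ a, 0 ≤ a → ∀ x, (g a).1 x = min (F.1 x) a := fun a ha x => by
    rw [hg, max_eq_right (le_min (h0 x) ha)]
  -- A higher layer is nonzero only where the lower one has reached its maximum `b - a`, so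
  -- truncation at `b - a` removes any positive multiple of it.
  have hcross : ∀ a b c d, 0 ≤ a → a < b → b ≤ c → c < d →
      0 ≤ E.energy (g b - g a) (g d - g c) := by
    intro a b c d ha hab hbc hcd
    refine energy_nonneg_of_truncation _ _ (sub_pos.2 hab) fun ε hε x => ?_
    change max 0 (min (((g b).1 x - (g a).1 x) + ε * ((g d).1 x - (g c).1 x)) (b - a))
      = (g b).1 x - (g a).1 x
    rw [hg' a ha, hg' b (by linarith), hg' c (by linarith), hg' d (by linarith)]
    rcases le_total (F.1 x) c with h | h
    · rw [min_eq_left h, min_eq_left (by linarith : F.1 x ≤ d), sub_self, mul_zero, add_zero]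
      have h2 : min (F.1 x) a ≤ min (F.1 x) b := min_le_min_left _ hab.le
      have h3 : min (F.1 x) b - min (F.1 x) a ≤ b - a := by
        rcases le_total (F.1 x) a with h4 | h4
        · rw [min_eq_left h4, min_eq_left (by linarith)]; linarith
        · rw [min_eq_right h4]; linarith [min_le_right (F.1 x) b]
      rw [min_eq_left h3, max_eq_right (by linarith)]
    · rw [min_eq_right (by linarith : b ≤ F.1 x), min_eq_right (by linarith : a ≤ F.1 x),
        min_eq_right h]
      have h2 : c ≤ min (F.1 x) d := le_min h hcd.le
      rw [min_eq_right (by nlinarith), max_eq_right (by linarith)]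
  have happ : ∀ n x, (riemannSum g n : E.funDom).1 x = riemannSum (fun a => min (F.1 x) a) n := by
    intro n x
    have e1 : ((riemannSum g n : E.funDom) : X → ℝ) = ∑ i ∈ Finset.range n,
        (2 * (i : ℝ) / n) • ((g ((i + 1 : ℕ) / n)).1 - (g ((i : ℕ) / n)).1) := by
      rw [riemannSum, Submodule.coe_sum]; rfl
    rw [e1, Finset.sum_apply, riemannSum]
    refine Finset.sum_congr rfl fun i _ => ?_
    rw [Pi.smul_apply, Pi.sub_apply, hg' _ (by positivity), hg' _ (by positivity)]
  obtain ⟨hF, -⟩ := F.2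
  refine mem_funDom_of_uniform_limit (fun n => riemannSum g (n + 1)) (fun x => F.1 x ^ 2)
    (hF.1.pow 2) (M := 1) (fun x => ?_) (K := 4 * E.energy (g 1 - g 0) (g 1 - g 0))
    (fun m n => ?_) (fun n x => ?_)
  · rw [abs_of_nonneg (sq_nonneg _)]
    exact pow_le_one₀ (h0 x) (h1 x)
  · have := form_riemannSum_sub_le E.energy energy_nonneg energy_symm g hcross m.succ_pos n.succ_pos
    refine this.trans_eq ?_
    push_cast
    ring
  · rw [happ]
    have := abs_riemannSum_min_sub_sq_le (h0 x) (h1 x) n.succ_pos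
    push_cast at this
    exact this

/-- Rescale the positive and negative parts into `[0, 1]`; then `F² = (F⁺)² + (F⁻)²`. -/
theorem sq_mem_funDom (F : E.funDom) {M : ℝ} (hM : ∀ x, |F.1 x| ≤ M) :
    (fun x => F.1 x ^ 2) ∈ E.funDom := by
  have hpos : ∀ F : E.funDom, (∀ x, |F.1 x| ≤ M) →
      (fun x => (max 0 (F.1 x)) ^ 2) ∈ E.funDom := by
    intro F hM
    obtain ⟨G, hG⟩ := exists_posPart F hM
    have h1 := sq_mem_funDom_of_unit ((|M| + 1)⁻¹ • G) (fun x => by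
        change 0 ≤ (|M| + 1)⁻¹ * G.1 x
        rw [hG]; positivity)
      (fun x => by
        change (|M| + 1)⁻¹ * G.1 x ≤ 1
        rw [hG, inv_mul_le_one₀ (by positivity)]
        have := (le_abs_self _).trans (hM x)
        exact max_le (by positivity) (by linarith [le_abs_self M]))
    have h2 := E.funDom.smul_mem ((|M| + 1) ^ 2) h1
    convert h2 using 1
    funext x
    change _ = (|M| + 1) ^ 2 * ((|M| + 1)⁻¹ * G.1 x) ^ 2
    rw [hG]
    have : |M| + 1 ≠ 0 := by positivity
    field_simp
  have h1 := E.funDom.add_mem (hpos F hM) (hpos (-F) fun x => by simpa using hM x)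
  convert h1 using 1
  funext x
  change F.1 x ^ 2 = max 0 (F.1 x) ^ 2 + max 0 (-F.1 x) ^ 2
  rcases le_total 0 (F.1 x) with h | h
  · rw [max_eq_right h, max_eq_left (by linarith)]; ring
  · rw [max_eq_left h, max_eq_right (by linarith)]; ring

/-- Products of bounded elements of the domain are in the domain. -/
theorem mul_mem_funDom (F G : E.funDom) {M N : ℝ} (hF : ∀ x, |F.1 x| ≤ M) (hG : ∀ x, |G.1 x| ≤ N) :
    (fun x => F.1 x * G.1 x) ∈ E.funDom := by
  have h1 := sq_mem_funDom (F + G) (M := M + N) fun x =>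
    (abs_add_le _ _).trans (add_le_add (hF x) (hG x))
  have h2 := E.funDom.smul_mem (1 / 2) (E.funDom.sub_mem (E.funDom.sub_mem h1
    (sq_mem_funDom F hF)) (sq_mem_funDom G hG))
  convert h2 using 1
  funext x
  change F.1 x * G.1 x = 1 / 2 * ((F.1 x + G.1 x) ^ 2 - F.1 x ^ 2 - G.1 x ^ 2)
  ring

end DirichletForm

/-! ### The exterior derivative and the carré du champ -/

/-- Only a seminorm is available, so the cross term is controlled by the Cauchy-Schwarz inequality
for semidefinite forms. It serves both for the energy and for energies weighted by a function. -/
theorem tendsto_form_self {V : Type*} [AddCommGroup V] [Module ℝ V] (B : V →ₗ[ℝ] V →ₗ[ℝ] ℝ)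
    (hB : ∀ u, 0 ≤ B u u) (hs : ∀ u v, B u v = B v u) {u : ℕ → V} {v : V}
    (h : Tendsto (fun n => B (u n - v) (u n - v)) atTop (𝓝 0)) :
    Tendsto (fun n => B (u n) (u n)) atTop (𝓝 (B v v)) := by
  have h1 : Tendsto (fun n => B (u n - v) v) atTop (𝓝 0) := by
    have h2 : Tendsto (fun n => √(B (u n - v) (u n - v) * B v v)) atTop (𝓝 0) := by
      have := (Real.continuous_sqrt.tendsto _).comp (h.mul_const (B v v))
      simpa [Function.comp_def] using this
    refine squeeze_zero_norm (fun n => ?_) h2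
    rw [Real.norm_eq_abs]
    refine Real.abs_le_sqrt ?_
    exact LinearMap.BilinForm.apply_sq_le_of_symm B hB ⟨fun x y => hs x y⟩ _ _
  have h2 : ∀ n, B (u n) (u n) = B (u n - v) (u n - v) + 2 * B (u n - v) v + B v v := by
    intro n
    simp only [map_sub, LinearMap.sub_apply, hs v (u n)]
    ring
  simp only [h2]
  simpa using (h.add (h1.const_mul 2)).add_const (B v v)

/-- Multiplication by a bounded function on `L²`. -/
theorem exists_bdd_mul {X : Type*} [MeasurableSpace X] {μ : Measure X} {h : X → ℝ}
    (hm : AEStronglyMeasurable h μ) {M : ℝ} (hM : ∀ᵐ x ∂μ, |h x| ≤ M) :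
    ∃ L : Lp ℝ 2 μ →L[ℝ] Lp ℝ 2 μ, ∀ v : Lp ℝ 2 μ, L v =ᵐ[μ] fun x => h x * v x := by
  have hmem : ∀ v : Lp ℝ 2 μ, MemLp (fun x => h x * v x) 2 μ := fun v =>
    (Lp.memLp v).of_le_mul (c := M) (hm.mul (Lp.aestronglyMeasurable v)) (by
      filter_upwards [hM] with x hx
      rw [norm_mul]
      gcongr
      exact hx)
  let L : Lp ℝ 2 μ →ₗ[ℝ] Lp ℝ 2 μ :=
    { toFun := fun v => (hmem v).toLp _
      map_add' := fun u v => by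
        refine Lp.ext ?_
        filter_upwards [(hmem (u + v)).coeFn_toLp, (hmem u).coeFn_toLp, (hmem v).coeFn_toLp,
          Lp.coeFn_add u v, Lp.coeFn_add ((hmem u).toLp _) ((hmem v).toLp _)] with x h1 h2 h3 h4 h5
        rw [h1, h5, Pi.add_apply, h2, h3, h4, Pi.add_apply, mul_add]
      map_smul' := fun c v => by
        refine Lp.ext ?_
        filter_upwards [(hmem (c • v)).coeFn_toLp, (hmem v).coeFn_toLp,
          Lp.coeFn_smul c v, Lp.coeFn_smul c ((hmem v).toLp _)] with x h1 h2 h3 h4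
        rw [h1, RingHom.id_apply, h4, Pi.smul_apply, h2, h3, Pi.smul_apply, smul_eq_mul,
          smul_eq_mul]
        ring }
  refine ⟨L.mkContinuous |M| fun v => ?_, fun v => (hmem v).coeFn_toLp⟩
  refine Lp.norm_le_mul_norm_of_ae_le_mul ?_
  filter_upwards [(hmem v).coeFn_toLp, hM] with x h1 h2
  change ‖((hmem v).toLp _ : Lp ℝ 2 μ) x‖ ≤ _
  rw [h1, norm_mul]
  gcongr
  exact h2.trans (le_abs_self M)

theorem inner_eq_integral_mul {X : Type*} [MeasurableSpace X] {μ : Measure X} (u v : Lp ℝ 2 μ) :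
    inner ℝ u v = ∫ x, u x * v x ∂μ := by
  rw [L2.inner_def]
  exact integral_congr_ae (Eventually.of_forall fun x => by simp [mul_comm])

/-- Weighted squares integrate continuously on `L²`. -/
theorem continuous_integral_bdd_mul_sq {X : Type*} [MeasurableSpace X] {μ : Measure X} {h : X → ℝ}
    (hm : AEStronglyMeasurable h μ) {M : ℝ} (hM : ∀ᵐ x ∂μ, |h x| ≤ M) :
    Continuous fun v : Lp ℝ 2 μ => ∫ x, h x * v x ^ 2 ∂μ := by
  obtain ⟨L, hL⟩ := exists_bdd_mul hm hM
  have : (fun v : Lp ℝ 2 μ => ∫ x, h x * v x ^ 2 ∂μ) = fun v => inner ℝ (L v) v := by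
    funext v
    rw [inner_eq_integral_mul]
    refine integral_congr_ae ?_
    filter_upwards [hL v] with x hx
    rw [hx]; ring
  rw [this]
  fun_prop

-- Continuous functions and constants in the domain.

namespace DirichletForm

variable {X : Type*} [MetricSpace X] [CompactSpace X] [MeasurableSpace X] [BorelSpace X]
  {μ : Measure X} [IsProbabilityMeasure μ] {E : DirichletForm X μ}

theorem core_mem_funDom (f : E.core) : (f.1 : X → ℝ) ∈ E.funDom := by
  have h1 : ((E.coreToDom f : Lp ℝ 2 μ) : X → ℝ) =ᵐ[μ] f.1 := ContinuousMap.coeFn_toLp μ f.1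
  have h2 : MemLp (f.1 : X → ℝ) 2 μ := (memLp_congr_ae h1).1 (Lp.memLp _)
  refine ⟨h2, ?_⟩
  have : h2.toLp _ = (E.coreToDom f : Lp ℝ 2 μ) := Lp.ext (h2.coeFn_toLp.trans h1.symm)
  rw [this]
  exact (E.coreToDom f).2

theorem cls_core (f : E.core) : E.cls ⟨f.1, core_mem_funDom f⟩ = E.coreToDom f :=
  cls_eq_of_ae (ContinuousMap.coeFn_toLp μ f.1).symm

/-- A core function within distance `1` of the constant `2` exceeds `1` everywhere, so its
truncation at level `1` is exactly the constant `1`. -/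
theorem one_mem_funDom (hreg : E.IsRegular) : (fun _ : X => (1 : ℝ)) ∈ E.funDom := by
  obtain ⟨f, hf, hd⟩ := hreg.1.exists_dist_lt (ContinuousMap.const X (2 : ℝ)) one_pos
  obtain ⟨G, hG, -⟩ := exists_truncation ⟨f, core_mem_funDom ⟨f, hf⟩⟩ one_pos
  convert G.2 using 1
  funext x
  have h1 : dist (2 : ℝ) (f x) < 1 := (ContinuousMap.dist_apply_le_dist x).trans_lt hd
  rw [Real.dist_eq, abs_lt] at h1
  rw [hG]
  change 1 = max 0 (min (f x) 1)
  rw [min_eq_right (by linarith), max_eq_right zero_le_one]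

theorem energy_one (hreg : E.IsRegular) (hloc : E.IsStrictlyLocal) (F : E.funDom) :
    E.energy F ⟨_, one_mem_funDom hreg⟩ = 0 := by
  refine hloc _ _ univ univ 1 isClosed_univ isOpen_univ subset_rfl (by simp) ?_
  filter_upwards [coeFn_cls ⟨_, one_mem_funDom hreg⟩] with x hx _
  rw [hx]

end DirichletForm

-- The closed derivative, its adjoint and the two Laplacians.

namespace CarreDuChamp

open DirichletForm

variable {X : Type*} [MetricSpace X] [CompactSpace X] [MeasurableSpace X] [BorelSpace X]
  {μ : Measure X} [IsProbabilityMeasure μ] {E : DirichletForm X μ} (Γ : CarreDuChamp E)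

omit [MetricSpace X] [CompactSpace X] [BorelSpace X] [IsProbabilityMeasure μ] in
/-- The defining identity of the carré du champ on functions. -/
theorem energy_identity {F G H : E.funDom} {M : ℝ} (hF : ∀ x, |F.1 x| ≤ M) (hG : ∀ x, |G.1 x| ≤ M)
    (hH : ∀ x, |H.1 x| ≤ M) (FG FH GH : E.funDom) (hFG : ∀ x, FG.1 x = F.1 x * G.1 x)
    (hFH : ∀ x, FH.1 x = F.1 x * H.1 x) (hGH : ∀ x, GH.1 x = G.1 x * H.1 x) :
    E.energy FH G + E.energy GH F - E.energy H FG
      = 2 * ∫ x, H.1 x * Γ.toFun (E.cls F) (E.cls G) x ∂μ := by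
  have hb : ∀ F : E.funDom, (∀ x, |F.1 x| ≤ M) → IsEssBounded (E.cls F : Lp ℝ 2 μ) := by
    intro F hF
    refine ⟨M, ?_⟩
    filter_upwards [coeFn_cls F] with x hx
    rw [hx]; exact hF x
  have hp : ∀ F G K : E.funDom, (∀ x, K.1 x = F.1 x * G.1 x) →
      IsProduct (E.cls K : Lp ℝ 2 μ) (E.cls F) (E.cls G) := by
    intro F G K h
    filter_upwards [coeFn_cls F, coeFn_cls G, coeFn_cls K] with x h1 h2 h3
    rw [h1, h2, h3, h]
  have := Γ.identity (E.cls F) (E.cls G) (E.cls H) (E.cls FG) (E.cls FH) (E.cls GH) (hb F hF)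
    (hb G hG) (hb H hH) (hp F G FG hFG) (hp F H FH hFH) (hp G H GH hGH)
  rw [energy_apply, energy_apply, energy_apply, this]
  congr 1
  refine integral_congr_ae ?_
  filter_upwards [coeFn_cls H] with x hx
  rw [hx]

/-- `𝓔(F, F) = ∫ Γ(F, F) dμ` for bounded `F`. -/
theorem energy_eq_integral (hreg : E.IsRegular) (hloc : E.IsStrictlyLocal) (F : E.funDom) {M : ℝ}
    (hF : ∀ x, |F.1 x| ≤ M) : E.energy F F = ∫ x, Γ.toFun (E.cls F) (E.cls F) x ∂μ := by
  -- Take the test function `1`: the term `𝓔(1, F²)` vanishes by strict locality, and the two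
  -- remaining terms coincide.
  have h := Γ.energy_identity (F := F) (G := F) (H := ⟨_, one_mem_funDom hreg⟩) (M := max M 1)
    (fun x => (hF x).trans (le_max_left _ _)) (fun x => (hF x).trans (le_max_left _ _))
    (fun x => by simp) ⟨_, mul_mem_funDom F F hF hF⟩ F F (fun x => rfl) (fun x => (mul_one _).symm)
    (fun x => (mul_one _).symm)
  rw [energy_symm ⟨_, one_mem_funDom hreg⟩, energy_one hreg hloc] at h
  simp only [one_mul] at h
  linarith

/-- The exterior derivative on `C(X) ∩ Dom 𝓔`. -/
noncomputable def coreDeriv : E.core →ₗ[ℝ] Γ.OneForms where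
  toFun f := ((Γ.tensor f (BoundedBorel.one X) : Γ.Tensors) : Γ.OneForms)
  map_add' f g := by
    rw [tensor, TensorProduct.add_tmul]; exact UniformSpace.Completion.coe_add _ _
  map_smul' c f := by
    rw [tensor, ← TensorProduct.smul_tmul']
    exact UniformSpace.Completion.coe_smul c (Γ.tensor f (BoundedBorel.one X))

theorem mem_derivGraph (p : Lp ℝ 2 μ × Γ.OneForms) : p ∈ Γ.derivGraph ↔
    ∃ f : E.core, p.1 = (E.coreToDom f : Lp ℝ 2 μ) ∧ p.2 = Γ.coreDeriv f := Iff.rfl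

theorem norm_coreDeriv_sq (hreg : E.IsRegular) (hloc : E.IsStrictlyLocal) (f : E.core) :
    ‖Γ.coreDeriv f‖ ^ 2 = E.form (E.coreToDom f) (E.coreToDom f) := by
  have h1 : ‖Γ.coreDeriv f‖ = ‖Γ.tensor f (BoundedBorel.one X)‖ :=
    UniformSpace.Completion.norm_coe _
  rw [h1, ← real_inner_self_eq_norm_sq]
  change ∫ x, Γ.fibreInner (Γ.tensor f (BoundedBorel.one X))
    (Γ.tensor f (BoundedBorel.one X)) x ∂μ = _
  obtain ⟨M, hM⟩ := (isCompact_range f.1.continuous).isBounded.exists_norm_le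
  have h2 := Γ.energy_eq_integral hreg hloc ⟨f.1, core_mem_funDom f⟩ (M := M)
    (fun x => hM _ ⟨x, rfl⟩)
  rw [energy_apply, cls_core] at h2
  rw [h2]
  refine integral_congr_ae ?_
  filter_upwards [Γ.fibreInner_tensor f f (BoundedBorel.one X) (BoundedBorel.one X)] with x hx
  rw [hx]
  change 1 * 1 * _ = _
  rw [one_mul, one_mul]; rfl

/-- Elements of the closure of the graph of the derivative are limits of core elements in the norm
of the form domain. -/
theorem exists_seq_of_mem_closure (hreg : E.IsRegular) (hloc : E.IsStrictlyLocal)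
    {u : Lp ℝ 2 μ} {ζ : Γ.OneForms} (h : (u, ζ) ∈ Γ.derivGraph.topologicalClosure) :
    ∃ (hu : u ∈ E.dom) (f : ℕ → E.core),
      Tendsto (fun n => E.form (E.coreToDom (f n) - ⟨u, hu⟩) (E.coreToDom (f n) - ⟨u, hu⟩)
        + ‖E.coreToDom (f n) - ⟨u, hu⟩‖ ^ 2) atTop (𝓝 0) ∧
      Tendsto (fun n => Γ.coreDeriv (f n)) atTop (𝓝 ζ) := by
  rw [← SetLike.mem_coe, Submodule.topologicalClosure_coe, mem_closure_iff_seq_limit] at h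
  obtain ⟨p, hp, hlim⟩ := h
  choose f hf1 hf2 using fun n => (Γ.mem_derivGraph (p n)).1 (hp n)
  have hl1 : Tendsto (fun n => (E.coreToDom (f n) : Lp ℝ 2 μ)) atTop (𝓝 u) :=
    ((continuous_fst.tendsto _).comp hlim).congr hf1
  have hl2 : Tendsto (fun n => Γ.coreDeriv (f n)) atTop (𝓝 ζ) :=
    ((continuous_snd.tendsto _).comp hlim).congr hf2
  obtain ⟨v, hv⟩ := E.closed (fun n => E.coreToDom (f n)) (by
    intro ε hε
    obtain ⟨N, hN⟩ := Metric.cauchySeq_iff.1 hl1.cauchySeq (√(ε / 2)) (by positivity)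
    obtain ⟨N', hN'⟩ := Metric.cauchySeq_iff.1 hl2.cauchySeq (√(ε / 2)) (by positivity)
    refine ⟨max N N', fun m hm n hn => ?_⟩
    have h1 := hN m (le_of_max_le_left hm) n (le_of_max_le_left hn)
    have h2 := hN' m (le_of_max_le_right hm) n (le_of_max_le_right hn)
    rw [dist_eq_norm] at h1 h2
    rw [← map_sub] at h2 ⊢
    rw [← Γ.norm_coreDeriv_sq hreg hloc]
    have h3 : ‖E.coreToDom (f m - f n)‖ < √(ε / 2) := by
      rw [map_sub]; exact h1
    have h4 := (Real.lt_sqrt (norm_nonneg _)).1 h2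
    have h5 := (Real.lt_sqrt (norm_nonneg _)).1 h3
    linarith)
  have hlv : Tendsto (fun n => (E.coreToDom (f n) : Lp ℝ 2 μ)) atTop (𝓝 (v : Lp ℝ 2 μ)) := by
    rw [tendsto_iff_norm_sub_tendsto_zero]
    have h1 : Tendsto (fun n => ‖E.coreToDom (f n) - v‖ ^ 2) atTop (𝓝 0) :=
      squeeze_zero (fun _ => sq_nonneg _)
        (fun n => by linarith [E.nonneg (E.coreToDom (f n) - v)]) hv
    have h2 := (Real.continuous_sqrt.tendsto 0).comp h1
    rw [Real.sqrt_zero] at h2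
    refine h2.congr fun n => ?_
    rw [Function.comp_apply, Real.sqrt_sq (norm_nonneg _)]
    rfl
  obtain rfl : u = v := tendsto_nhds_unique hl1 hlv
  exact ⟨v.2, f, hv, hl2⟩

/-- The isometry `norm_coreDeriv_sq` passes to the closure. It yields closability, since `u = 0`
forces `ζ = 0`, and shows that the closed derivative has its domain inside that of the form. -/
theorem norm_sq_of_mem_closure (hreg : E.IsRegular) (hloc : E.IsStrictlyLocal)
    {u : Lp ℝ 2 μ} {ζ : Γ.OneForms} (h : (u, ζ) ∈ Γ.derivGraph.topologicalClosure) :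
    ∃ hu : u ∈ E.dom, ‖ζ‖ ^ 2 = E.form ⟨u, hu⟩ ⟨u, hu⟩ := by
  obtain ⟨hu, f, hf, hζ⟩ := Γ.exists_seq_of_mem_closure hreg hloc h
  refine ⟨hu, ?_⟩
  have h1 : Tendsto (fun n => E.form (E.coreToDom (f n)) (E.coreToDom (f n))) atTop
      (𝓝 (E.form ⟨u, hu⟩ ⟨u, hu⟩)) :=
    tendsto_form_self E.form E.nonneg E.symm (squeeze_zero (fun _ => E.nonneg _)
      (fun n => le_add_of_nonneg_right (sq_nonneg _)) hf)
  refine tendsto_nhds_unique (hζ.norm.pow 2) (h1.congr fun n => ?_)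
  exact (Γ.norm_coreDeriv_sq hreg hloc _).symm

theorem exists_mem_closure (hreg : E.IsRegular) (hloc : E.IsStrictlyLocal) (u : E.dom) :
    ∃ ζ, ((u : Lp ℝ 2 μ), ζ) ∈ Γ.derivGraph.topologicalClosure := by
  choose f hf using fun n : ℕ => hreg.2 u ((1 / ((n : ℝ) + 1)) ^ 2) (by positivity)
  have hE : ∀ n, √(E.form (u - E.coreToDom (f n)) (u - E.coreToDom (f n))) ≤ 1 / ((n : ℝ) + 1) := by
    intro n
    rw [Real.sqrt_le_left (by positivity)]
    have := hf n
    linarith [sq_nonneg ‖u - E.coreToDom (f n)‖]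
  have hN : ∀ n, ‖u - E.coreToDom (f n)‖ ≤ 1 / ((n : ℝ) + 1) := by
    intro n
    refine (sq_le_sq₀ (norm_nonneg _) (by positivity)).1 ?_
    have := hf n
    linarith [E.nonneg (u - E.coreToDom (f n))]
  have hlim0 : Tendsto (fun n : ℕ => 1 / ((n : ℝ) + 1)) atTop (𝓝 0) :=
    tendsto_one_div_add_atTop_nhds_zero_nat
  have hpar : ∀ a b : E.dom, E.form (a - b) (a - b) ≤ 2 * (E.form a a + E.form b b) := by
    intro a b
    have := E.nonneg (a + b)
    simp only [map_sub, map_add, LinearMap.sub_apply, LinearMap.add_apply] at this ⊢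
    linarith
  have hcau : CauchySeq fun n => Γ.coreDeriv (f n) := by
    rw [Metric.cauchySeq_iff]
    intro ε hε
    obtain ⟨N, hN'⟩ := ((hlim0.const_mul 2).eventually (gt_mem_nhds (by simpa using hε))).exists
    refine ⟨N, fun m hm n hn => ?_⟩
    have a1 : (1 : ℝ) / ((m : ℝ) + 1) ≤ 1 / ((N : ℝ) + 1) := Nat.one_div_le_one_div hm
    have a2 : (1 : ℝ) / ((n : ℝ) + 1) ≤ 1 / ((N : ℝ) + 1) := Nat.one_div_le_one_div hn
    have a3 : (0 : ℝ) < 1 / ((m : ℝ) + 1) := by positivity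
    have a4 : (0 : ℝ) < 1 / ((n : ℝ) + 1) := by positivity
    rw [dist_eq_norm, ← map_sub]
    refine lt_of_le_of_lt ?_ hN'
    refine (sq_le_sq₀ (norm_nonneg _) (by positivity)).1 ?_
    rw [Γ.norm_coreDeriv_sq hreg hloc, map_sub]
    have e1 : E.coreToDom (f m) - E.coreToDom (f n)
        = (u - E.coreToDom (f n)) - (u - E.coreToDom (f m)) := by abel
    rw [e1]
    refine (hpar _ _).trans ?_
    have h1 := hf m
    have h2 := hf n
    have h3 := sq_nonneg ‖u - E.coreToDom (f n)‖
    have h4 := sq_nonneg ‖u - E.coreToDom (f m)‖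
    nlinarith
  obtain ⟨ζ, hζ⟩ := cauchySeq_tendsto_of_complete hcau
  refine ⟨ζ, ?_⟩
  rw [← SetLike.mem_coe, Submodule.topologicalClosure_coe, mem_closure_iff_seq_limit]
  refine ⟨fun n => ((E.coreToDom (f n) : Lp ℝ 2 μ), Γ.coreDeriv (f n)),
    fun n => (Γ.mem_derivGraph _).2 ⟨f n, rfl, rfl⟩, ?_⟩
  refine Tendsto.prodMk_nhds ?_ hζ
  rw [tendsto_iff_norm_sub_tendsto_zero]
  refine squeeze_zero (fun _ => norm_nonneg _) (fun n => ?_) hlim0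
  rw [norm_sub_rev]
  exact hN n

theorem unique_of_mem_closure (hreg : E.IsRegular) (hloc : E.IsStrictlyLocal) {ζ : Γ.OneForms}
    (h : (0, ζ) ∈ Γ.derivGraph.topologicalClosure) : ζ = 0 := by
  obtain ⟨hu, e⟩ := Γ.norm_sq_of_mem_closure hreg hloc h
  have : (⟨0, hu⟩ : E.dom) = 0 := rfl
  rw [this, map_zero] at e
  exact norm_eq_zero.1 (pow_eq_zero_iff two_ne_zero |>.1 e)

theorem graph_deriv (hreg : E.IsRegular) (hloc : E.IsStrictlyLocal) :
    Γ.deriv.graph = Γ.derivGraph.topologicalClosure := by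
  refine Submodule.toLinearPMap_graph_eq _ ?_
  rintro ⟨u, ζ⟩ h rfl
  exact Γ.unique_of_mem_closure hreg hloc h

theorem mem_graph_deriv_iff (hreg : E.IsRegular) (hloc : E.IsStrictlyLocal) {u : Lp ℝ 2 μ} :
    (∃ ζ, (u, ζ) ∈ Γ.deriv.graph) ↔ u ∈ E.dom := by
  rw [Γ.graph_deriv hreg hloc]
  refine ⟨?_, fun h => Γ.exists_mem_closure hreg hloc ⟨u, h⟩⟩
  rintro ⟨ζ, h⟩
  exact (Γ.norm_sq_of_mem_closure hreg hloc h).1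

theorem isAdjointPair (hreg : E.IsRegular) (hloc : E.IsStrictlyLocal) :
    IsAdjointPair Γ.deriv.graph Γ.coderiv.graph := by
  have hdense : Dense {u : Lp ℝ 2 μ | ∃ ζ, (u, ζ) ∈ Γ.deriv.graph} := by
    simp only [Γ.mem_graph_deriv_iff hreg hloc]
    exact E.dense_dom
  refine IsAdjointPair.of_isClosed ?_ ?_ hdense ?_
  · rw [Γ.graph_deriv hreg hloc]
    exact Submodule.isClosed_topologicalClosure _
  · rw [Γ.graph_deriv hreg hloc]
    exact fun ζ => Γ.unique_of_mem_closure hreg hloc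
  · intro y w
    have hd : Dense (Γ.deriv.domain : Set (Lp ℝ 2 μ)) := by
      convert hdense using 1
      ext u
      exact LinearPMap.mem_domain_iff
    rw [coderiv, LinearPMap.adjoint_graph_eq_graph_adjoint hd, Submodule.mem_adjoint_iff]
    refine forall₂_congr fun x z => imp_congr_right fun _ => ?_
    rw [sub_eq_zero, eq_comm, real_inner_comm, real_inner_comm y]

theorem form_eq_inner (hreg : E.IsRegular) (hloc : E.IsStrictlyLocal) {u v : E.dom}
    {ζ ξ : Γ.OneForms} (h : ((u : Lp ℝ 2 μ), ζ) ∈ Γ.deriv.graph)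
    (h' : ((v : Lp ℝ 2 μ), ξ) ∈ Γ.deriv.graph) : E.form u v = inner ℝ ζ ξ := by
  have h1 : ‖ζ‖ ^ 2 = E.form u u := by
    rw [Γ.graph_deriv hreg hloc] at h
    exact (Γ.norm_sq_of_mem_closure hreg hloc h).2
  have h2 : ‖ξ‖ ^ 2 = E.form v v := by
    rw [Γ.graph_deriv hreg hloc] at h'
    exact (Γ.norm_sq_of_mem_closure hreg hloc h').2
  have h3 : ‖ζ + ξ‖ ^ 2 = E.form (u + v) (u + v) := by
    have := Γ.deriv.graph.add_mem h h'
    rw [Γ.graph_deriv hreg hloc] at this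
    exact (Γ.norm_sq_of_mem_closure hreg hloc this).2
  rw [@norm_add_sq_real, h1, h2] at h3
  simp only [map_add, LinearMap.add_apply] at h3
  rw [E.symm v u] at h3
  linarith

/-- The weak definition of `Δ` tests against the form domain, which is the domain of `∂`; with
`form_eq_inner` it says precisely that `Δ = -∂*∂`. This brings the heat semigroup into the
intertwining relation. -/
theorem isLaplacian_eq (hreg : E.IsRegular) (hloc : E.IsStrictlyLocal) :
    E.IsLaplacian = negComp Γ.deriv.graph Γ.coderiv.graph := by
  funext u w
  refine propext ⟨?_, ?_⟩
  · rintro ⟨hu, h⟩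
    obtain ⟨ζ, hζ⟩ := (Γ.mem_graph_deriv_iff hreg hloc).2 hu
    refine ⟨ζ, hζ, ((Γ.isAdjointPair hreg hloc).mem_right _ _).2 fun x z hxz => ?_⟩
    have hx := (Γ.mem_graph_deriv_iff hreg hloc).1 ⟨z, hxz⟩
    rw [← Γ.form_eq_inner hreg hloc (u := ⟨u, hu⟩) (v := ⟨x, hx⟩) hζ hxz, h, inner_neg_left]
  · rintro ⟨ζ, hζ, h⟩
    have hu := (Γ.mem_graph_deriv_iff hreg hloc).1 ⟨ζ, hζ⟩
    refine ⟨hu, fun φ => ?_⟩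
    obtain ⟨ξ, hξ⟩ := (Γ.mem_graph_deriv_iff hreg hloc).2 φ.2
    rw [Γ.form_eq_inner hreg hloc (u := ⟨u, hu⟩) hζ hξ,
      ← (Γ.isAdjointPair hreg hloc).inner_eq hξ h, inner_neg_left]

theorem isFormLaplacian_eq : Γ.IsFormLaplacian = negComp Γ.coderiv.graph Γ.deriv.graph := by
  funext η ζ
  refine propext ⟨?_, ?_⟩
  · rintro ⟨h, h', rfl⟩
    refine ⟨_, LinearPMap.mem_graph _ ⟨η, h⟩, ?_⟩
    rw [neg_neg]
    exact LinearPMap.mem_graph _ ⟨_, h'⟩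
  · rintro ⟨z, hz, hz'⟩
    rw [LinearPMap.mem_graph_iff] at hz hz'
    obtain ⟨⟨_, h1⟩, rfl, rfl⟩ := hz
    obtain ⟨⟨_, h2⟩, h3, h4⟩ := hz'
    simp only at h3
    subst h3
    exact ⟨h1, h2, by rw [h4, neg_neg]⟩

/-! ### The fibrewise norm -/

theorem fibreNorm_coe (v : Γ.Tensors) : Γ.fibreNorm (v : Γ.OneForms) = Γ.fibreNormTensor v :=
  UniformSpace.Completion.extension_coe Γ.lipschitz_fibreNormTensor.uniformContinuous v

theorem continuous_fibreNorm : Continuous Γ.fibreNorm := UniformSpace.Completion.continuous_extension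

theorem fibreNorm_smul {c : ℝ} (hc : 0 ≤ c) (η : Γ.OneForms) :
    Γ.fibreNorm (c • η) = c • Γ.fibreNorm η := by
  refine UniformSpace.Completion.induction_on η ?_ fun v => ?_
  · exact isClosed_eq (Γ.continuous_fibreNorm.comp (continuous_const_smul c))
      (Γ.continuous_fibreNorm.const_smul c)
  · rw [← UniformSpace.Completion.coe_smul, fibreNorm_coe, fibreNorm_coe]
    have e : ∀ u, Γ.fibreNormTensor u =ᵐ[μ] fun x => √(Γ.fibreInner u u x) :=
      fun u => MemLp.coeFn_toLp _
    refine Lp.ext ?_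
    have e1 : Γ.fibreInner (c • v) (c • v) = c • c • Γ.fibreInner v v := by
      simp only [map_smul, LinearMap.smul_apply]
    have e2 := e (c • v)
    rw [e1] at e2
    filter_upwards [e2, e v, Lp.coeFn_smul c (Γ.fibreNormTensor v),
      AEEqFun.coeFn_smul c (c • Γ.fibreInner v v), AEEqFun.coeFn_smul c (Γ.fibreInner v v)]
      with x h1 h2 h3 h4 h5
    rw [h1, h3, Pi.smul_apply, h2, h4, Pi.smul_apply, h5, Pi.smul_apply, smul_eq_mul, smul_eq_mul,
      smul_eq_mul, ← mul_assoc, Real.sqrt_mul (mul_self_nonneg c), Real.sqrt_mul_self hc]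

theorem fibreNorm_nonneg (η : Γ.OneForms) : 0 ≤ᵐ[μ] Γ.fibreNorm η := by
  rw [Lp.coeFn_nonneg]
  refine UniformSpace.Completion.induction_on η ?_ fun v => ?_
  · exact isClosed_le continuous_const Γ.continuous_fibreNorm
  · rw [fibreNorm_coe, ← Lp.coeFn_nonneg]
    have e : Γ.fibreNormTensor v =ᵐ[μ] fun x => √(Γ.fibreInner v v x) := MemLp.coeFn_toLp _
    filter_upwards [e] with x hx
    rw [hx]; exact Real.sqrt_nonneg _

theorem integral_bdd_mul_fibreNorm_coreDeriv (h : X → ℝ) (f : E.core) :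
    ∫ x, h x * Γ.fibreNorm (Γ.coreDeriv f) x ^ 2 ∂μ
      = ∫ x, h x * Γ.toFun (E.coreToDom f) (E.coreToDom f) x ∂μ := by
  have e : Γ.fibreNorm (Γ.coreDeriv f) =ᵐ[μ] fun x => √(Γ.fibreInner
      (Γ.tensor f (BoundedBorel.one X)) (Γ.tensor f (BoundedBorel.one X)) x) := by
    change Γ.fibreNorm ((Γ.tensor f (BoundedBorel.one X) : Γ.Tensors) : Γ.OneForms) =ᵐ[μ] _
    rw [fibreNorm_coe]
    exact MemLp.coeFn_toLp _
  refine integral_congr_ae ?_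
  filter_upwards [e, Γ.fibreInner_nonneg (Γ.tensor f (BoundedBorel.one X)),
    Γ.fibreInner_tensor f f (BoundedBorel.one X) (BoundedBorel.one X)] with x h1 h2 h3
  rw [h1, Real.sq_sqrt h2, h3]
  change _ * (1 * 1 * _) = _
  rw [one_mul, one_mul]; rfl

/-- Integration of `Γ` and of the squared fibrewise norm of the derivative against nonnegative
bounded weights agree. -/
theorem integral_bdd_mul_fibreNorm_sq (hreg : E.IsRegular) (hloc : E.IsStrictlyLocal) {h : X → ℝ}
    (hm : AEStronglyMeasurable h μ) {M : ℝ} (hM : ∀ᵐ x ∂μ, |h x| ≤ M) (h0 : ∀ᵐ x ∂μ, 0 ≤ h x)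
    {u : E.dom} {ζ : Γ.OneForms} (hu : ((u : Lp ℝ 2 μ), ζ) ∈ Γ.deriv.graph) :
    ∫ x, h x * Γ.fibreNorm ζ x ^ 2 ∂μ = ∫ x, h x * Γ.toFun u u x ∂μ := by
  rw [Γ.graph_deriv hreg hloc] at hu
  obtain ⟨_, f, hf, hζ⟩ := Γ.exists_seq_of_mem_closure hreg hloc hu
  have hint : ∀ φ : Lp ℝ 1 μ, Integrable (fun x => h x * φ x) μ := fun φ =>
    (L1.integrable_coeFn φ).bdd_mul (c := M) hm hM
  let ℓ : Lp ℝ 1 μ →ₗ[ℝ] ℝ :=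
    { toFun := fun φ => ∫ x, h x * φ x ∂μ
      map_add' := fun φ ψ => by
        rw [← integral_add (hint φ) (hint ψ)]
        refine integral_congr_ae ?_
        filter_upwards [Lp.coeFn_add φ ψ] with x hx
        rw [hx, Pi.add_apply, mul_add]
      map_smul' := fun c φ => by
        rw [RingHom.id_apply, smul_eq_mul, ← integral_const_mul]
        refine integral_congr_ae ?_
        filter_upwards [Lp.coeFn_smul c φ] with x hx
        rw [hx, Pi.smul_apply, smul_eq_mul]; ring }
  have hℓ : ∀ φ, |ℓ φ| ≤ |M| * ‖φ‖ := by
    intro φ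
    rw [L1.norm_eq_integral_norm, ← integral_const_mul, ← Real.norm_eq_abs]
    refine (norm_integral_le_integral_norm _).trans (integral_mono_ae (hint φ).norm
      ((L1.integrable_coeFn φ).norm.const_mul _) ?_)
    filter_upwards [hM] with x hx
    rw [norm_mul]
    gcongr
    exact hx.trans (le_abs_self M)
  -- The weighted energy `∫ h Γ` is a nonnegative symmetric form, continuous in the form norm, so
  -- `tendsto_form_self` passes from the core to its closure.
  let B : E.dom →ₗ[ℝ] E.dom →ₗ[ℝ] ℝ := Γ.toFun.compr₂ ℓ
  have hB : ∀ v, 0 ≤ B v v := fun v => by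
    refine integral_nonneg_of_ae ?_
    filter_upwards [h0, (Lp.coeFn_nonneg _).2 (Γ.nonneg v)] with x h1 h2
    exact mul_nonneg h1 h2
  obtain ⟨C, hC⟩ := Γ.continuous
  have hlim : Tendsto (fun n => B (E.coreToDom (f n) - u) (E.coreToDom (f n) - u)) atTop (𝓝 0) := by
    refine squeeze_zero (fun n => hB _) (fun n => ?_)
      (by have := hf.const_mul (|M| * C); rwa [mul_zero] at this)
    refine (le_abs_self _).trans ((hℓ _).trans ?_)
    rw [mul_assoc]
    gcongr
    exact hC _
  have h1 := tendsto_form_self B hB (fun v w => by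
    change ℓ _ = ℓ _; rw [Γ.symm]) hlim
  have h2 := (((continuous_integral_bdd_mul_sq hm hM).comp Γ.continuous_fibreNorm).tendsto ζ).comp hζ
  refine tendsto_nhds_unique h2 (h1.congr fun n => ?_)
  exact (Γ.integral_bdd_mul_fibreNorm_coreDeriv h (f n)).symm

end CarreDuChamp

/-! ### Markov properties of the heat semigroup -/

namespace DirichletForm

section Representatives

variable {X : Type*} [MeasurableSpace X] {μ : Measure X} {E : DirichletForm X μ}

theorem mem_funDom_of_ae {F : X → ℝ} {u : E.dom} (h : F =ᵐ[μ] (u : Lp ℝ 2 μ)) : F ∈ E.funDom := by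
  have h1 : MemLp F 2 μ := (memLp_congr_ae h).2 (Lp.memLp _)
  have h2 : h1.toLp F = (u : Lp ℝ 2 μ) := Lp.ext (h1.coeFn_toLp.trans h)
  exact ⟨h1, h2 ▸ u.2⟩

/-- The algebra and truncation lemmas require bounds at every point; clamping a representative
changes it only on a null set. -/
theorem exists_bounded_rep (u : E.dom) {a b : ℝ} (hab : a ≤ b) (ha : ∀ᵐ x ∂μ, a ≤ (u : Lp ℝ 2 μ) x)
    (hb : ∀ᵐ x ∂μ, (u : Lp ℝ 2 μ) x ≤ b) :
    ∃ F : E.funDom, E.cls F = u ∧ ∀ x, F.1 x ∈ Icc a b := by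
  have h : (fun x => max a (min ((u : Lp ℝ 2 μ) x) b)) =ᵐ[μ] (u : Lp ℝ 2 μ) := by
    filter_upwards [ha, hb] with x h1 h2
    rw [min_eq_left h2, max_eq_right h1]
  exact ⟨⟨_, mem_funDom_of_ae h⟩, cls_eq_of_ae h,
    fun x => ⟨le_max_left _ _, max_le hab (min_le_right _ _)⟩⟩

theorem form_eq_of_isLaplacian {u v : E.dom} {w : Lp ℝ 2 μ} (h : E.IsLaplacian u w) :
    E.form u v = -inner ℝ w (v : Lp ℝ 2 μ) := h.2 v

/-- The norm of `v⁻` is the distance from `v` to the positive cone, and the right side is the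
distance from `v` to the element `u⁺` of that cone. -/
theorem dist_negPart_le (u v : Lp ℝ 2 μ) :
    ‖Lp.negPart v‖ ≤ ‖(v - u) - Lp.negPart u‖ := by
  refine Lp.norm_le_norm_of_ae_le ?_
  filter_upwards [Lp.coeFn_negPart_eq_max u, Lp.coeFn_negPart_eq_max v,
    Lp.coeFn_sub (v - u) (Lp.negPart u), Lp.coeFn_sub v u] with x h1 h2 h3 h4
  rw [h2, h3, Pi.sub_apply, h4, Pi.sub_apply, h1, Real.norm_eq_abs, Real.norm_eq_abs,
    abs_of_nonneg (le_max_right _ _)]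
  generalize (u : X → ℝ) x = a
  generalize (v : X → ℝ) x = b
  refine max_le ?_ (abs_nonneg _)
  rw [le_abs]
  right
  have := le_max_left (-a) 0
  have := le_max_right (-a) 0
  rcases max_cases (-a) 0 with h | h <;> linarith [h.1]

theorem negPart_eq_zero_iff (u : Lp ℝ 2 μ) : Lp.negPart u = 0 ↔ 0 ≤ᵐ[μ] u := by
  constructor
  · intro h
    have h1 := Lp.coeFn_negPart_eq_max u
    rw [h] at h1
    filter_upwards [h1, Lp.coeFn_zero ℝ 2 μ] with x h2 h3
    rw [h3] at h2
    have := le_max_left (-u x) 0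
    rw [← h2] at this
    simp only [Pi.zero_apply] at this ⊢
    linarith
  · intro h
    refine Lp.ext ?_
    filter_upwards [h, Lp.coeFn_negPart_eq_max u, Lp.coeFn_zero ℝ 2 μ] with x h1 h2 h3
    simp only [Pi.zero_apply] at h1 h3
    rw [h2, h3, max_eq_right (by linarith)]

end Representatives

/-- The heat semigroup of a Dirichlet form, when it maps into bounded functions. -/
structure IsBoundingSemigroup {X : Type*} [MeasurableSpace X] {μ : Measure X}
    (E : DirichletForm X μ) (P : ℝ → Lp ℝ 2 μ →L[ℝ] Lp ℝ 2 μ) : Prop where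
  selfAdjoint : IsNonposSelfAdjoint E.IsLaplacian
  generated : IsSemigroupGeneratedBy P E.IsLaplacian
  bounded : ∀ t > 0, ∀ f, ∃ C, ∀ᵐ x ∂μ, |P t f x| ≤ C

-- Positivity, conservation of constants and Jensen's inequality.

namespace IsBoundingSemigroup

variable {X : Type*} [MeasurableSpace X] {μ : Measure X} {E : DirichletForm X μ}
  {P : ℝ → Lp ℝ 2 μ →L[ℝ] Lp ℝ 2 μ}

/-- With `u = P t f` one has `-⟨Δu, u⁻⟩ = 𝓔(u, u⁻) ≤ 0`. Boundedness of `u` is what makes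
`exists_negPart` applicable. -/
theorem inner_negPart_nonneg (hP : E.IsBoundingSemigroup P) {t : ℝ} (ht : 0 < t) {f w : Lp ℝ 2 μ}
    (hw : E.IsLaplacian (P t f) w) : 0 ≤ inner ℝ w (Lp.negPart (P t f)) := by
  obtain ⟨C, hC⟩ := hP.bounded t ht f
  set u : E.dom := ⟨P t f, hw.1⟩ with hu
  obtain ⟨F, hF, hFb⟩ := exists_bounded_rep u (a := -|C|) (b := |C|)
    (by linarith [abs_nonneg C])
    (by filter_upwards [hC] with x hx using (abs_le.1 (hx.trans (le_abs_self C))).1)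
    (by filter_upwards [hC] with x hx using (abs_le.1 (hx.trans (le_abs_self C))).2)
  obtain ⟨N, hN, hle⟩ := exists_negPart F (M := |C|) (fun x => abs_le.2 (hFb x))
  rw [energy_apply, hF, form_eq_of_isLaplacian (u := u) hw] at hle
  have e : (E.cls N : Lp ℝ 2 μ) = Lp.negPart (P t f) := by
    refine Lp.ext ?_
    have h1 := coeFn_cls F
    rw [hF] at h1
    filter_upwards [coeFn_cls N, Lp.coeFn_negPart_eq_max (P t f), h1] with x h2 h3 h4
    rw [h2, h3, hN, ← h4, max_comm]
  rw [e] at hle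
  linarith

/-- The squared distance of `P t f` to the cone of nonnegative functions does not increase, and it
starts at zero. -/
theorem nonneg (hP : E.IsBoundingSemigroup P) {t : ℝ} (ht : 0 ≤ t) {f : Lp ℝ 2 μ}
    (hf : 0 ≤ᵐ[μ] f) : 0 ≤ᵐ[μ] P t f := by
  have hS := hP.generated
  have hA := hP.selfAdjoint
  rcases ht.eq_or_lt with rfl | ht
  · rwa [hS.apply_zero]
  set g : ℝ → ℝ := fun t => ‖Lp.negPart (P t f)‖ ^ 2 with hg
  have hcont : ContinuousOn g (Ici 0) :=
    ((Lp.continuous_negPart.comp_continuousOn (hS.continuousOn f)).norm).pow 2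
  -- A general `f` is differentiated only at positive times, so the comparison starts at `ε` and
  -- continuity at zero closes the gap.
  have hle : ∀ ε, 0 < ε → ε ≤ t → g t ≤ g ε := by
    intro ε hε hεt
    refine image_le_of_liminf_slope_right_le_deriv_boundary (f := g) (B := fun _ => g ε)
      (B' := fun _ => 0) (hcont.mono fun x hx => hε.le.trans hx.1) le_rfl continuousOn_const
      (fun x _ => hasDerivWithinAt_const _ _ _) ?_ (right_mem_Icc.2 hεt)
    intro x hx r hr
    have hx0 : 0 < x := hε.trans_le hx.1
    obtain ⟨w, hw, -⟩ := hS.exists_generator hA hx0 f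
    have hd := hS.hasDerivAt hA hx0 hw
    -- By `dist_negPart_le`, `g z - g x` is at most `‖(P z f - P x f) - (P x f)⁻‖² - ‖(P x f)⁻‖²`.
    -- This differentiable majorant vanishes at `x` and bounds the right slope of `g`, whose own
    -- differentiability is not needed.
    have hk : HasDerivAt (fun z => -2 * inner ℝ (P z f - P x f) (Lp.negPart (P x f))
        + ‖P z f - P x f‖ ^ 2) (-2 * inner ℝ w (Lp.negPart (P x f))) x := by
      have h1 := hd.sub_const (P x f)
      have h2 := ((h1.inner ℝ (hasDerivAt_const x (Lp.negPart (P x f)))).const_mul (-2)).add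
        h1.norm_sq
      refine h2.congr_deriv ?_
      rw [sub_self, inner_zero_right, inner_zero_left]
      ring
    have hslope := (hasDerivAt_iff_tendsto_slope.1 hk).mono_left (nhdsGT_le_nhdsNE x)
    have hneg : -2 * inner ℝ w (Lp.negPart (P x f)) < r := by
      have := hP.inner_negPart_nonneg hx0 hw
      linarith
    refine Eventually.frequently ?_
    filter_upwards [hslope.eventually (gt_mem_nhds hneg), self_mem_nhdsWithin] with z hz hxz
    refine lt_of_le_of_lt ?_ hz
    rw [slope_def_field, slope_def_field]
    have hpos : 0 < z - x := sub_pos.2 hxz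
    refine div_le_div_of_nonneg_right ?_ hpos.le
    simp only [sub_self, inner_zero_left, norm_zero, hg]
    have h1 := dist_negPart_le (P x f) (P z f)
    have h2 : ‖Lp.negPart (P z f)‖ ^ 2 ≤ ‖(P z f - P x f) - Lp.negPart (P x f)‖ ^ 2 := by gcongr
    rw [@norm_sub_sq_real] at h2
    linarith
  have h0 : g 0 = 0 := by
    simp only [hg]
    rw [hS.apply_zero, (negPart_eq_zero_iff f).2 hf, norm_zero]; ring
  have hlim : Tendsto g (𝓝[>] 0) (𝓝 (g 0)) :=
    (hcont 0 self_mem_Ici).mono_left (nhdsWithin_mono _ Ioi_subset_Ici_self)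
  have hgt : g t ≤ 0 := by
    rw [← h0]
    refine ge_of_tendsto hlim ?_
    filter_upwards [Ioc_mem_nhdsGT ht] with ε hε using hle ε hε.1 hε.2
  rw [← negPart_eq_zero_iff, ← norm_eq_zero]
  exact pow_eq_zero_iff two_ne_zero |>.1 (le_antisymm hgt (sq_nonneg _))

theorem mono (hP : E.IsBoundingSemigroup P) {t : ℝ} (ht : 0 ≤ t) {f g : Lp ℝ 2 μ}
    (h : f ≤ᵐ[μ] g) : P t f ≤ᵐ[μ] P t g := by
  have h1 : 0 ≤ᵐ[μ] ((g - f : Lp ℝ 2 μ) : X → ℝ) := by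
    filter_upwards [h, Lp.coeFn_sub g f] with x h2 h3
    rw [h3]; exact sub_nonneg.2 h2
  have h2 := hP.nonneg ht h1
  rw [map_sub] at h2
  filter_upwards [h2, Lp.coeFn_sub (P t g) (P t f)] with x h3 h4
  rw [h4] at h3
  exact sub_nonneg.1 h3

variable {one : Lp ℝ 2 μ}

/-- The constant curve solves the Cauchy problem because `Δ1 = 0`. -/
theorem apply_one (hP : E.IsBoundingSemigroup P) (h1 : E.IsLaplacian one 0) {t : ℝ} (ht : 0 ≤ t) :
    P t one = one :=
  (hP.generated.eq_of_hasDerivAt hP.selfAdjoint (v := fun _ => one) (v' := fun _ => 0) ht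
    continuousOn_const (fun _ _ => hasDerivAt_const _ _) (fun _ _ => h1)).symm

theorem mem_Icc (hP : E.IsBoundingSemigroup P) (h1 : E.IsLaplacian one 0) (hone : ∀ᵐ x ∂μ, one x = 1)
    {t : ℝ} (ht : 0 ≤ t) {f : Lp ℝ 2 μ} {a b : ℝ} (hf : ∀ᵐ x ∂μ, f x ∈ Icc a b) :
    ∀ᵐ x ∂μ, P t f x ∈ Icc a b := by
  have hc : ∀ c : ℝ, ∀ᵐ x ∂μ, (c • one : Lp ℝ 2 μ) x = c := by
    intro c
    filter_upwards [Lp.coeFn_smul c one, hone] with x h2 h3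
    rw [h2, Pi.smul_apply, h3, smul_eq_mul, mul_one]
  have hPc : ∀ c : ℝ, P t (c • one) = c • one := fun c => by
    rw [map_smul, hP.apply_one h1 ht]
  have ha := hP.mono ht (f := a • one) (g := f) (by
    filter_upwards [hf, hc a] with x h2 h3
    rw [h3]; exact h2.1)
  have hb := hP.mono ht (f := f) (g := b • one) (by
    filter_upwards [hf, hc b] with x h2 h3
    rw [h3]; exact h2.2)
  rw [hPc] at ha hb
  filter_upwards [ha, hb, hc a, hc b] with x h2 h3 h4 h5
  rw [h4] at h2
  rw [h5] at h3
  exact ⟨h2, h3⟩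

/-- Jensen's inequality for the heat semigroup, for bounded functions. -/
theorem sq_apply_le (hP : E.IsBoundingSemigroup P) (h1 : E.IsLaplacian one 0)
    (hone : ∀ᵐ x ∂μ, one x = 1) {t : ℝ} (ht : 0 ≤ t) {g q : Lp ℝ 2 μ}
    (hq : ∀ᵐ x ∂μ, q x = g x ^ 2) : ∀ᵐ x ∂μ, P t g x ^ 2 ≤ P t q x := by
  -- Apply positivity to `(g - c)²`. Rational `c` keep the exceptional set null; density then allows
  -- `c = P t g x` pointwise.
  have key : ∀ c : ℚ, ∀ᵐ x ∂μ, 0 ≤ P t q x - 2 * (c : ℝ) * P t g x + (c : ℝ) ^ 2 := by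
    intro c
    have h2 : 0 ≤ᵐ[μ] ((q - (2 * (c : ℝ)) • g + ((c : ℝ) ^ 2) • one : Lp ℝ 2 μ) : X → ℝ) := by
      filter_upwards [Lp.coeFn_add (q - (2 * (c : ℝ)) • g) (((c : ℝ) ^ 2) • one),
        Lp.coeFn_sub q ((2 * (c : ℝ)) • g), Lp.coeFn_smul (2 * (c : ℝ)) g,
        Lp.coeFn_smul ((c : ℝ) ^ 2) one, hq, hone] with x e1 e2 e3 e4 e5 e6
      rw [e1, Pi.add_apply, e2, Pi.sub_apply, e3, e4, Pi.smul_apply, Pi.smul_apply, e5, e6]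
      simp only [smul_eq_mul, Pi.zero_apply]
      nlinarith [sq_nonneg (g x - c)]
    have h3 := hP.nonneg ht h2
    rw [map_add, map_sub, map_smul, map_smul, hP.apply_one h1 ht] at h3
    filter_upwards [h3, Lp.coeFn_add (P t q - (2 * (c : ℝ)) • P t g) (((c : ℝ) ^ 2) • one),
        Lp.coeFn_sub (P t q) ((2 * (c : ℝ)) • P t g), Lp.coeFn_smul (2 * (c : ℝ)) (P t g),
        Lp.coeFn_smul ((c : ℝ) ^ 2) one, hone] with x e0 e1 e2 e3 e4 e6
    rw [e1, Pi.add_apply, e2, Pi.sub_apply, e3, e4, Pi.smul_apply, Pi.smul_apply, e6] at e0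
    simpa only [smul_eq_mul, mul_one, Pi.zero_apply] using e0
  filter_upwards [ae_all_iff.2 key] with x hx
  have hcl : IsClosed {c : ℝ | 0 ≤ P t q x - 2 * c * P t g x + c ^ 2} :=
    isClosed_le continuous_const (by fun_prop)
  have h2 := Rat.denseRange_cast.induction_on
    (p := fun c : ℝ => 0 ≤ P t q x - 2 * c * P t g x + c ^ 2) (P t g x) hcl hx
  nlinarith

end IsBoundingSemigroup

-- Weighted Jensen inequality and consequences of the kernel.

section Weighted

variable {X : Type*} [MetricSpace X] [CompactSpace X] [MeasurableSpace X] [BorelSpace X]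
  {μ : Measure X} [IsProbabilityMeasure μ] {E : DirichletForm X μ}
  {P : ℝ → Lp ℝ 2 μ →L[ℝ] Lp ℝ 2 μ} {one : Lp ℝ 2 μ}

/-- Jensen's inequality, followed by moving `P t` onto the weight by symmetry. It is done for
continuous `g`, whose square lies in `L²`, and extended by density, both sides being continuous in
`g`. -/
theorem IsBoundingSemigroup.integral_mul_sq_le (hP : E.IsBoundingSemigroup P)
    (h1 : E.IsLaplacian one 0) (hone : ∀ᵐ x ∂μ, one x = 1) {t : ℝ} (ht : 0 ≤ t)
    {ψ : Lp ℝ 2 μ} (hψ : ∀ᵐ x ∂μ, ψ x ∈ Icc 0 1) (g : Lp ℝ 2 μ) :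
    ∫ x, ψ x * P t g x ^ 2 ∂μ ≤ ∫ x, P t ψ x * g x ^ 2 ∂μ := by
  have hb : ∀ φ : Lp ℝ 2 μ, (∀ᵐ x ∂μ, φ x ∈ Icc 0 1) → ∀ᵐ x ∂μ, |φ x| ≤ 1 := fun φ hφ => by
    filter_upwards [hφ] with x hx
    rw [abs_of_nonneg hx.1]; exact hx.2
  have hPψ := hP.mem_Icc h1 hone ht hψ
  have hc1 := (continuous_integral_bdd_mul_sq (Lp.aestronglyMeasurable ψ) (hb ψ hψ)).comp
    (P t).continuous
  have hc2 := continuous_integral_bdd_mul_sq (Lp.aestronglyMeasurable (P t ψ)) (hb _ hPψ)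
  refine (ContinuousMap.toLp_denseRange ℝ μ ℝ (p := 2) (by simp)).induction_on (p := fun g =>
    ∫ x, ψ x * P t g x ^ 2 ∂μ ≤ ∫ x, P t ψ x * g x ^ 2 ∂μ) g (isClosed_le hc1 hc2) fun f => ?_
  set g : Lp ℝ 2 μ := ContinuousMap.toLp 2 μ ℝ f with hg
  set q : Lp ℝ 2 μ := ContinuousMap.toLp 2 μ ℝ (f ^ 2) with hqd
  have hq : ∀ᵐ x ∂μ, q x = g x ^ 2 := by
    filter_upwards [ContinuousMap.coeFn_toLp (p := 2) (𝕜 := ℝ) μ f,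
      ContinuousMap.coeFn_toLp (p := 2) (𝕜 := ℝ) μ (f ^ 2)] with x e1 e2
    rw [hg, hqd, e1, e2]; rfl
  have hle := hP.sq_apply_le h1 hone ht hq
  calc ∫ x, ψ x * P t g x ^ 2 ∂μ ≤ ∫ x, ψ x * P t q x ∂μ := by
        refine integral_mono_ae ?_ ?_ ?_
        · exact (Lp.memLp (P t g)).integrable_sq.bdd_mul (c := 1) (Lp.aestronglyMeasurable ψ) (hb ψ hψ)
        · exact ((Lp.memLp (P t q)).integrable (by norm_num)).bdd_mul (c := 1)
            (Lp.aestronglyMeasurable ψ) (hb ψ hψ)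
        · filter_upwards [hle, hψ] with x e1 e2
          exact mul_le_mul_of_nonneg_left e1 e2.1
    _ = inner ℝ ψ (P t q) := (inner_eq_integral_mul _ _).symm
    _ = inner ℝ (P t ψ) q := (hP.generated.symm hP.selfAdjoint ht _ _).symm
    _ = ∫ x, P t ψ x * q x ∂μ := inner_eq_integral_mul _ _
    _ = ∫ x, P t ψ x * g x ^ 2 ∂μ := by
        refine integral_congr_ae ?_
        filter_upwards [hq] with x e1
        rw [e1]

omit [BorelSpace X] [IsProbabilityMeasure μ] in
theorem heatKernel_bounded {p : ℝ → X → X → ℝ} (hp : E.IsHeatKernel p) {t : ℝ} (ht : 0 < t) :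
    ∃ C, ∀ x y, |p t x y| ≤ C := by
  have hc : Continuous fun z : X × X => p t z.1 z.2 := by
    have h1 : Continuous fun z : X × X => (t, z.1, z.2) := by fun_prop
    have h2 := hp.continuousOn.comp_continuous h1 fun z => ⟨ht, mem_univ _⟩
    exact h2
  obtain ⟨C, hC⟩ := (isCompact_range hc).isBounded.exists_norm_le
  exact ⟨C, fun x y => hC _ ⟨(x, y), rfl⟩⟩

theorem isLaplacian_one (hreg : E.IsRegular) (hloc : E.IsStrictlyLocal) :
    E.IsLaplacian (E.cls ⟨_, one_mem_funDom hreg⟩ : Lp ℝ 2 μ) 0 := by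
  refine ⟨(E.cls ⟨_, one_mem_funDom hreg⟩).2, fun φ => ?_⟩
  have h := energy_one hreg hloc ⟨_, coeFn_mem_funDom φ⟩
  have e : E.cls ⟨_, coeFn_mem_funDom φ⟩ = φ := cls_eq_of_ae EventuallyEq.rfl
  rw [energy_apply, e, E.symm] at h
  rw [inner_zero_left, neg_zero]
  exact h

end Weighted

end DirichletForm

namespace CarreDuChamp

open DirichletForm

variable {X : Type*} [MetricSpace X] [CompactSpace X] [MeasurableSpace X] [BorelSpace X]
  {μ : Measure X} [IsProbabilityMeasure μ] {E : DirichletForm X μ} (Γ : CarreDuChamp E)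

-- At a fixed positive time the kernel is bounded by compactness, and on a probability space an `L²`
-- function is integrable; so `P_t f` is bounded.
include Γ in
theorem isBoundingSemigroup (hreg : E.IsRegular) (hloc : E.IsStrictlyLocal) {p : ℝ → X → X → ℝ}
    (hp : E.IsHeatKernel p) : E.IsBoundingSemigroup E.heatSemigroup := by
  have hA : IsNonposSelfAdjoint E.IsLaplacian := by
    rw [Γ.isLaplacian_eq hreg hloc]
    exact (Γ.isAdjointPair hreg hloc).isNonposSelfAdjoint
  refine ⟨hA, semigroupGeneratedBy_spec hA, fun t ht f => ?_⟩
  obtain ⟨C, hC⟩ := heatKernel_bounded hp ht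
  refine ⟨∫ y, C * ‖f y‖ ∂μ, ?_⟩
  filter_upwards [hp.kernel t ht f] with x hx
  rw [hx, ← Real.norm_eq_abs]
  refine norm_integral_le_of_norm_le
    (((Lp.memLp f).integrable (by norm_num)).norm.const_mul C) (Eventually.of_forall fun y => ?_)
  rw [norm_mul]
  exact mul_le_mul_of_nonneg_right (hC x y) (norm_nonneg _)

end CarreDuChamp

/-! ### The gradient bound -/

theorem lipschitzWith_clamp_sq : LipschitzWith 2 fun s : ℝ => (max 0 (min s 1)) ^ 2 := by
  refine LipschitzWith.of_dist_le_mul fun a b => ?_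
  rw [Real.dist_eq, Real.dist_eq, NNReal.coe_ofNat]
  have h1 : |max 0 (min a 1) - max 0 (min b 1)| ≤ |a - b| := by
    rw [max_comm 0, max_comm 0]
    refine (abs_max_sub_max_le_abs (min a 1) (min b 1) 0).trans ?_
    simpa using abs_min_sub_min_le_max a 1 b 1
  have h2 : ∀ c : ℝ, 0 ≤ max 0 (min c 1) ∧ max 0 (min c 1) ≤ 1 := fun c =>
    ⟨le_max_left _ _, max_le zero_le_one (min_le_right _ _)⟩
  have h3 := h2 a
  have h4 := h2 b
  generalize max 0 (min a 1) = c at *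
  generalize max 0 (min b 1) = d at *
  rw [sq_sub_sq, abs_mul, abs_of_nonneg (by linarith : 0 ≤ c + d)]
  exact mul_le_mul (by linarith) h1 (abs_nonneg _) zero_le_two

/-- Squaring need not map `L²` into itself, but the Lipschitz function `s ↦ (max 0 (min s 1))²` acts
continuously and agrees with it on values in `[0, 1]`. -/
theorem exists_continuous_sq {X : Type*} [MeasurableSpace X] (μ : Measure X) :
    ∃ T : Lp ℝ 2 μ → Lp ℝ 2 μ, Continuous T ∧
      ∀ u : Lp ℝ 2 μ, (∀ᵐ x ∂μ, u x ∈ Icc 0 1) → ∀ᵐ x ∂μ, T u x = u x ^ 2 := by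
  have h0 : (fun s : ℝ => (max 0 (min s 1)) ^ 2) 0 = 0 := by simp
  refine ⟨lipschitzWith_clamp_sq.compLp h0, lipschitzWith_clamp_sq.continuous_compLp h0,
    fun u hu => ?_⟩
  filter_upwards [hu, lipschitzWith_clamp_sq.coeFn_compLp h0 u] with x h1 h2
  rw [h2, Function.comp_apply, min_eq_left h1.2, max_eq_right h1.1]

/-- The derivative of `∫ h u²` along differentiable curves in `L²`. -/
theorem hasDerivAt_integral_mul_sq {X : Type*} [MeasurableSpace X] {μ : Measure X}
    {h u : ℝ → Lp ℝ 2 μ} {h' u' F q : Lp ℝ 2 μ} {r : ℝ} (hh : HasDerivAt h h' r)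
    (hu : HasDerivAt u u' r) (hb : ∀ᵐ x ∂μ, h r x ∈ Icc 0 1)
    (hu1 : ∀ᶠ z in 𝓝 r, ∀ᵐ x ∂μ, u z x ∈ Icc 0 1) (hF : ∀ᵐ x ∂μ, F x = h r x * u r x)
    (hq : ∀ᵐ x ∂μ, q x = u r x ^ 2) :
    HasDerivAt (fun z => ∫ x, h z x * u z x ^ 2 ∂μ) (inner ℝ h' q + 2 * inner ℝ F u') r := by
  obtain ⟨T, hT, hT'⟩ := exists_continuous_sq μ
  obtain ⟨L, hL⟩ := exists_bdd_mul (μ := μ) (h := h r) (Lp.aestronglyMeasurable _) (M := 1) (by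
    filter_upwards [hb] with x hx
    rw [abs_of_nonneg hx.1]; exact hx.2)
  have hTq : T (u r) = q := by
    refine Lp.ext ?_
    filter_upwards [hT' _ hu1.self_of_nhds, hq] with x h1 h2
    rw [h1, h2]
  have hLF : L (u r) = F := by
    refine Lp.ext ?_
    filter_upwards [hL (u r), hF] with x h1 h2
    rw [h1, h2]
  have hLsymm : ∀ a b, inner ℝ (L a) b = inner ℝ (L b) a := by
    intro a b
    rw [inner_eq_integral_mul, inner_eq_integral_mul]
    refine integral_congr_ae ?_
    filter_upwards [hL a, hL b] with x h1 h2
    rw [h1, h2]; ring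
  -- Write `h z = (h z - h r) + h r`. The first part vanishes at `r`, so only continuity of `z ↦ (u
  -- z)²` is needed; the second is the quadratic form of multiplication by `h r` (`d2`).
  have d1 : HasDerivAt (fun z => inner ℝ (h z - h r) (T (u z))) (inner ℝ h' q) r := by
    rw [hasDerivAt_iff_tendsto_slope]
    have h1 := hasDerivAt_iff_tendsto_slope.1 hh
    have h2 : Tendsto (fun z => T (u z)) (𝓝[≠] r) (𝓝 (T (u r))) :=
      ((hT.tendsto _).comp hu.continuousAt).mono_left nhdsWithin_le_nhds
    rw [hTq] at h2
    refine (h1.inner h2).congr fun z => ?_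
    rw [slope_def_module, slope_def_module, sub_self, inner_zero_left, sub_zero, inner_smul_left]
    rfl
  have d2 : HasDerivAt (fun z => inner ℝ (L (u z)) (u z)) (2 * inner ℝ F u') r := by
    have h1 : HasDerivAt (fun z => L (u z)) (L u') r := L.hasFDerivAt.comp_hasDerivAt r hu
    refine (h1.inner ℝ hu).congr_deriv ?_
    rw [hLsymm u' (u r), hLF]; ring
  refine (d1.add d2).congr_of_eventuallyEq ?_
  filter_upwards [hu1] with z hz
  have e1 : inner ℝ (L (u z)) (u z) = inner ℝ (h r) (T (u z)) := by
    rw [inner_eq_integral_mul, inner_eq_integral_mul]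
    refine integral_congr_ae ?_
    filter_upwards [hL (u z), hT' _ hz] with x h1 h2
    rw [h1, h2]; ring
  rw [Pi.add_apply, e1, ← inner_add_left, sub_add_cancel, inner_eq_integral_mul]
  refine integral_congr_ae ?_
  filter_upwards [hT' _ hz] with x h2
  rw [h2]

namespace CarreDuChamp

open DirichletForm

variable {X : Type*} [MetricSpace X] [CompactSpace X] [MeasurableSpace X] [BorelSpace X]
  {μ : Measure X} [IsProbabilityMeasure μ] {E : DirichletForm X μ} (Γ : CarreDuChamp E)

/-- This is `Δ(u²) - 2uΔu = 2Γ(u, u)`, tested against `h` with the Laplacian moved onto `h`. It is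
the carré du champ identity for the triple `u, u, h`. -/
theorem inner_laplacian_eq (hreg : E.IsRegular) (hloc : E.IsStrictlyLocal)
    {h k u w F q : Lp ℝ 2 μ} {ζ : Γ.OneForms} (hh : ∀ᵐ x ∂μ, h x ∈ Icc 0 1)
    (hu : ∀ᵐ x ∂μ, u x ∈ Icc 0 1) (hk : E.IsLaplacian h k) (hw : E.IsLaplacian u w)
    (hζ : (u, ζ) ∈ Γ.deriv.graph) (hF : ∀ᵐ x ∂μ, F x = h x * u x)
    (hq : ∀ᵐ x ∂μ, q x = u x ^ 2) :
    inner ℝ (-k) q + 2 * inner ℝ F w = -(2 * ∫ x, h x * Γ.fibreNorm ζ x ^ 2 ∂μ) := by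
  have hrep : ∀ v : E.dom, (∀ᵐ x ∂μ, (v : Lp ℝ 2 μ) x ∈ Icc 0 1) →
      ∃ F : E.funDom, E.cls F = v ∧ ∀ x, F.1 x ∈ Icc 0 1 := fun v hv =>
    exists_bounded_rep v zero_le_one (hv.mono fun _ => And.left) (hv.mono fun _ => And.right)
  have hab : ∀ F : E.funDom, (∀ x, F.1 x ∈ Icc 0 1) → ∀ x, |F.1 x| ≤ 1 := fun F hF x => by
    rw [abs_of_nonneg (hF x).1]; exact (hF x).2
  obtain ⟨H, hH, hH1⟩ := hrep ⟨h, hk.1⟩ hh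
  obtain ⟨U, hU, hU1⟩ := hrep ⟨u, hw.1⟩ hu
  have hH2 : h =ᵐ[μ] H.1 := by
    have := coeFn_cls H
    rwa [hH] at this
  have hU2 : u =ᵐ[μ] U.1 := by
    have := coeFn_cls U
    rwa [hU] at this
  let UU : E.funDom := ⟨_, mul_mem_funDom U U (hab U hU1) (hab U hU1)⟩
  let UH : E.funDom := ⟨_, mul_mem_funDom U H (hab U hU1) (hab H hH1)⟩
  have e1 : (E.cls UU : Lp ℝ 2 μ) = q := by
    refine Lp.ext ?_
    filter_upwards [coeFn_cls UU, hq, hU2] with x h1 h2 h3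
    rw [h1, h2, h3]
    exact (sq _).symm
  have e2 : (E.cls UH : Lp ℝ 2 μ) = F := by
    refine Lp.ext ?_
    filter_upwards [coeFn_cls UH, hF, hU2, hH2] with x h1 h2 h3 h4
    rw [h1, h2, h3, h4]
    exact mul_comm _ _
  have h1 := Γ.energy_identity (hab U hU1) (hab U hU1) (hab H hH1) UU UH UH (fun _ => rfl)
    (fun _ => rfl) (fun _ => rfl)
  rw [energy_symm UH U, energy_apply, energy_apply, hH, hU,
    form_eq_of_isLaplacian (u := ⟨h, hk.1⟩) hk, form_eq_of_isLaplacian (u := ⟨u, hw.1⟩) hw,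
    e1, e2] at h1
  have h2 := Γ.integral_bdd_mul_fibreNorm_sq hreg hloc (h := h) (Lp.aestronglyMeasurable h) (M := 1)
    (by filter_upwards [hh] with x hx
        rw [abs_of_nonneg hx.1]; exact hx.2) (hh.mono fun _ => And.left)
    (u := ⟨u, hw.1⟩) hζ
  have h3 : ∫ x, H.1 x * Γ.toFun ⟨u, hw.1⟩ ⟨u, hw.1⟩ x ∂μ
      = ∫ x, h x * Γ.toFun ⟨u, hw.1⟩ ⟨u, hw.1⟩ x ∂μ := by
    refine integral_congr_ae ?_
    filter_upwards [hH2] with x hx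
    rw [hx]
  rw [h2, ← h3, inner_neg_left, real_inner_comm w F, ← h1]
  ring

variable {p : ℝ → X → X → ℝ}

theorem formSemigroup_spec (hreg : E.IsRegular) (hloc : E.IsStrictlyLocal) :
    IsSemigroupGeneratedBy Γ.formSemigroup (negComp Γ.coderiv.graph Γ.deriv.graph) := by
  have := semigroupGeneratedBy_spec (Γ.isAdjointPair hreg hloc).swap.isNonposSelfAdjoint
  rwa [← Γ.isFormLaplacian_eq] at this ⊢

/-- Intertwining gives `∂P_s f` as the form semigroup at time `s - r` applied to `∂P_r f`.
Domination bounds its fibre norm by `C₁ P_{s-r} ‖∂P_r f‖`, and the weighted Jensen inequality moves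
the semigroup onto `ψ`. -/
theorem integral_mul_fibreNorm_sq_le (hreg : E.IsRegular) (hloc : E.IsStrictlyLocal)
    (hp : E.IsHeatKernel p) {C₁ : ℝ} (hdom : Γ.SemigroupDomination C₁)
    {s r : ℝ} (hr : 0 < r) (hrs : r ≤ s) (hs1 : s ≤ 1) {f : Lp ℝ 2 μ} {ζ ξ : Γ.OneForms}
    (hζ : (E.heatSemigroup s f, ζ) ∈ Γ.deriv.graph) (hξ : (E.heatSemigroup r f, ξ) ∈ Γ.deriv.graph)
    {ψ : Lp ℝ 2 μ} (hψ : ∀ᵐ x ∂μ, ψ x ∈ Icc 0 1) :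
    ∫ x, ψ x * Γ.fibreNorm ζ x ^ 2 ∂μ
      ≤ C₁ ^ 2 * ∫ x, E.heatSemigroup (s - r) ψ x * Γ.fibreNorm ξ x ^ 2 ∂μ := by
  have hP := Γ.isBoundingSemigroup hreg hloc hp
  have hpair := Γ.isAdjointPair hreg hloc
  have hsr : 0 ≤ s - r := sub_nonneg.2 hrs
  have hone := coeFn_cls (E := E) ⟨_, one_mem_funDom hreg⟩
  have hgen := hP.generated
  rw [Γ.isLaplacian_eq hreg hloc] at hgen
  have h1 := hpair.intertwine hgen (Γ.formSemigroup_spec hreg hloc) hr hsr f hξ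
  rw [add_sub_cancel] at h1
  have e : ζ = Γ.formSemigroup (s - r) ξ := hpair.unique hζ h1
  have hd := hdom ξ (s - r) hsr (by linarith)
  rw [← e] at hd
  have hb : ∀ᵐ x ∂μ, ‖ψ x‖ ≤ 1 := by
    filter_upwards [hψ] with x hx
    rw [Real.norm_of_nonneg hx.1]; exact hx.2
  calc ∫ x, ψ x * Γ.fibreNorm ζ x ^ 2 ∂μ
      ≤ ∫ x, C₁ ^ 2 * (ψ x * E.heatSemigroup (s - r) (Γ.fibreNorm ξ) x ^ 2) ∂μ := by
        refine integral_mono_ae ?_ ?_ ?_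
        · exact (Lp.memLp (Γ.fibreNorm ζ)).integrable_sq.bdd_mul (Lp.aestronglyMeasurable ψ) hb
        · exact ((Lp.memLp _).integrable_sq.bdd_mul (Lp.aestronglyMeasurable ψ) hb).const_mul _
        · filter_upwards [hd, hψ, Γ.fibreNorm_nonneg ζ] with x h2 h3 h4
          have h5 : Γ.fibreNorm ζ x ^ 2
              ≤ (C₁ * E.heatSemigroup (s - r) (Γ.fibreNorm ξ) x) ^ 2 :=
            pow_le_pow_left₀ h4 h2 2
          rw [mul_left_comm, ← mul_pow]
          exact mul_le_mul_of_nonneg_left h5 h3.1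
    _ = C₁ ^ 2 * ∫ x, ψ x * E.heatSemigroup (s - r) (Γ.fibreNorm ξ) x ^ 2 ∂μ :=
        integral_const_mul _ _
    _ ≤ _ := by
        refine mul_le_mul_of_nonneg_left ?_ (sq_nonneg _)
        exact hP.integral_mul_sq_le (isLaplacian_one hreg hloc) hone hsr hψ _

/-- The weighted reverse Poincaré inequality. -/
theorem mul_integral_fibreNorm_sq_le (hreg : E.IsRegular) (hloc : E.IsStrictlyLocal)
    (hp : E.IsHeatKernel p) {C₁ : ℝ} (hC₁ : 1 ≤ C₁) (hdom : Γ.SemigroupDomination C₁)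
    {s : ℝ} (hs0 : 0 < s) (hs1 : s ≤ 1) {f : Lp ℝ 2 μ} (hf : ∀ᵐ x ∂μ, f x ∈ Icc 0 1)
    {ζ : Γ.OneForms} (hζ : (E.heatSemigroup s f, ζ) ∈ Γ.deriv.graph)
    {ψ : Lp ℝ 2 μ} (hψ : ∀ᵐ x ∂μ, ψ x ∈ Icc 0 1) :
    s * ∫ x, ψ x * Γ.fibreNorm ζ x ^ 2 ∂μ ≤ C₁ ^ 2 * ∫ x, ψ x ∂μ := by
  set P := E.heatSemigroup with hPdef
  have hP : E.IsBoundingSemigroup P := Γ.isBoundingSemigroup hreg hloc hp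
  have hgen := hP.generated
  have hA := hP.selfAdjoint
  have hL1 := isLaplacian_one hreg hloc
  have hone := coeFn_cls (E := E) ⟨_, one_mem_funDom hreg⟩
  set one : Lp ℝ 2 μ := (E.cls ⟨_, one_mem_funDom hreg⟩ : Lp ℝ 2 μ) with hone_def
  choose! w hw _ using fun r (hr : 0 < r) => hgen.exists_generator hA hr f
  choose! k hk _ using fun r (hr : 0 < r) => hgen.exists_generator hA hr ψ
  have hξ : ∀ r, 0 < r → ∃ ξ, (P r f, ξ) ∈ Γ.deriv.graph := fun r hr =>
    (Γ.mem_graph_deriv_iff hreg hloc).2 (hw r hr).1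
  choose! ξ hξ using hξ
  obtain ⟨T, -, hT⟩ := exists_continuous_sq μ
  have hu01 : ∀ r, 0 ≤ r → ∀ᵐ x ∂μ, P r f x ∈ Icc 0 1 := fun r hr => hP.mem_Icc hL1 hone hr hf
  have hh01 : ∀ r, 0 ≤ r → ∀ᵐ x ∂μ, P r ψ x ∈ Icc 0 1 := fun r hr => hP.mem_Icc hL1 hone hr hψ
  set G : ℝ → ℝ := fun r => ∫ x, P (s - r) ψ x * P r f x ^ 2 ∂μ with hG
  have hder : ∀ r, 0 < r → r < s → HasDerivAt G
      (-(2 * ∫ x, P (s - r) ψ x * Γ.fibreNorm (ξ r) x ^ 2 ∂μ)) r := by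
    intro r hr hrs
    have hsr : 0 < s - r := sub_pos.2 hrs
    obtain ⟨L, hL⟩ := exists_bdd_mul (μ := μ) (h := P (s - r) ψ) (Lp.aestronglyMeasurable _)
      (M := 1) (by
        filter_upwards [hh01 _ hsr.le] with x hx
        rw [abs_of_nonneg hx.1]; exact hx.2)
    rw [← Γ.inner_laplacian_eq hreg hloc (hh01 _ hsr.le) (hu01 _ hr.le) (hk _ hsr) (hw _ hr)
      (hξ r hr) (hL (P r f)) (hT _ (hu01 r hr.le))]
    refine hasDerivAt_integral_mul_sq (h := fun r => P (s - r) ψ) (u := fun r => P r f) ?_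
      (hgen.hasDerivAt hA hr (hw r hr)) (hh01 _ hsr.le) ?_ (hL (P r f)) (hT _ (hu01 r hr.le))
    · have := (hgen.hasDerivAt hA hsr (hk _ hsr)).scomp r ((hasDerivAt_id r).const_sub s)
      simpa [Function.comp_def] using this
    · filter_upwards [lt_mem_nhds hr] with z hz using hu01 z hz.le
  -- The mean value theorem on `[s/4, 3s/4]` stays away from the times `0` and `s`. The length `s/2`
  -- cancels the factor `2` of the derivative, leaving exactly `s`.
  have ha : 0 < s / 4 := by positivity
  have hab : s / 4 < 3 * s / 4 := by linarith
  obtain ⟨c, hc, e⟩ := exists_hasDerivAt_eq_slope G _ hab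
    (fun r hr => (hder r (by linarith [hr.1]) (by linarith [hr.2])).continuousAt.continuousWithinAt)
    (fun r hr => hder r (by linarith [hr.1]) (by linarith [hr.2]))
  have hc0 : 0 < c := ha.trans hc.1
  have hcs : c ≤ s := by linarith [hc.2]
  have hle := Γ.integral_mul_fibreNorm_sq_le hreg hloc hp hdom hc0 hcs hs1 hζ (hξ c hc0) hψ
  have hGb : 0 ≤ G (3 * s / 4) := by
    refine integral_nonneg_of_ae ?_
    filter_upwards [hh01 (s - 3 * s / 4) (by linarith)] with x hx
    exact mul_nonneg hx.1 (sq_nonneg _)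
  -- Drop `(P (s/4) f)² ≤ 1`; the heat semigroup preserves the integral of `ψ`.
  have hGa : G (s / 4) ≤ ∫ x, ψ x ∂μ := by
    have hsa : 0 ≤ s - s / 4 := by linarith
    have e1 : ∫ x, P (s - s / 4) ψ x ∂μ = ∫ x, ψ x ∂μ := by
      have h1 : ∀ v : Lp ℝ 2 μ, ∫ x, v x ∂μ = inner ℝ v one := by
        intro v
        rw [inner_eq_integral_mul]
        refine integral_congr_ae ?_
        filter_upwards [hone] with x hx
        rw [hx, mul_one]
      rw [h1, h1, hgen.symm hA hsa, hP.apply_one hL1 hsa]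
    rw [← e1]
    have hI : Integrable (P (s - s / 4) ψ : X → ℝ) μ :=
      (Lp.memLp _).integrable (by norm_num)
    refine integral_mono_ae ?_ hI ?_
    · refine hI.mul_bdd (c := 1) ((Lp.aestronglyMeasurable _).pow 2) ?_
      filter_upwards [hu01 (s / 4) ha.le] with x hx
      rw [Real.norm_of_nonneg (sq_nonneg _)]
      exact pow_le_one₀ hx.1 hx.2
    · filter_upwards [hh01 (s - s / 4) hsa, hu01 (s / 4) ha.le] with x h1 h2
      exact mul_le_of_le_one_right h1.1 (pow_le_one₀ h2.1 h2.2)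
  rw [eq_div_iff (by linarith : 3 * s / 4 - s / 4 ≠ 0)] at e
  have hK : s * ∫ x, P (s - c) ψ x * Γ.fibreNorm (ξ c) x ^ 2 ∂μ ≤ ∫ x, ψ x ∂μ := by
    nlinarith
  calc s * ∫ x, ψ x * Γ.fibreNorm ζ x ^ 2 ∂μ
      ≤ s * (C₁ ^ 2 * ∫ x, P (s - c) ψ x * Γ.fibreNorm (ξ c) x ^ 2 ∂μ) := by gcongr
    _ = C₁ ^ 2 * (s * ∫ x, P (s - c) ψ x * Γ.fibreNorm (ξ c) x ^ 2 ∂μ) := by ring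
    _ ≤ _ := by gcongr

/-- The gradient bound `‖∂ P_s f‖ ≤ C₁ / √s` for `0 ≤ f ≤ 1`. -/
theorem fibreNorm_deriv_le (hreg : E.IsRegular) (hloc : E.IsStrictlyLocal)
    (hp : E.IsHeatKernel p) {C₁ : ℝ} (hC₁ : 1 ≤ C₁) (hdom : Γ.SemigroupDomination C₁)
    {s : ℝ} (hs0 : 0 < s) (hs1 : s ≤ 1) {f : Lp ℝ 2 μ} (hf : ∀ᵐ x ∂μ, f x ∈ Icc 0 1)
    {ζ : Γ.OneForms} (hζ : (E.heatSemigroup s f, ζ) ∈ Γ.deriv.graph) :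
    ∀ᵐ x ∂μ, Γ.fibreNorm ζ x ≤ C₁ / √s := by
  have hsq : Integrable (fun x => Γ.fibreNorm ζ x ^ 2) μ := (Lp.memLp _).integrable_sq
  -- Taking `ψ = 1_B` for every measurable `B` turns the weighted inequality into a pointwise one.
  have key := ae_le_of_forall_setIntegral_le (f := fun x => s * Γ.fibreNorm ζ x ^ 2)
    (g := fun _ => C₁ ^ 2) (hsq.const_mul s) (integrable_const _) (fun B hB _ => by
      have hψm : MemLp (B.indicator fun _ => (1 : ℝ)) 2 μ := memLp_indicator_const 2 hB 1 (by simp)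
      have hψ : ∀ᵐ x ∂μ, hψm.toLp _ x = B.indicator (fun _ => (1 : ℝ)) x := hψm.coeFn_toLp
      have h1 := Γ.mul_integral_fibreNorm_sq_le hreg hloc hp hC₁ hdom hs0 hs1 hf hζ
        (ψ := hψm.toLp _) (by
          filter_upwards [hψ] with x hx
          rw [hx]
          by_cases hxB : x ∈ B <;> simp [hxB])
      have e1 : ∫ x, hψm.toLp _ x * Γ.fibreNorm ζ x ^ 2 ∂μ = ∫ x in B, Γ.fibreNorm ζ x ^ 2 ∂μ := by
        rw [← integral_indicator hB]
        refine integral_congr_ae ?_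
        filter_upwards [hψ] with x hx
        rw [hx]
        by_cases hxB : x ∈ B <;> simp [hxB]
      have e2 : ∫ x, hψm.toLp _ x ∂μ = ∫ x in B, (1 : ℝ) ∂μ := by
        rw [← integral_indicator hB]
        exact integral_congr_ae hψ
      rw [e1, e2] at h1
      rw [integral_const_mul]
      refine h1.trans_eq ?_
      simp [mul_comm])
  filter_upwards [key] with x hx
  rw [le_div_iff₀ (Real.sqrt_pos.2 hs0)]
  refine (le_abs_self _).trans (abs_le_of_sq_le_sq ?_ (by linarith))
  rw [mul_pow, Real.sq_sqrt hs0.le]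
  linarith

end CarreDuChamp

/-! ### The isoperimetric inequality -/

/-- The class in `L²` of the indicator function of a set of finite measure. -/
noncomputable def indicatorL2 {X : Type*} [MeasurableSpace X] (μ : Measure X) [IsFiniteMeasure μ]
    {A : Set X} (hA : MeasurableSet A) : Lp ℝ 2 μ :=
  (memLp_indicator_const 2 hA (1 : ℝ) (Or.inr (measure_ne_top μ A))).toLp _

theorem coeFn_indicatorL2 {X : Type*} [MeasurableSpace X] (μ : Measure X) [IsFiniteMeasure μ]
    {A : Set X} (hA : MeasurableSet A) :
    indicatorL2 μ hA =ᵐ[μ] A.indicator fun _ => (1 : ℝ) :=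
  MemLp.coeFn_toLp _

theorem inner_indicatorL2 {X : Type*} [MeasurableSpace X] (μ : Measure X) [IsFiniteMeasure μ]
    {A : Set X} (hA : MeasurableSet A) (w : Lp ℝ 2 μ) :
    inner ℝ (indicatorL2 μ hA) w = ∫ x, A.indicator (fun _ => (1 : ℝ)) x * w x ∂μ := by
  rw [inner_eq_integral_mul]
  refine integral_congr_ae ?_
  filter_upwards [coeFn_indicatorL2 μ hA] with x hx
  rw [hx]

namespace CarreDuChamp

variable {X : Type*} [MetricSpace X] [CompactSpace X] [MeasurableSpace X] [BorelSpace X]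
  {μ : Measure X} [IsProbabilityMeasure μ] {E : DirichletForm X μ} (Γ : CarreDuChamp E)
  {p : ℝ → X → X → ℝ}

theorem IsCaccioppoli.measurableSet {Γ : CarreDuChamp E} {A : Set X} (hA : Γ.IsCaccioppoli A) :
    MeasurableSet A :=
  hA.1

theorem IsCaccioppoli.perimeter_ne_top {Γ : CarreDuChamp E} {A : Set X}
    (hA : Γ.IsCaccioppoli A) : Γ.perimeter A ≠ ∞ :=
  hA.2.2.ne

/-- By the gradient bound, `(√s / C₁) ∂P_s f` has fibre norm at most `1`, so it competes in the
supremum defining the perimeter; its codifferential is `-(√s / C₁) ΔP_s f`. -/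
theorem neg_le_inner_indicator_laplacian (hreg : E.IsRegular) (hloc : E.IsStrictlyLocal)
    (hp : E.IsHeatKernel p) {C₁ : ℝ} (hC₁ : 1 ≤ C₁) (hdom : Γ.SemigroupDomination C₁)
    {A : Set X} (hA : Γ.IsCaccioppoli A) {s : ℝ} (hs0 : 0 < s) (hs1 : s ≤ 1) {f w : Lp ℝ 2 μ}
    (hf : ∀ᵐ x ∂μ, f x ∈ Icc 0 1) (hw : E.IsLaplacian (E.heatSemigroup s f) w) :
    -(C₁ * (Γ.perimeter A).toReal / √s) ≤ inner ℝ (indicatorL2 μ hA.measurableSet) w := by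
  rw [Γ.isLaplacian_eq hreg hloc] at hw
  obtain ⟨ζ, h1, h2⟩ := hw
  have hb := Γ.fibreNorm_deriv_le hreg hloc hp hC₁ hdom hs0 hs1 hf h1
  have hq : 0 < √s := Real.sqrt_pos.2 hs0
  have hc : 0 ≤ √s / C₁ := by positivity
  have h3 := Γ.coderiv.graph.smul_mem (√s / C₁) h2
  obtain ⟨η, hη, hη'⟩ := (LinearPMap.mem_graph_iff _).1 h3
  simp only [Prod.smul_mk] at hη hη'
  have hn : ∀ᵐ x ∂μ, Γ.fibreNorm η x ≤ 1 := by
    rw [hη, Γ.fibreNorm_smul hc]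
    filter_upwards [hb, Lp.coeFn_smul (√s / C₁) (Γ.fibreNorm ζ)] with x h4 h5
    rw [h5, Pi.smul_apply, smul_eq_mul]
    calc √s / C₁ * Γ.fibreNorm ζ x ≤ √s / C₁ * (C₁ / √s) := by gcongr
      _ = 1 := by field_simp
  have h6 : ENNReal.ofReal (∫ x, A.indicator (fun _ => (1 : ℝ)) x * Γ.coderiv η x ∂μ)
      ≤ Γ.perimeter A :=
    le_iSup₂ (f := fun (η : Γ.coderiv.domain) (_ : ∀ᵐ x ∂μ, Γ.fibreNorm η x ≤ 1) =>
      ENNReal.ofReal (∫ x, A.indicator (fun _ => (1 : ℝ)) x * Γ.coderiv η x ∂μ)) η hn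
  rw [← inner_indicatorL2 μ hA.measurableSet, hη', smul_neg, inner_neg_right, inner_smul_right,
    ENNReal.ofReal_le_iff_le_toReal hA.perimeter_ne_top] at h6
  have h7 : C₁ * (Γ.perimeter A).toReal / √s = (C₁ / √s) * (Γ.perimeter A).toReal := by ring
  have h8 : inner ℝ (indicatorL2 μ hA.measurableSet) w
      = (C₁ / √s) * (√s / C₁ * inner ℝ (indicatorL2 μ hA.measurableSet) w) := by field_simp
  have h9 := mul_le_mul_of_nonneg_left h6 (show 0 ≤ C₁ / √s by positivity)
  rw [h7, h8]
  linarith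

/-- The heat content of a Caccioppoli set. -/
theorem measureReal_sub_inner_heatSemigroup_le (hreg : E.IsRegular) (hloc : E.IsStrictlyLocal)
    (hp : E.IsHeatKernel p) {C₁ : ℝ} (hC₁ : 1 ≤ C₁) (hdom : Γ.SemigroupDomination C₁)
    {A : Set X} (hA : Γ.IsCaccioppoli A) {t : ℝ} (ht0 : 0 ≤ t) (ht1 : t ≤ 1) :
    μ.real A - inner ℝ (indicatorL2 μ hA.measurableSet) (E.heatSemigroup t (indicatorL2 μ hA.measurableSet))
      ≤ 2 * C₁ * (Γ.perimeter A).toReal * √t := by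
  have hP := Γ.isBoundingSemigroup hreg hloc hp
  have hgen := hP.generated
  set f := indicatorL2 μ hA.measurableSet with hf
  have hf01 : ∀ᵐ x ∂μ, f x ∈ Icc (0 : ℝ) 1 := by
    filter_upwards [coeFn_indicatorL2 μ hA.measurableSet] with x hx
    rw [hx]
    by_cases hxA : x ∈ A <;> simp [hxA]
  set V := (Γ.perimeter A).toReal
  -- The added term is the primitive of `C₁ V / √s`, so `F` is nondecreasing on `(0, t)`; strong
  -- continuity includes the endpoint `0`.
  set F : ℝ → ℝ := fun s => inner ℝ f (E.heatSemigroup s f) + 2 * C₁ * V * √s with hF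
  choose! w hw _ using fun s (hs : 0 < s) => hgen.exists_generator hP.selfAdjoint hs f
  have hd : ∀ s, 0 < s → HasDerivAt F (inner ℝ f (w s) + 2 * C₁ * V * (1 / (2 * √s))) s := by
    intro s hs
    exact ((innerSL ℝ f).hasFDerivAt.comp_hasDerivAt s
      (hgen.hasDerivAt hP.selfAdjoint hs (hw s hs))).add
      ((Real.hasDerivAt_sqrt hs.ne').const_mul _)
  have hmono : MonotoneOn F (Icc 0 t) := by
    refine monotoneOn_of_deriv_nonneg (convex_Icc 0 t) ?_ ?_ ?_
    · refine ((innerSL ℝ f).continuous.comp_continuousOn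
        ((hgen.continuousOn f).mono Icc_subset_Ici_self)).add ?_
      exact (continuous_const.mul Real.continuous_sqrt).continuousOn
    · rw [interior_Icc]
      exact fun s hs => (hd s hs.1).differentiableAt.differentiableWithinAt
    · rw [interior_Icc]
      intro s hs
      rw [(hd s hs.1).deriv]
      have h1 := Γ.neg_le_inner_indicator_laplacian hreg hloc hp hC₁ hdom hA hs.1
        (hs.2.le.trans ht1) hf01 (hw s hs.1)
      have h2 : 2 * C₁ * V * (1 / (2 * √s)) = C₁ * V / √s := by ring
      rw [h2]
      linarith
  have h := hmono (left_mem_Icc.2 ht0) (right_mem_Icc.2 ht0) ht0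
  have h0 : inner ℝ f f = μ.real A := by
    rw [hf, inner_indicatorL2, ← integral_indicator_one hA.measurableSet]
    refine integral_congr_ae ?_
    filter_upwards [coeFn_indicatorL2 μ hA.measurableSet] with x hx
    rw [hx]
    by_cases hxA : x ∈ A <;> simp [hxA]
  simp only [hF, hgen.apply_zero, Real.sqrt_zero, mul_zero, add_zero, h0] at h
  linarith

end CarreDuChamp

/-- The left side is the integral of the kernel over `A × A`. -/
theorem DirichletForm.IsHeatKernel.inner_indicator_le {X : Type*} [MetricSpace X] [CompactSpace X]
    [MeasurableSpace X] [BorelSpace X] {μ : Measure X} [IsProbabilityMeasure μ]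
    {E : DirichletForm X μ} {p : ℝ → X → X → ℝ} (hp : E.IsHeatKernel p)
    {A : Set X} (hA : MeasurableSet A) {t K : ℝ} (ht : 0 < t) (hK : ∀ x y, p t x y ≤ K) :
    inner ℝ (indicatorL2 μ hA) (E.heatSemigroup t (indicatorL2 μ hA)) ≤ K * μ.real A ^ 2 := by
  have hcont : ∀ x, Continuous (p t x) := fun x =>
    hp.continuousOn.comp_continuous (f := fun y => (t, x, y)) (by fun_prop)
      fun y => ⟨ht, mem_univ _⟩
  have hint : ∀ (g : X → ℝ), ∫ y, A.indicator (fun _ => (1 : ℝ)) y * g y ∂μ = ∫ y in A, g y ∂μ := by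
    intro g
    rw [← integral_indicator hA]
    congr 1
    ext y
    by_cases hy : y ∈ A <;> simp [hy]
  have h1 : ∀ᵐ x ∂μ, E.heatSemigroup t (indicatorL2 μ hA) x ≤ K * μ.real A := by
    filter_upwards [hp.kernel t ht (indicatorL2 μ hA)] with x hx
    have e : ∫ y, p t x y * indicatorL2 μ hA y ∂μ = ∫ y in A, p t x y ∂μ := by
      rw [← hint]
      refine integral_congr_ae ?_
      filter_upwards [coeFn_indicatorL2 μ hA] with y hy
      rw [hy, mul_comm]
    rw [hx, e]
    have hi : IntegrableOn (p t x) A μ :=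
      ((hcont x).integrable_of_hasCompactSupport (HasCompactSupport.of_compactSpace _)).integrableOn
    calc ∫ y in A, p t x y ∂μ ≤ ∫ _ in A, K ∂μ :=
          integral_mono hi (integrable_const K) (hK x)
      _ = K * μ.real A := by simp [mul_comm]
  rw [inner_indicatorL2, hint]
  calc ∫ x in A, E.heatSemigroup t (indicatorL2 μ hA) x ∂μ ≤ ∫ _ in A, K * μ.real A ∂μ :=
        integral_mono_ae ((Lp.memLp _).integrable (by norm_num)).integrableOn
          (integrable_const _) (ae_restrict_of_ae h1)
    _ = K * μ.real A ^ 2 := by simp; ring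

/-- Optimizing the heat content at the time `t = (2Mm)^(2/Q)`. -/
theorem rpow_le_of_heatContent {Q M C V m : ℝ} (hQ : 1 < Q) (hM : 0 < M) (hm : 0 ≤ m)
    (hmM : m ≤ 1 / (2 * M)) (hCV : 0 ≤ C * V)
    (h : ∀ t, 0 < t → t ≤ 1 → m ≤ M * t ^ (-(Q / 2)) * m ^ 2 + C * V * √t) :
    m ^ ((Q - 1) / Q) ≤ 2 * C * (2 * M) ^ (1 / Q) * V := by
  have hQ0 : 0 < Q := by linarith
  rcases hm.eq_or_lt with rfl | hm
  · rw [Real.zero_rpow (div_pos (by linarith) hQ0).ne']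
    have : 0 ≤ C * V * (2 * (2 * M) ^ (1 / Q)) := by positivity
    linarith
  set a := 2 * M * m with ha
  have ha0 : 0 < a := by positivity
  -- The smallness condition on `m` is exactly what keeps the time `a ^ (2 / Q)` in `(0, 1]`.
  have ha1 : a ≤ 1 := by
    rw [le_div_iff₀ (by positivity)] at hmM
    linarith
  have h1 := h (a ^ (2 / Q)) (by positivity) (Real.rpow_le_one ha0.le ha1 (by positivity))
  have e1 : (a ^ (2 / Q)) ^ (-(Q / 2)) = a⁻¹ := by
    rw [← Real.rpow_mul ha0.le, ← Real.rpow_neg_one]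
    congr 1
    field_simp
  have e2 : √(a ^ (2 / Q)) = a ^ (1 / Q) := by
    rw [Real.sqrt_eq_rpow, ← Real.rpow_mul ha0.le]
    congr 1
    field_simp
  -- The time is chosen so that the kernel term is half of `m` and moves to the left side.
  have e3 : M * a⁻¹ * m ^ 2 = m / 2 := by
    rw [ha]; field_simp
  rw [e1, e2, e3, ha, Real.mul_rpow (by positivity) hm.le] at h1
  have e4 : m = m ^ ((Q - 1) / Q) * m ^ (1 / Q) := by
    rw [← Real.rpow_add hm, ← add_div, sub_add_cancel, div_self hQ0.ne', Real.rpow_one]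
  have h2 : m ^ ((Q - 1) / Q) * m ^ (1 / Q) ≤ (2 * C * (2 * M) ^ (1 / Q) * V) * m ^ (1 / Q) := by
    rw [← e4]
    linarith
  exact le_of_mul_le_mul_right h2 (by positivity)

theorem theoremT {X : Type*} [MetricSpace X] [CompactSpace X] [MeasurableSpace X] [BorelSpace X]
    (μ : Measure X) [IsProbabilityMeasure μ] [μ.IsOpenPosMeasure]
    (E : DirichletForm X μ) (hreg : E.IsRegular) (hloc : E.IsStrictlyLocal)
    (Γ : CarreDuChamp E)
    (C₁ : ℝ) (hC₁ : 1 ≤ C₁) (hdom : Γ.SemigroupDomination C₁)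
    (p : ℝ → X → X → ℝ) (hp : E.IsHeatKernel p)
    (hpos : ∃ t > 0, ∃ c > 0, ∀ x y, c ≤ p t x y)
    (Q : ℝ) (hQ : 1 < Q)
    (hbound : ∃ M : ℝ, ∀ t ∈ Set.Ioc (0 : ℝ) 1, ∀ x y, t ^ (Q / 2) * p t x y ≤ M) :
    ∃ Ciso > (0 : ℝ), ∃ μmax > (0 : ℝ), ∀ A : Set X, Γ.IsCaccioppoli A →
      μ A ≤ ENNReal.ofReal μmax →
      (μ A) ^ ((Q - 1) / Q) ≤ ENNReal.ofReal Ciso * Γ.perimeter A := by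
  obtain ⟨M, hM⟩ := hbound
  -- The given bound `M` is replaced by a positive one, as `1 / (2 * N)` serves as the measure
  -- threshold.
  set N := max M 1
  have hN : 0 < N := lt_max_of_lt_right one_pos
  have hC : 0 < 2 * (2 * C₁) * (2 * N) ^ (1 / Q) := by positivity
  refine ⟨_, hC, 1 / (2 * N), by positivity, fun A hA hμA => ?_⟩
  have hm : μ.real A ≤ 1 / (2 * N) := ENNReal.toReal_le_of_le_ofReal (by positivity) hμA
  have key := rpow_le_of_heatContent (C := 2 * C₁) (V := (Γ.perimeter A).toReal) hQ hN
    measureReal_nonneg hm (by positivity) (fun t ht0 ht1 => by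
      have h1 := Γ.measureReal_sub_inner_heatSemigroup_le hreg hloc hp hC₁ hdom hA ht0.le ht1
      have h2 := hp.inner_indicator_le hA.measurableSet (K := N * t ^ (-(Q / 2))) ht0 fun x y => by
        rw [Real.rpow_neg ht0.le, ← div_eq_mul_inv, le_div_iff₀ (by positivity), mul_comm]
        exact (hM t ⟨ht0, ht1⟩ x y).trans (le_max_left _ _)
      linarith)
  have hQ' : 0 ≤ (Q - 1) / Q := div_nonneg (by linarith) (by linarith)
  rw [← ENNReal.ofReal_toReal (measure_ne_top μ A), ← ENNReal.ofReal_toReal hA.perimeter_ne_top,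
    ENNReal.ofReal_rpow_of_nonneg ENNReal.toReal_nonneg hQ', ← ENNReal.ofReal_mul hC.le]
  exact ENNReal.ofReal_le_ofReal key
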